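/- Let $\mathfrak g=\mathfrak g_{\bar 0}\oplus\mathfrak g_{\bar 1}$ be a basic Lie superalgebra over $\mathbb C$, i.e. $\mathfrak g$ is finite-dimensional and simple, $\mathfrak g_{\bar 0}$ is a reductive Lie algebra, and $\mathfrak g$ carries an even invariant non-degenerate supersymmetric bilinear form $(\cdot|\cdot)$. Let $\mathfrak h$ be a Cartan subalgebra of $\mathfrak g_{\bar 0}$ and assume that $(\alpha|\beta)\in\mathbb R$ for all roots $\alpha,\beta\in\mathfrak h^*$ of $\mathfrak g$ with respect to $\mathfrak h$. Let $e,x,f\in\mathfrak g_{\bar 0}$ with $x\neq 0$ be an $sl_2$-triple, normalised by $[e,f]=x$, $[x,e]=e$, $[x,f]=-f$; put $\mathfrak s=\mathrm{span}_{\mathbb C}\{e,x,f\}$ and let $\mathfrak g^\natural$ be the centralizer of $\mathfrak s$ in $\mathfrak g$. Assume that $$\mathfrak g_{\bar 0}=\mathfrak s\oplus\mathfrak g^\natural ,$$ and that the grading of $\mathfrak g$ by the eigenspaces $\mathfrak g_j$ of $\mathrm{ad}\,x$ is minimal and compatible with parity, i.e. $\mathfrak g_{\bar 0}=\mathfrak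 g_{-1}\oplus\mathfrak g_0\oplus\mathfrak g_1$, $\mathfrak g_{\bar 1}=\mathfrak g_{-1/2}\oplus\mathfrak g_{1/2}$ and $\mathfrak g_{-1}=\mathbb C f$. Then there exists an almost compact conjugate-linear involution of $\mathfrak g$ for $\{e,x,f\}$: a parity-preserving conjugate-linear map $\phi:\mathfrak g\to\mathfrak g$ with $\phi^2=\mathrm{id}$ and $\phi([a,b])=[\phi(a),\phi(b)]$ for all $a,b\in\mathfrak g$, such that (i) $\phi(e)=e$, $\phi(x)=x$, $\phi(f)=f$; (ii) $\phi$ restricts to a compact involution of $\mathfrak g^\natural$, i.e. $\phi(\mathfrak g^\natural)\subseteq\mathfrak g^\natural$ and the real Lie algebra $\{a\in\mathfrak g^\natural:\phi(a)=a\}$ is compact (it admits a positive definite symmetric bilinear form for which all $\mathrm{ad}\,a$ are skew-symmetric). -/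

import Mathlib

open scoped ComplexConjugate

/-- A complex Lie superalgebra structure on the vector space `V`: a decomposition of `V` into an
even part `part 0` and an odd part `part 1`, and an even bilinear bracket which is
super-skew-symmetric and satisfies the super Jacobi identity. -/
structure LieSuperalgebra (V : Type*) [AddCommGroup V] [Module ℂ V] where
  /-- the homogeneous components -/
  part : ZMod 2 → Submodule ℂ V
  isCompl : IsCompl (part 0) (part 1)
  /-- the superbracket -/
  br : V →ₗ[ℂ] V →ₗ[ℂ] V
  br_mem : ∀ (i j : ZMod 2) (a b : V), a ∈ part i → b ∈ part j → br a b ∈ part (i + j)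
  skew : ∀ (i j : ZMod 2) (a b : V), a ∈ part i → b ∈ part j →
    br a b = -((-1 : ℂ) ^ (i.val * j.val) • br b a)
  jacobi : ∀ (i j : ZMod 2) (a b c : V), a ∈ part i → b ∈ part j →
    br a (br b c) = br (br a b) c + (-1 : ℂ) ^ (i.val * j.val) • br b (br a c)

namespace LieSuperalgebra

variable {V : Type*} [AddCommGroup V] [Module ℂ V] (L : LieSuperalgebra V)

/-- The even part, as a type. -/
abbrev Even : Type _ := L.part 0

/-- The even part of a Lie superalgebra is a Lie ring. -/
instance instLieRingEven : LieRing L.Even where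
  bracket a b := ⟨L.br a b, L.br_mem 0 0 a b a.2 b.2⟩
  add_lie a b c := Subtype.ext (by simp)
  lie_add a b c := Subtype.ext (by simp)
  lie_self a := by
    apply Subtype.ext
    have h := L.skew 0 0 a a a.2 a.2
    simp only [ZMod.val_zero, mul_zero, pow_zero, one_smul] at h
    have h2 : (2 : ℂ) • L.br (a : V) (a : V) = 0 := by
      rw [two_smul]
      nth_rewrite 1 [h]
      exact neg_add_cancel _
    exact (smul_eq_zero.mp h2).resolve_left two_ne_zero
  leibniz_lie a b c := by
    apply Subtype.ext
    have h := L.jacobi 0 0 a b c a.2 b.2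
    simp only [ZMod.val_zero, mul_zero, pow_zero, one_smul] at h
    exact h

/-- The even part of a Lie superalgebra is a complex Lie algebra. -/
instance instLieAlgebraEven : LieAlgebra ℂ L.Even where
  lie_smul t a b := Subtype.ext ((L.br (a : V)).map_smul t (b : V))

/-- Simplicity: the bracket is not identically zero, and the only graded ideals are `0` and the
whole algebra. -/
structure IsSimple : Prop where
  non_abelian : ∃ a b : V, L.br a b ≠ 0
  eq_bot_or_eq_top : ∀ I : Submodule ℂ V,
    (I = (I ⊓ L.part 0) ⊔ (I ⊓ L.part 1)) →
    (∀ a : V, ∀ b ∈ I, L.br a b ∈ I) → I = ⊥ ∨ I = ⊤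

/-- Even invariant non-degenerate supersymmetric bilinear forms. -/
structure IsBasicForm (B : V →ₗ[ℂ] V →ₗ[ℂ] ℂ) : Prop where
  even : ∀ a ∈ L.part 0, ∀ b ∈ L.part 1, B a b = 0
  supersymm : ∀ (i j : ZMod 2) (a b : V), a ∈ L.part i → b ∈ L.part j →
    B a b = (-1 : ℂ) ^ (i.val * j.val) * B b a
  invariant : ∀ a b c : V, B (L.br a b) c = B a (L.br b c)
  nondegenerate : ∀ a : V, (∀ b : V, B a b = 0) → a = 0

/-- `L` is a basic Lie superalgebra, with `B` as its bilinear form: it is finite-dimensional and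
simple, its even part is reductive (the radical equals the centre), and `B` is an even invariant
non-degenerate supersymmetric bilinear form on it. -/
structure IsBasic (B : V →ₗ[ℂ] V →ₗ[ℂ] ℂ) : Prop where
  finite : FiniteDimensional ℂ V
  simple : L.IsSimple
  reductive : LieAlgebra.radical ℂ L.Even = LieAlgebra.center ℂ L.Even
  form : L.IsBasicForm B

/-- `α` is a root of `L` with respect to the subalgebra `H` of the even part. -/
def IsRoot (H : LieSubalgebra ℂ L.Even) (α : Module.Dual ℂ H) : Prop :=
  α ≠ 0 ∧ ∃ v : V, v ≠ 0 ∧ ∀ t : H, L.br ((t : L.Even) : V) v = α t • v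

/-- `t ∈ H` represents `α ∈ H*` through the bilinear form: `(t | s) = α s` for all `s ∈ H`. -/
def Represents (B : V →ₗ[ℂ] V →ₗ[ℂ] ℂ) (H : LieSubalgebra ℂ L.Even) (t : H)
    (α : Module.Dual ℂ H) : Prop :=
  ∀ s : H, B ((t : L.Even) : V) ((s : L.Even) : V) = α s

/-- All scalar products `(α | β)` of roots are real; here `(α | β) = (t | u)` where `t, u ∈ H`
represent `α, β`. -/
def HasRealRootProducts (B : V →ₗ[ℂ] V →ₗ[ℂ] ℂ) (H : LieSubalgebra ℂ L.Even) : Prop :=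
  ∀ α β : Module.Dual ℂ H, L.IsRoot H α → L.IsRoot H β →
    ∀ t u : H, L.Represents B H t α → L.Represents B H u β →
      ∃ r : ℝ, B ((t : L.Even) : V) ((u : L.Even) : V) = (r : ℂ)

/-- `{e, x, f}` is an `sl₂`-triple of even elements, normalised by
`[e, f] = x`, `[x, e] = e`, `[x, f] = -f`. -/
structure IsTriple (e x f : V) : Prop where
  e_even : e ∈ L.part 0
  x_even : x ∈ L.part 0
  f_even : f ∈ L.part 0
  x_ne_zero : x ≠ 0
  br_e_f : L.br e f = x
  br_x_e : L.br x e = e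
  br_x_f : L.br x f = -f

/-- The centralizer `g^♮` in `L` of the span of `{e, x, f}`. -/
def natural (e x f : V) : Submodule ℂ V :=
  LinearMap.ker (L.br e) ⊓ LinearMap.ker (L.br x) ⊓ LinearMap.ker (L.br f)

/-- The even part is the direct sum of the span of `{e, x, f}` and of its centralizer in `L`. -/
def EvenPartSplits (e x f : V) : Prop :=
  Disjoint (Submodule.span ℂ {e, x, f}) (L.natural e x f) ∧
    Submodule.span ℂ {e, x, f} ⊔ L.natural e x f = L.part 0

/-- The eigenspace of `ad x` for the eigenvalue `j`. -/
def eigen (x : V) (j : ℂ) : Submodule ℂ V := Module.End.eigenspace (L.br x) j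

/-- The grading by the eigenvalues of `ad x` is minimal and compatible with parity: `ad x` is
diagonalizable with eigenvalues among `0, ±1` on the even part and among `±1/2` on the odd part,
and its eigenspace for the eigenvalue `-1` is spanned by `f`. -/
structure IsMinimalGrading (x f : V) : Prop where
  even_le : L.part 0 ≤ L.eigen x (-1) ⊔ L.eigen x 0 ⊔ L.eigen x 1
  odd_le : L.part 1 ≤ L.eigen x (-(1 / 2)) ⊔ L.eigen x (1 / 2)
  eigen_neg_one : L.eigen x (-1) = Submodule.span ℂ {f}

/-- Conjugate-linear involutions (of order dividing two, parity preserving) of a Lie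
superalgebra. -/
structure IsConjInvolution (φ : V →ₛₗ[starRingEnd ℂ] V) : Prop where
  involutive : ∀ a : V, φ (φ a) = a
  parity : ∀ (i : ZMod 2) (a : V), a ∈ L.part i → φ a ∈ L.part i
  map_br : ∀ a b : V, φ (L.br a b) = L.br (φ a) (φ b)

/-- `φ` restricts to a compact conjugate-linear involution of the subalgebra `K`: it maps `K` to
itself, and the real Lie algebra `{a ∈ K | φ a = a}` is compact, that is, it carries a positive
definite symmetric real bilinear form for which all `ad a` are skew. (The form is written as the
restriction of a real bilinear form on `V`; nothing is asked of it outside the fixed points.) -/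
def IsCompactOn (φ : V →ₛₗ[starRingEnd ℂ] V) (K : Submodule ℂ V) : Prop :=
  (∀ a ∈ K, φ a ∈ K) ∧
  ∃ β : V →ₗ[ℝ] V →ₗ[ℝ] ℝ,
    (∀ a ∈ K, ∀ b ∈ K, φ a = a → φ b = b → β a b = β b a) ∧
    (∀ a ∈ K, φ a = a → a ≠ 0 → 0 < β a a) ∧
    (∀ a ∈ K, ∀ b ∈ K, ∀ c ∈ K, φ a = a → φ b = b → φ c = c →
      β (L.br a b) c = -β b (L.br a c))

/-- Almost compact conjugate-linear involutions, for the `sl₂`-triple `{e, x, f}`. -/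
structure IsAlmostCompact (e x f : V) (φ : V →ₛₗ[starRingEnd ℂ] V) : Prop where
  conjInvolution : L.IsConjInvolution φ
  map_e : φ e = e
  map_x : φ x = x
  map_f : φ f = f
  compact : L.IsCompactOn φ (L.natural e x f)

end LieSuperalgebra

/-! Let `M` be the `-1/2`-eigenspace of `ad x`. The odd part is `M ⊕ [e, M]`, that is `ℂ² ⊗ M`, and
the superbracket is encoded by the action of `g^♮` on `M`, a symmetric form `q` with `[m, n] = q(m,
n) f`, and a skew map `T : M × M → g^♮` with `[[e, m], n] = q(m, n) x / 2 - T(m, n) / 4`. The axioms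
of `L` translate into `IsMomentMap`; simplicity makes the action faithful and the values of `T` span
`g^♮`. So `φ` exists as soon as `M` has a conjugation `J` compatible with `q` and with `(m, n, p) ↦
[T(m, n), p]`.

Such a `J` is sought as the conjugation permuting a basis `b` by an involution `ν` that describes
duality under `q` (`IsCompactBasis`). Then `q(m, J n)` is the Hermitian form with orthonormal basis
`b`. Elements of `g^♮` fixed by the conjugation act by skew-Hermitian matrices, so minus the trace
form is positive definite on them and compactness is automatic.

If `M` is reducible, the Jacobi identity makes every proper invariant subspace isotropic, so there
is an invariant Lagrangian `U`. A grading element yields a complementary Lagrangian on which `T`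
vanishes, and all coefficients of `T` are then integer combinations of Kronecker deltas
(`exists_isCompactBasis_of_invariant`).

If `M` is irreducible, `g^♮` is semisimple and the weights of `M` have multiplicity one. Rescaling a
weight basis by the torus, a Kempf–Ness argument minimises the norm of the tensor of coefficients of
`T`. At the critical point the adjoints of root operators again preserve this tensor, hence come
from `g^♮` (`IsWeightBasis.exists_adjoint`). This gives the symmetry under `ν` up to a scalar for
each root, which is `1` because the diagonal coefficients are real (`IsWeightBasis.isCompactBasis`).
That reality is where the scalar products of roots enter: each weight of `M` gives two odd roots,
whose products with other roots average to the coefficients wanted (`exists_real_halfForm`). -/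

set_option linter.unusedSectionVars false

/-! ### Orthogonal representations with a curvature-type map, and the reducible case. -/

section MomentMap

variable {𝔤 M : Type*} [LieRing 𝔤] [LieAlgebra ℂ 𝔤] [AddCommGroup M] [Module ℂ M]
  [LieRingModule 𝔤 M] [LieModule ℂ 𝔤 M]

/-- An orthogonal representation `M` of `𝔤`, with a skew equivariant map `T : M × M → 𝔤` of
curvature type: these are the data which determine the bracket of a Lie superalgebra with odd part
`ℂ² ⊗ M` and even part `sl₂ ⊕ 𝔤`. -/
structure IsMomentMap (q : M →ₗ[ℂ] M →ₗ[ℂ] ℂ) (T : M →ₗ[ℂ] M →ₗ[ℂ] 𝔤) : Prop where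
  symm : ∀ m n, q m n = q n m
  nondeg : ∀ m, (∀ n, q m n = 0) → m = 0
  skew : ∀ (a : 𝔤) (m n : M), q ⁅a, m⁆ n = -q m ⁅a, n⁆
  map_skew : ∀ m n, T m n = -T n m
  equivariant : ∀ (a : 𝔤) (m n : M), ⁅a, T m n⁆ = T ⁅a, m⁆ n + T m ⁅a, n⁆
  pair_symm : ∀ m n p r, q ⁅T m n, p⁆ r = q ⁅T p r, m⁆ n
  jacobi : ∀ m n p, ⁅T n p, m⁆ + ⁅T m p, n⁆ = q n p • m + q m p • n - (2 * q m n) • p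
  faithful : ∀ a : 𝔤, (∀ m : M, ⁅a, m⁆ = 0) → a = 0
  span : Submodule.span ℂ {a | ∃ m n, a = T m n} = ⊤

/-- A basis of `M` permuted by the conjugation of a compact real form. -/
structure IsCompactBasis {ι : Type*} [DecidableEq ι] (q : M →ₗ[ℂ] M →ₗ[ℂ] ℂ)
    (T : M →ₗ[ℂ] M →ₗ[ℂ] 𝔤) (b : Module.Basis ι ℂ M) (ν : ι → ι) : Prop where
  involutive : ∀ i, ν (ν i) = i
  form : ∀ i j, q (b i) (b j) = if j = ν i then 1 else 0
  real : ∀ i j k l, conj (q ⁅T (b i) (b j), b k⁆ (b l)) =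
    q ⁅T (b (ν i)) (b (ν j)), b (ν k)⁆ (b (ν l))

namespace IsMomentMap

variable {q : M →ₗ[ℂ] M →ₗ[ℂ] ℂ} {T : M →ₗ[ℂ] M →ₗ[ℂ] 𝔤}

theorem map_self (h : IsMomentMap q T) (m : M) : T m m = 0 := by
  have := h.map_skew m m
  have h2 : (2 : ℂ) • T m m = 0 := by
    rw [two_smul]; nth_rewrite 1 [this]; simp
  exact (smul_eq_zero.mp h2).resolve_left two_ne_zero

theorem lie_map_self (h : IsMomentMap q T) (m p : M) :
    ⁅T m p, m⁆ = q m p • m - q m m • p := by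
  have := h.jacobi m m p
  have h2 : (2 : ℂ) • (⁅T m p, m⁆ - (q m p • m - q m m • p)) = 0 := by
    rw [smul_sub, two_smul, this]; module
  exact sub_eq_zero.mp ((smul_eq_zero.mp h2).resolve_left two_ne_zero)

theorem ext_form (h : IsMomentMap q T) {m n : M} (hmn : ∀ p, q m p = q n p) : m = n := by
  refine sub_eq_zero.mp (h.nondeg _ fun p => ?_)
  simp [hmn]

theorem form_eq (h : IsMomentMap q T) (m n p r : M) :
    q ⁅T n p, m⁆ r + q ⁅T m p, n⁆ r = q n p * q m r + q m p * q n r - 2 * q m n * q p r := by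
  have := congrArg (fun v => q v r) (h.jacobi m n p)
  simpa using this

theorem form_skew_left (h : IsMomentMap q T) (m n p r : M) :
    q ⁅T m n, p⁆ r = -q ⁅T n m, p⁆ r := by
  rw [h.map_skew m n]; simp

theorem form_skew_right (h : IsMomentMap q T) (m n p r : M) :
    q ⁅T m n, p⁆ r = -q ⁅T m n, r⁆ p := by
  rw [h.skew, h.symm]

/-- Invariance of the Lagrangian spanned by `u`, the vanishing of `T` on the `p`'s and pair symmetry
kill every coefficient except those with one `u` and one `p` in each pair. `form_eq` evaluates these
as `δ_ij δ_kl - 2 δ_ik δ_jl` up to sign. They are real and unchanged when `u` and `p` are exchanged.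
-/
theorem isCompactBasis_of_lagrangian (h : IsMomentMap q T) {d : Type*} [Fintype d] [DecidableEq d]
    (u p : d → M) (huu : ∀ i j, q (u i) (u j) = 0)
    (hup : ∀ i j, q (u i) (p j) = if i = j then 1 else 0) (hpp : ∀ i j, q (p i) (p j) = 0)
    (hT : ∀ i j, T (p i) (p j) = 0)
    (hinv : ∀ (a : 𝔤) i, ⁅a, u i⁆ ∈ Submodule.span ℂ (Set.range u))
    (hmax : ∀ m, (∀ i, q (u i) m = 0) → m ∈ Submodule.span ℂ (Set.range u)) :
    ∃ b : Module.Basis (d ⊕ d) ℂ M, IsCompactBasis q T b Sum.swap := by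
  have hpu : ∀ i j, q (p i) (u j) = if j = i then 1 else 0 := fun i j => by rw [h.symm, hup]
  have hspu : ∀ m ∈ Submodule.span ℂ (Set.range u), ∀ j, q m (u j) = 0 := by
    intro m hm j
    induction hm using Submodule.span_induction with
    | mem x hx => obtain ⟨i, rfl⟩ := hx; exact huu i j
    | zero => simp
    | add x y _ _ hx hy => simp [hx, hy]
    | smul a x _ hx => simp [hx]
  let v : d ⊕ d → M := Sum.elim u p
  have hform : ∀ i j, q (v i) (v j) = if j = Sum.swap i then 1 else 0 := by
    rintro (i | i) (j | j) <;> simp [v, huu, hup, hpu, hpp, eq_comm]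
  have hli : LinearIndependent ℂ v := by
    rw [Fintype.linearIndependent_iff]
    intro g hg i
    have := congrArg (fun m => q m (v (Sum.swap i))) hg
    rcases i with i | i <;> simpa [v, huu, hup, hpu, hpp] using this
  have hsp : ⊤ ≤ Submodule.span ℂ (Set.range v) := by
    intro m _
    have h1 : m - ∑ i, q (u i) m • p i ∈ Submodule.span ℂ (Set.range u) :=
      hmax _ fun i => by simp [hup]
    have h2 : Submodule.span ℂ (Set.range u) ≤ Submodule.span ℂ (Set.range v) :=
      Submodule.span_mono (by rintro _ ⟨i, rfl⟩; exact ⟨Sum.inl i, rfl⟩)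
    have h3 : ∑ i, q (u i) m • p i ∈ Submodule.span ℂ (Set.range v) :=
      Submodule.sum_mem _ fun i _ => Submodule.smul_mem _ _
        (Submodule.subset_span ⟨Sum.inr i, rfl⟩)
    simpa using add_mem (h2 h1) h3
  have u3 : ∀ a i j, q ⁅(a : 𝔤), u i⁆ (u j) = 0 := fun a i j => hspu _ (hinv a i) j
  have uL : ∀ i j (m n : M), q ⁅T m n, u i⁆ (u j) = 0 := fun i j m n => u3 _ i j
  have uR : ∀ i j (m n : M), q ⁅T (u i) (u j), m⁆ n = 0 := fun i j m n => by
    rw [h.pair_symm, u3]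
  have pL : ∀ i j (m n : M), q ⁅T (p i) (p j), m⁆ n = 0 := fun i j m n => by simp [hT]
  have pR : ∀ i j (m n : M), q ⁅T m n, p i⁆ (p j) = 0 := fun i j m n => by
    rw [h.pair_symm, pL]
  have up : ∀ i j k l, q ⁅T (u i) (p j), p k⁆ (u l) =
      (if i = j then 1 else 0) * (if k = l then 1 else 0) -
        2 * (if i = k then 1 else 0) * (if j = l then 1 else 0) := by
    intro i j k l
    have := h.form_eq (u i) (p k) (p j) (u l)
    rw [pL, zero_add] at this
    rw [this]; simp [hpp, hup, hpu, eq_comm]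
  refine ⟨Module.Basis.mk hli hsp, Sum.swap_swap, fun i j => by simp [hform], ?_⟩
  simp only [Module.Basis.mk_apply]
  have pu' : ∀ i j k l, q ⁅T (p i) (u j), p k⁆ (u l) = -q ⁅T (u j) (p i), p k⁆ (u l) :=
    fun i j k l => h.form_skew_left ..
  have up' : ∀ i j k l, q ⁅T (u i) (p j), u k⁆ (p l) = -q ⁅T (u i) (p j), p l⁆ (u k) :=
    fun i j k l => h.form_skew_right ..
  have pu'' : ∀ i j k l, q ⁅T (p i) (u j), u k⁆ (p l) = q ⁅T (u j) (p i), p l⁆ (u k) :=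
    fun i j k l => by rw [h.form_skew_left, h.form_skew_right, neg_neg]
  have c1 : ∀ P : Prop, ∀ [Decidable P], conj (if P then (1 : ℂ) else 0) = if P then 1 else 0 := by
    intro P _; split_ifs <;> simp
  rintro (i | i) (j | j) (k | k) (l | l) <;>
    simp only [v, Sum.elim_inl, Sum.elim_inr, Sum.swap_inl, Sum.swap_inr, uL, uR, pL, pR, map_zero,
      pu'', pu', up', up, map_sub, map_neg, map_mul, c1, map_ofNat] <;>
    simp only [eq_comm] <;> ring

/-- The dual family `p` is only determined modulo the span `U` of `u`. It has to be corrected so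
that it becomes isotropic and `T` vanishes on it. -/
theorem exists_isCompactBasis_of_dual_families (h : IsMomentMap q T) {d : Type*} [Fintype d]
    [DecidableEq d]
    (u p : d → M) (huu : ∀ i j, q (u i) (u j) = 0)
    (hup : ∀ i j, q (u i) (p j) = if i = j then 1 else 0)
    (hinv : ∀ (a : 𝔤), ∀ m ∈ Submodule.span ℂ (Set.range u),
      ⁅a, m⁆ ∈ Submodule.span ℂ (Set.range u))
    (hmax : ∀ m, (∀ i, q (u i) m = 0) → m ∈ Submodule.span ℂ (Set.range u)) :
    ∃ b : Module.Basis (d ⊕ d) ℂ M, IsCompactBasis q T b Sum.swap := by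
  have hu : ∀ i, u i ∈ Submodule.span ℂ (Set.range u) := fun i => Submodule.subset_span ⟨i, rfl⟩
  have hspu : ∀ m ∈ Submodule.span ℂ (Set.range u), ∀ j, q (u j) m = 0 := by
    intro m hm j
    induction hm using Submodule.span_induction with
    | mem x hx => obtain ⟨i, rfl⟩ := hx; exact huu j i
    | zero => simp
    | add x y _ _ hx hy => simp [hx, hy]
    | smul a x _ hx => simp [hx]
  have hspp : ∀ m ∈ Submodule.span ℂ (Set.range u), ∀ n,
      (∀ i, q n (u i) = 0) → q n m = 0 := by
    intro m hm n hn
    induction hm using Submodule.span_induction with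
    | mem x hx => obtain ⟨i, rfl⟩ := hx; exact hn i
    | zero => simp
    | add x y _ _ hx hy => simp [hx, hy]
    | smul a x _ hx => simp [hx]
  have hzero : ∀ (p' : d → M) (_ : ∀ i j, q (u i) (p' j) = if i = j then 1 else 0) (v : M),
      (∀ i, q v (u i) = 0) → (∀ i, q v (p' i) = 0) → v = 0 := by
    intro p' hp' v h1 h2
    refine h.nondeg v fun n => ?_
    have h3 : n - ∑ i, q (u i) n • p' i ∈ Submodule.span ℂ (Set.range u) :=
      hmax _ fun i => by simp [hp']
    have h4 := hspp _ h3 v h1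
    simpa [h2] using h4
  have hact : ∀ (p' : d → M) (_ : ∀ i j, q (u i) (p' j) = if i = j then 1 else 0) (a : 𝔤),
      (∀ i, ⁅a, u i⁆ = 0) → (∀ i, ⁅a, p' i⁆ = 0) → a = 0 := by
    intro p' hp' a h1 h2
    refine h.faithful a fun m => ?_
    refine hzero p' hp' _ (fun i => ?_) (fun i => ?_)
    · rw [h.skew, h1]; simp
    · rw [h.skew, h2]; simp
  -- The grading element used below acts by `± (d - 2)`, so `d = 2` is treated apart. There isotropy
  -- suffices: `T(p'_i, p'_j)` kills `p'_i` and `p'_j` by `lie_map_self`, and there are no other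
  -- `p'_k`.
  by_cases hd : Fintype.card d = 2
  · let p' : d → M := fun i => p i - (1 / 2 : ℂ) • ∑ j, q (p i) (p j) • u j
    have hup' : ∀ i j, q (u i) (p' j) = if i = j then 1 else 0 := fun i j => by
      simp [p', huu, hup]
    have hpp' : ∀ i j, q (p' i) (p' j) = 0 := fun i j => by
      have e1 : ∀ i j, q (p i) (u j) = if j = i then 1 else 0 := fun i j => by
        rw [h.symm, hup]
      simp only [p', map_sub, LinearMap.sub_apply, map_smul, LinearMap.smul_apply, map_sum,
        LinearMap.sum_apply, huu, e1, hup, smul_eq_mul, mul_ite, mul_one, mul_zero]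
      simp [h.symm (p j) (p i)]
      ring
    have hTk : ∀ i j, T (p' i) (p' j) = 0 := by
      intro i j
      by_cases hij : i = j
      · rw [hij]; exact h.map_self _
      have hk : ∀ k, k = i ∨ k = j := by
        intro k
        by_contra hk
        push Not at hk
        have := Finset.card_le_univ {i, j, k}
        rw [hd, Finset.card_eq_three.mpr ⟨i, j, k, hij, hk.1.symm, hk.2.symm, rfl⟩] at this
        omega
      have hp0 : ∀ k, ⁅T (p' i) (p' j), p' k⁆ = 0 := by
        intro k
        rcases hk k with rfl | rfl
        · rw [h.lie_map_self, hpp', hpp']; simp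
        · rw [h.map_skew, neg_lie, h.lie_map_self, hpp', hpp']; simp
      refine hact p' hup' _ (fun k => ?_) hp0
      refine hzero p' hup' _ (fun l => ?_) (fun l => ?_)
      · rw [h.symm]; exact hspu _ (hinv _ _ (hu k)) l
      · rw [h.skew, hp0]; simp
    exact h.isCompactBasis_of_lagrangian u p' huu hup' hpp' hTk (fun a i => hinv a _ (hu i)) hmax
  · let s : ℂ := (Fintype.card d : ℂ) - 2
    have hs : s ≠ 0 := by
      intro h0
      apply hd
      exact_mod_cast sub_eq_zero.mp h0
    -- A grading element: by the Jacobi identity it acts on `M / U` as `s`, hence on `U`, dual to `M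
    -- / U`, as `-s`.
    let E : 𝔤 := ∑ i, T (u i) (p i)
    have hEn : ∀ n, ⁅E, n⁆ - s • n ∈ Submodule.span ℂ (Set.range u) := by
      intro n
      have h1 : ⁅E, n⁆ - s • n = ∑ i, (q n (p i) • u i - ⁅T n (p i), u i⁆) +
          (2 : ℂ) • (n - ∑ i, q (u i) n • p i) := by
        have h2 : ∀ i, ⁅T (u i) (p i), n⁆ = (q n (p i) • u i - ⁅T n (p i), u i⁆) + n -
            (2 : ℂ) • q (u i) n • p i := by
          intro i
          have := h.jacobi (u i) n (p i)
          rw [hup, if_pos rfl] at this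
          rw [← sub_eq_iff_eq_add'.mpr this.symm]
          module
        simp only [E, sum_lie, h2, Finset.sum_sub_distrib, Finset.sum_add_distrib,
          Finset.sum_const, Finset.card_univ, smul_sub, Finset.smul_sum, s]
        rw [← Nat.cast_smul_eq_nsmul ℂ]
        module
      rw [h1]
      refine add_mem (Submodule.sum_mem _ fun i _ => sub_mem (Submodule.smul_mem _ _ (hu i))
        (hinv _ _ (hu i))) (Submodule.smul_mem _ _ (hmax _ fun i => by simp [hup]))
    have hEu : ∀ m ∈ Submodule.span ℂ (Set.range u), ⁅E, m⁆ = -s • m := by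
      intro m hm
      refine h.ext_form fun n => ?_
      have h1 : q m (⁅E, n⁆ - s • n) = 0 :=
        hspp _ (hEn n) m fun i => by rw [h.symm]; exact hspu m hm i
      rw [map_sub, map_smul, sub_eq_zero, smul_eq_mul] at h1
      rw [h.skew, h1]; simp
    -- With `w = [E, p i] - s p i` in `U` and `[E, w] = -s w`, the vector `p i + c w` is an
    -- `s`-eigenvector exactly when `2 s c w = w`.
    let p' : d → M := fun i => p i + (1 / (2 * s)) • (⁅E, p i⁆ - s • p i)
    have hup' : ∀ i j, q (u i) (p' j) = if i = j then 1 else 0 := fun i j => by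
      simp only [p', map_add, map_smul, hspu _ (hEn (p j)) i, hup]; simp
    have hEp : ∀ i, ⁅E, p' i⁆ = s • p' i := by
      intro i
      have h1 := hEu _ (hEn (p i))
      simp only [p', lie_add, lie_smul, h1]
      have h2 : ⁅E, p i⁆ = (⁅E, p i⁆ - s • p i) + s • p i := by abel
      rw [h2]
      generalize ⁅E, p i⁆ - s • p i = w
      match_scalars <;> field_simp <;> ring
    have hpp' : ∀ i j, q (p' i) (p' j) = 0 := by
      intro i j
      have h1 := h.skew E (p' i) (p' j)
      simp only [hEp, map_smul, LinearMap.smul_apply, smul_eq_mul] at h1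
      have h2 : (2 * s) * q (p' i) (p' j) = 0 := by linear_combination h1
      exact (mul_eq_zero.mp h2).resolve_left (mul_ne_zero two_ne_zero hs)
    have hvz : ∀ (v : M) (k : ℂ), ⁅E, v⁆ = k • v → k ≠ s → k ≠ -s → v = 0 := by
      intro v k hv h1 h2
      refine hzero p' hup' v (fun i => ?_) (fun i => ?_)
      · have h3 := h.skew E v (u i)
        simp only [hv, hEu _ (hu i), map_smul, LinearMap.smul_apply, smul_eq_mul] at h3
        have h4 : (k - s) * q v (u i) = 0 := by linear_combination h3
        exact (mul_eq_zero.mp h4).resolve_left (sub_ne_zero.mpr h1)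
      · have h3 := h.skew E v (p' i)
        simp only [hv, hEp, map_smul, LinearMap.smul_apply, smul_eq_mul] at h3
        have h4 : (k + s) * q v (p' i) = 0 := by linear_combination h3
        exact (mul_eq_zero.mp h4).resolve_left fun h5 => h2 (eq_neg_of_add_eq_zero_left h5)
    have hTk : ∀ i j, T (p' i) (p' j) = 0 := by
      intro i j
      have hED : ⁅E, T (p' i) (p' j)⁆ = (2 * s) • T (p' i) (p' j) := by
        rw [h.equivariant, hEp, hEp]; simp; module
      -- `T(p'_i, p'_j)` raises eigenvalues of `E` by `2s`. It sends `u k` to eigenvalue `s`, while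
      -- invariance of `U` demands `-s`; it sends `p'_k` to `3s`, which is neither `s` nor `-s`.
      refine hact p' hup' _ (fun k => ?_) (fun k => ?_)
      · have hm := hinv (T (p' i) (p' j)) _ (hu k)
        have h1 := hEu _ hm
        rw [leibniz_lie, hED, hEu _ (hu k), smul_lie, lie_smul] at h1
        have h2 : (2 * s) • ⁅T (p' i) (p' j), u k⁆ = 0 := by
          rw [← sub_eq_zero.mpr h1]; module
        exact (smul_eq_zero.mp h2).resolve_left (mul_ne_zero two_ne_zero hs)
      · refine hvz _ (3 * s) ?_ (fun h3 => hs ?_) (fun h3 => hs ?_)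
        · rw [leibniz_lie, hED, hEp, smul_lie, lie_smul]; module
        · linear_combination h3 / 2
        · linear_combination h3 / 4
    exact h.isCompactBasis_of_lagrangian u p' huu hup' hpp' hTk (fun a i => hinv a _ (hu i)) hmax

/-- For `m, n` in `U`, every term of the Jacobi identity except `2 q(m, n) p` lies in `U`, for
arbitrary `p`. -/
theorem isotropic_of_invariant (h : IsMomentMap q T) (U : Submodule ℂ M) (hU : U ≠ ⊤)
    (hinv : ∀ (a : 𝔤), ∀ m ∈ U, ⁅a, m⁆ ∈ U) : ∀ m ∈ U, ∀ n ∈ U, q m n = 0 := by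
  intro m hm n hn
  obtain ⟨p, -, hp⟩ := SetLike.exists_of_lt (lt_top_iff_ne_top.mpr hU)
  by_contra hq
  have h1 := h.jacobi m n p
  have h2 : (2 * q m n) • p = q n p • m + q m p • n - (⁅T n p, m⁆ + ⁅T m p, n⁆) := by
    rw [h1]; abel
  have h3 : (2 * q m n) • p ∈ U := by
    rw [h2]
    exact sub_mem (add_mem (U.smul_mem _ hm) (U.smul_mem _ hn)) (add_mem (hinv _ _ hm) (hinv _ _ hn))
  exact hp ((U.smul_mem_iff (mul_ne_zero two_ne_zero hq)).mp h3)

/-- The case of a reducible representation. -/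
theorem exists_isCompactBasis_of_invariant [FiniteDimensional ℂ M] (h : IsMomentMap q T)
    (U : Submodule ℂ M) (hU : U ≠ ⊤) (hU0 : U ≠ ⊥) (hinv : ∀ (a : 𝔤), ∀ m ∈ U, ⁅a, m⁆ ∈ U) :
    ∃ (n : ℕ) (b : Module.Basis (Fin n ⊕ Fin n) ℂ M), IsCompactBasis q T b Sum.swap := by
  have hiso := h.isotropic_of_invariant U hU hinv
  -- The orthogonal of `U` is invariant, and proper since `U ≠ 0`, hence isotropic too. So `W ≤ W^⊥
  -- = U`, and `U` is Lagrangian.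
  let W : Submodule ℂ M :=
    { carrier := {m | ∀ n ∈ U, q m n = 0}
      add_mem' := fun ha hb n hn => by simp [ha n hn, hb n hn]
      zero_mem' := fun n _ => by simp
      smul_mem' := fun c a ha n hn => by simp [ha n hn] }
  have hW : ∀ m, m ∈ W ↔ ∀ n ∈ U, q m n = 0 := fun m => Iff.rfl
  have hWinv : ∀ (a : 𝔤), ∀ m ∈ W, ⁅a, m⁆ ∈ W := fun a m hm n hn => by
    rw [h.skew, hm _ (hinv a n hn), neg_zero]
  have hWtop : W ≠ ⊤ := by
    intro hW'
    apply hU0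
    rw [Submodule.eq_bot_iff]
    intro m hm
    refine h.nondeg m fun n => ?_
    rw [h.symm]
    exact (hW n).mp (hW' ▸ Submodule.mem_top) m hm
  have hWiso := h.isotropic_of_invariant W hWtop hWinv
  -- the form gives a surjection onto the dual of `U`
  let u := Module.finBasis ℂ U
  have hqker : LinearMap.ker q = ⊥ := by
    rw [LinearMap.ker_eq_bot']
    intro m hm
    exact h.nondeg m fun n => by rw [hm]; rfl
  have hqsurj : Function.Surjective q :=
    (LinearMap.injective_iff_surjective_of_finrank_eq_finrank
      (Subspace.dual_finrank_eq (K := ℂ) (V := M)).symm).mp (LinearMap.ker_eq_bot.mp hqker)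
  have hdual : ∀ f : U →ₗ[ℂ] ℂ, ∃ m, ∀ n : U, q m n = f n := by
    intro f
    obtain ⟨g, hg⟩ := LinearMap.exists_extend f
    obtain ⟨m, hm⟩ := hqsurj g
    exact ⟨m, fun n => by rw [hm, ← hg]; rfl⟩
  choose p hp using fun i => hdual (u.coord i)
  have hspan : Submodule.span ℂ (Set.range fun i => (u i : M)) = U := by
    have := congrArg (Submodule.map U.subtype) u.span_eq
    rw [Submodule.map_span, ← Set.range_comp] at this
    simpa [Function.comp_def] using this
  have hWU : W ≤ U := by
    intro m hm
    by_contra hmU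
    obtain ⟨f, hfm, hf⟩ := Submodule.exists_le_ker_of_notMem hmU
    obtain ⟨n, rfl⟩ := hqsurj f
    have hn : n ∈ W := fun k hk => hf hk
    exact hfm (hWiso n hn m hm)
  refine ⟨_, h.exists_isCompactBasis_of_dual_families (fun i => (u i : M)) p
    (fun i j => hiso _ (u i).2 _ (u j).2) (fun i j => ?_) ?_ ?_⟩
  · rw [h.symm, hp]; simp [Finsupp.single_apply]
  · rw [hspan]; exact hinv
  · rw [hspan]
    intro m hm
    refine hWU fun n hn => ?_
    rw [← hspan] at hn
    induction hn using Submodule.span_induction with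
    | mem x hx => obtain ⟨i, rfl⟩ := hx; rw [h.symm]; exact hm i
    | zero => simp
    | add x y _ _ hx hy => simp [hx, hy]
    | smul a x _ hx => simp [hx]

end IsMomentMap
end MomentMap

/-! ### The Kempf–Ness argument for a torus. -/

section KempfNess

open Matrix Kronecker

/-- A sum of exponentials of linear forms whose set of exponents is symmetric has a critical
point. -/
theorem exists_critical_point_sum_exp {E S : Type*} [AddCommGroup E] [Module ℝ E] [Fintype S]
    (Λ : E →ₗ[ℝ] S → ℝ) (c : S → ℝ) (hc : ∀ s, 0 < c s) (σ : S → S)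
    (hσ : ∀ τ s, Λ τ (σ s) = -Λ τ s) :
    ∃ τ, ∀ D, ∑ s, Λ D s * (c s * Real.exp (Λ τ s)) = 0 := by
  obtain ⟨m, hm, hmc⟩ : ∃ m > 0, ∀ s, m ≤ c s := by
    rcases isEmpty_or_nonempty S with _ | _
    · exact ⟨1, one_pos, fun s => isEmptyElim s⟩
    · obtain ⟨s, hs⟩ := Finite.exists_min c
      exact ⟨c s, hc s, hs⟩
  -- The minimum is taken on the range of `Λ`, since the kernel would destroy properness. Both `y s`
  -- and `-y s` occur as exponents, so `F y ≥ m ‖y‖`.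
  let F : LinearMap.range Λ → ℝ := fun y => ∑ s, c s * Real.exp ((y : S → ℝ) s)
  have hFc : Continuous F := by
    refine continuous_finsetSum _ fun s _ => continuous_const.mul (Real.continuous_exp.comp ?_)
    exact (continuous_apply s).comp continuous_subtype_val
  have hle : ∀ (y : LinearMap.range Λ) s, m * (y : S → ℝ) s ≤ F y := by
    intro y s
    have h1 : c s * Real.exp ((y : S → ℝ) s) ≤ F y :=
      Finset.single_le_sum (f := fun s => c s * Real.exp ((y : S → ℝ) s))
        (fun s _ => (mul_pos (hc s) (Real.exp_pos _)).le) (Finset.mem_univ s)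
    refine le_trans ?_ h1
    calc m * (y : S → ℝ) s ≤ m * Real.exp ((y : S → ℝ) s) := by
          gcongr; linarith [Real.add_one_le_exp ((y : S → ℝ) s)]
      _ ≤ _ := by gcongr; exact hmc s
  have hF : ∀ y, m * ‖y‖ ≤ F y := by
    intro y
    have hF0 : 0 ≤ F y := Finset.sum_nonneg fun s _ => (mul_pos (hc s) (Real.exp_pos _)).le
    rw [← le_div_iff₀' hm]
    change ‖(y : S → ℝ)‖ ≤ _
    rw [pi_norm_le_iff_of_nonneg (div_nonneg hF0 hm.le)]
    intro s
    rw [Real.norm_eq_abs, le_div_iff₀' hm, abs_eq_max_neg]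
    rcases max_choice ((y : S → ℝ) s) (-(y : S → ℝ) s) with h | h <;> rw [h]
    · exact hle y s
    · obtain ⟨τ, hτ⟩ := y.2
      rw [← hτ, ← hσ, hτ]
      exact hle y _
  have hlim : Filter.Tendsto F (Filter.cocompact _) Filter.atTop := by
    refine Filter.tendsto_atTop_mono hF ?_
    exact Filter.Tendsto.const_mul_atTop hm tendsto_norm_cocompact_atTop
  obtain ⟨⟨y, τ, rfl⟩, hy⟩ := hFc.exists_forall_le hlim
  refine ⟨τ, fun D => ?_⟩
  have hd : HasDerivAt (fun t : ℝ => ∑ s, c s * Real.exp (Λ τ s + t * Λ D s))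
      (∑ s, c s * (Real.exp (Λ τ s + 0 * Λ D s) * Λ D s)) 0 := by
    refine HasDerivAt.fun_sum fun s _ => HasDerivAt.const_mul _ (HasDerivAt.exp ?_)
    simpa using ((hasDerivAt_id (0 : ℝ)).mul_const (Λ D s)).const_add (Λ τ s)
  have hmin : IsLocalMin (fun t : ℝ => ∑ s, c s * Real.exp (Λ τ s + t * Λ D s)) 0 := by
    refine Filter.Eventually.of_forall fun t => ?_
    have := hy ⟨Λ (τ + t • D), LinearMap.mem_range_self _ _⟩
    simpa [F] using this
  have h0 := hmin.hasDerivAt_eq_zero hd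
  rw [← h0]
  refine Finset.sum_congr rfl fun s _ => ?_
  simp; ring

/-- Exchanging `a` and `b` negates the exponent. As the support of `w` is symmetric, restricting the
sum to it gives positive coefficients with a symmetric set of exponents. -/
theorem exists_critical_torus_point {ι : Type*} [Fintype ι] (ν : ι → ι)
    (w : ι × ι → ι × ι → ℝ) (hw : ∀ a b, 0 ≤ w a b) (hsymm : ∀ a b, w a b ≠ 0 → w b a ≠ 0) :
    ∃ τ : ι → ℝ, (∀ i, τ (ν i) = -τ i) ∧ ∀ D : ι → ℝ, (∀ i, D (ν i) = -D i) →
      ∑ a, ∑ b, (D a.1 + D a.2 - D b.1 - D b.2) *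
        (w a b * Real.exp (τ a.1 + τ a.2 - τ b.1 - τ b.2)) = 0 := by
  classical
  let E : Submodule ℝ (ι → ℝ) :=
    { carrier := {τ | ∀ i, τ (ν i) = -τ i}
      add_mem' := fun ha hb i => by simp [ha i, hb i]; ring
      zero_mem' := fun i => by simp
      smul_mem' := fun c a ha i => by simp [ha i] }
  let S := {s : (ι × ι) × (ι × ι) // w s.1 s.2 ≠ 0}
  let Λ : E →ₗ[ℝ] S → ℝ :=
    { toFun := fun τ s => (τ : ι → ℝ) s.1.1.1 + (τ : ι → ℝ) s.1.1.2 - (τ : ι → ℝ) s.1.2.1 -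
        (τ : ι → ℝ) s.1.2.2
      map_add' := fun a b => by ext s; simp; ring
      map_smul' := fun c a => by ext s; simp; ring }
  obtain ⟨τ, hτ⟩ := exists_critical_point_sum_exp Λ (fun s => w s.1.1 s.1.2)
    (fun s => lt_of_le_of_ne (hw _ _) s.2.symm) (fun s => ⟨(s.1.2, s.1.1), hsymm _ _ s.2⟩)
    (fun τ s => by simp [Λ]; ring)
  refine ⟨τ, τ.2, fun D hD => ?_⟩
  have := hτ ⟨D, hD⟩
  rw [← Fintype.sum_prod_type']
  rw [← this]
  symm
  refine (Finset.sum_subtype (Finset.univ.filter fun s : (ι × ι) × (ι × ι) => w s.1 s.2 ≠ 0)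
    (by simp) (fun s : (ι × ι) × (ι × ι) => (D s.1.1 + D s.1.2 - D s.2.1 - D s.2.2) *
        (w s.1 s.2 * Real.exp ((τ : ι → ℝ) s.1.1 + (τ : ι → ℝ) s.1.2 - (τ : ι → ℝ) s.2.1 -
          (τ : ι → ℝ) s.2.2)))).symm.trans ?_
  refine Finset.sum_filter_of_ne fun s _ hs => ?_
  intro h0
  exact hs (by rw [h0]; ring)

open scoped ComplexOrder in
-- When `A` and `t` commute, the trace in `htr` equals the squared Hilbert–Schmidt norm of `[Aᴴ,
-- t]`.
theorem commute_conjTranspose_of_trace_eq_zero {n : Type*} [Fintype n] {A t : Matrix n n ℂ}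
    (hA : A * t = t * A)
    (htr : ((A * Aᴴ - Aᴴ * A) * (t * tᴴ - tᴴ * t)).trace = 0) : Aᴴ * t = t * Aᴴ := by
  have hA' : tᴴ * Aᴴ = Aᴴ * tᴴ := by
    rw [← conjTranspose_mul, hA, conjTranspose_mul]
  rw [← sub_eq_zero, ← Matrix.trace_mul_conjTranspose_self_eq_zero_iff]
  rw [← htr]
  simp only [conjTranspose_sub, conjTranspose_mul, conjTranspose_conjTranspose, sub_mul, mul_sub,
    trace_sub]
  have e1 : (Aᴴ * t * (tᴴ * A)).trace = (A * Aᴴ * (t * tᴴ)).trace := by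
    rw [← mul_assoc, trace_mul_comm]; simp only [mul_assoc]
  have e2 : (Aᴴ * t * (A * tᴴ)).trace = (Aᴴ * A * (t * tᴴ)).trace := by
    rw [mul_assoc, ← mul_assoc t A, ← hA]; simp only [mul_assoc]
  have e3 : (t * Aᴴ * (tᴴ * A)).trace = (A * Aᴴ * (tᴴ * t)).trace := by
    rw [← mul_assoc, trace_mul_comm, mul_assoc t, ← mul_assoc A t, hA, mul_assoc, trace_mul_comm t]
    simp only [mul_assoc]
  have e4 : (t * Aᴴ * (A * tᴴ)).trace = (Aᴴ * A * (tᴴ * t)).trace := by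
    rw [mul_assoc, trace_mul_comm]; simp only [mul_assoc]
  rw [e1, e2, e3, e4]; ring

/-- The operator of `a` on the tensor square. -/
def tensorSquareAction {ι : Type*} [DecidableEq ι] (a : Matrix ι ι ℂ) :
    Matrix (ι × ι) (ι × ι) ℂ := a ⊗ₖ 1 + 1 ⊗ₖ a

theorem tensorSquareAction_conjTranspose {ι : Type*} [DecidableEq ι] (a : Matrix ι ι ℂ) :
    (tensorSquareAction a)ᴴ = tensorSquareAction aᴴ := by
  simp [tensorSquareAction, conjTranspose_kronecker]

theorem tensorSquareAction_comm {ι : Type*} [Fintype ι] [DecidableEq ι] (a b : Matrix ι ι ℂ) :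
    tensorSquareAction a * tensorSquareAction b - tensorSquareAction b * tensorSquareAction a =
      tensorSquareAction (a * b - b * a) := by
  simp only [tensorSquareAction, add_mul, mul_add, ← mul_kronecker_mul, one_mul, mul_one]
  ext x y
  simp only [Matrix.sub_apply, Matrix.add_apply, kroneckerMap_apply]
  ring

/-- By `hdiag`, `[a, aᴴ]` is a real diagonal matrix `D`, and skewness of `a` gives `D (ν i) = -D i`.
So `D` is a torus direction, and the trace of its action against `[t, tᴴ]` is the derivative of
`‖t‖²` along it, zero by criticality. -/
theorem tensorSquareAction_conjTranspose_commute {ι : Type*} [Fintype ι] [DecidableEq ι]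
    (ν : ι → ι) (hν : ∀ i, ν (ν i) = i) (t : Matrix (ι × ι) (ι × ι) ℂ)
    (hcrit : ∀ D : ι → ℝ, (∀ i, D (ν i) = -D i) →
      ∑ x, ∑ y, (D x.1 + D x.2 - D y.1 - D y.2) * ‖t x y‖ ^ 2 = 0)
    (a : Matrix ι ι ℂ) (ha : ∀ i j, a (ν j) (ν i) = -a i j)
    (hdiag : ∀ i j, i ≠ j → (a * aᴴ - aᴴ * a) i j = 0)
    (hcomm : tensorSquareAction a * t = t * tensorSquareAction a) :
    tensorSquareAction aᴴ * t = t * tensorSquareAction aᴴ := by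
  rw [← tensorSquareAction_conjTranspose]
  refine commute_conjTranspose_of_trace_eq_zero hcomm ?_
  rw [tensorSquareAction_conjTranspose, tensorSquareAction_comm]
  let D : ι → ℝ := fun i => ∑ j, ‖a i j‖ ^ 2 - ∑ j, ‖a j i‖ ^ 2
  have hD : a * aᴴ - aᴴ * a = diagonal fun i => (D i : ℂ) := by
    ext i j
    by_cases hij : i = j
    · subst hij
      simp [D, mul_apply, Complex.mul_conj', Complex.conj_mul']
    · rw [hdiag i j hij, diagonal_apply_ne _ hij]
  let σ : Equiv.Perm ι := ⟨ν, ν, hν, hν⟩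
  have hσ : ∀ i, σ i = ν i := fun _ => rfl
  have hDν : ∀ i, D (ν i) = -D i := by
    intro i
    have e1 : ∑ j, ‖a (ν i) j‖ ^ 2 = ∑ j, ‖a j i‖ ^ 2 := by
      rw [← Equiv.sum_comp σ]
      exact Finset.sum_congr rfl fun j _ => by rw [hσ, ha, norm_neg]
    have e2 : ∑ j, ‖a j (ν i)‖ ^ 2 = ∑ j, ‖a i j‖ ^ 2 := by
      rw [← Equiv.sum_comp σ]
      exact Finset.sum_congr rfl fun j _ => by rw [hσ, ha, norm_neg]
    simp only [D, e1, e2]; ring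
  have h1 := hcrit D hDν
  have h2 : tensorSquareAction (diagonal fun i => (D i : ℂ)) =
      diagonal fun x : ι × ι => ((D x.1 + D x.2 : ℝ) : ℂ) := by
    rw [tensorSquareAction, ← diagonal_one, diagonal_kronecker_diagonal,
      diagonal_kronecker_diagonal, diagonal_add]
    simp
  rw [hD, h2, mul_sub, trace_sub, trace, trace]
  simp only [diag_apply, diagonal_mul]
  simp only [mul_apply, conjTranspose_apply, RCLike.star_def, Complex.mul_conj',
    Complex.conj_mul']
  have h3 : ∑ x, ((D x.1 + D x.2 : ℝ) : ℂ) * ∑ y, (‖t y x‖ : ℂ) ^ 2 =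
      ∑ x, ∑ y, ((D y.1 + D y.2 : ℝ) : ℂ) * (‖t x y‖ : ℂ) ^ 2 := by
    simp only [Finset.mul_sum]; rw [Finset.sum_comm]
  rw [h3]
  have h4 := congrArg (fun r : ℝ => (r : ℂ)) h1
  simp only [Complex.ofReal_sum, Complex.ofReal_zero] at h4
  rw [← h4]
  simp only [Finset.mul_sum, ← Finset.sum_sub_distrib]
  refine Finset.sum_congr rfl fun x _ => Finset.sum_congr rfl fun y _ => ?_
  push_cast; ring

end KempfNess

/-! ### Root spaces, weight spaces, and multiplicity one. -/

section Roots

variable {𝔤 : Type*} [LieRing 𝔤] [LieAlgebra ℂ 𝔤] [FiniteDimensional ℂ 𝔤]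
  [LieAlgebra.IsKilling ℂ 𝔤] (H : LieSubalgebra ℂ 𝔤) [H.IsCartanSubalgebra]

open LieAlgebra LieModule

theorem exists_smul_of_mem_rootSpace {α : H → ℂ} (hα : α ≠ 0) {e e' : 𝔤} (he : e ∈ rootSpace H α)
    (he' : e' ∈ rootSpace H α) (h0 : e ≠ 0) : ∃ c : ℂ, c • e = e' := by
  have hne : genWeightSpace 𝔤 α ≠ ⊥ := fun h => h0 (by
    have : e ∈ (⊥ : LieSubmodule ℂ H 𝔤) := h ▸ he
    simpa using this)
  let a : Weight ℂ H 𝔤 := ⟨α, hne⟩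
  have ha : a.IsNonZero := fun h => hα h
  have h1 := LieAlgebra.IsKilling.finrank_rootSpace_eq_one a ha
  obtain ⟨c, hc⟩ := exists_smul_eq_of_finrank_eq_one (x := (⟨e, he⟩ : rootSpace H α)) h1
    (fun h => h0 (congrArg Subtype.val h)) ⟨e', he'⟩
  exact ⟨c, congrArg Subtype.val hc⟩

/-- Root spaces being lines, `e` and `f` are nonzero multiples of the members of an `sl₂`-triple,
whose bracket is the coroot. -/
theorem exists_lie_eq_of_mem_rootSpace {α : H → ℂ} (hα : α ≠ 0) {e f : 𝔤} (he : e ∈ rootSpace H α)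
    (hf : f ∈ rootSpace H (-α)) (he0 : e ≠ 0) (hf0 : f ≠ 0) :
    ∃ t : H, ⁅e, f⁆ = t ∧ α t ≠ 0 := by
  have hne : genWeightSpace 𝔤 α ≠ ⊥ := fun h => he0 (by
    have : e ∈ (⊥ : LieSubmodule ℂ H 𝔤) := h ▸ he
    simpa using this)
  let a : Weight ℂ H 𝔤 := ⟨α, hne⟩
  have ha : a.IsNonZero := fun h => hα h
  obtain ⟨h', e', f', ht, he', hf'⟩ := LieAlgebra.IsKilling.exists_isSl2Triple_of_weight_isNonZero ha
  have hh := IsSl2Triple.h_eq_coroot ha ht he' hf'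
  obtain ⟨c, rfl⟩ := exists_smul_of_mem_rootSpace H hα he' he ht.e_ne_zero
  obtain ⟨d, rfl⟩ := exists_smul_of_mem_rootSpace H (neg_ne_zero.mpr hα) hf' hf ht.f_ne_zero
  refine ⟨(c * d) • LieAlgebra.IsKilling.coroot a, ?_, ?_⟩
  · rw [smul_lie, lie_smul, ht.lie_e_f, hh, smul_smul]; rfl
  · have h2 : a (LieAlgebra.IsKilling.coroot a) = 2 := LieAlgebra.IsKilling.root_apply_coroot ha
    have h3 : α ((c * d) • LieAlgebra.IsKilling.coroot a) = (c * d) * 2 := by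
      have : a ((c * d) • LieAlgebra.IsKilling.coroot a) =
          (c * d) * a (LieAlgebra.IsKilling.coroot a) := by
        rw [← LieModule.Weight.toLinear_apply, map_smul]; rfl
      rw [h2] at this
      exact this
    rw [h3]
    have hc : c ≠ 0 := fun h => he0 (by simp [h])
    have hd : d ≠ 0 := fun h => hf0 (by simp [h])
    exact mul_ne_zero (mul_ne_zero hc hd) two_ne_zero

variable {H}
variable {M : Type*} [AddCommGroup M] [Module ℂ M] [LieRingModule 𝔤 M] [LieModule ℂ 𝔤 M]

theorem lie_mem_weightSpace_add {α χ : H → ℂ} {e : 𝔤} {m : M} (he : e ∈ rootSpace H α)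
    (hm : m ∈ weightSpace M χ) : ⁅e, m⁆ ∈ weightSpace M (χ + α) := by
  rw [mem_weightSpace] at hm ⊢
  intro t
  have h1 := LieAlgebra.IsKilling.lie_eq_smul_of_mem_rootSpace he t
  have h2 := hm t
  rw [LieSubalgebra.coe_bracket_of_module] at h1 h2 ⊢
  rw [leibniz_lie, h1, h2, smul_lie, lie_smul, Pi.add_apply]
  module

theorem lie_induction {P : 𝔤 → Prop} (hadd : ∀ a b, P a → P b → P (a + b)) (h0 : P 0)
    (hroot : ∀ (α : H → ℂ), ∀ e ∈ rootSpace H α, P e) (a : 𝔤) : P a := by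
  have h1 : a ∈ ⨆ α : H → ℂ, genWeightSpace 𝔤 α := by
    rw [iSup_genWeightSpace_eq_top]; trivial
  rw [← LieSubmodule.mem_toSubmodule, LieSubmodule.iSup_toSubmodule] at h1
  exact Submodule.iSup_induction _ (motive := P) h1 (fun α e he => hroot α e he) h0 hadd

/-- The sum of the genuine weight spaces is stable under root vectors, and is nonzero by Lie's
theorem. Irreducibility thus makes the Cartan subalgebra act diagonalizably. -/
theorem iSup_weightSpace_eq_top [FiniteDimensional ℂ M] [Nontrivial M]
    (hirr : ∀ U : Submodule ℂ M, (∀ (a : 𝔤), ∀ m ∈ U, ⁅a, m⁆ ∈ U) → U = ⊥ ∨ U = ⊤) :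
    ⨆ χ : H → ℂ, (weightSpace M χ).toSubmodule = ⊤ := by
  refine (hirr _ fun a m hm => ?_).resolve_left ?_
  · refine lie_induction (H := H) (P := fun a => ⁅a, m⁆ ∈ _) (fun a b ha hb => ?_) ?_ ?_ a
    · rw [add_lie]; exact add_mem ha hb
    · rw [zero_lie]; exact zero_mem _
    · intro α e he
      refine Submodule.iSup_induction _ (motive := fun m => ⁅e, m⁆ ∈ _) hm ?_ ?_ ?_
      · intro χ v hv
        exact Submodule.mem_iSup_of_mem (χ + α) (lie_mem_weightSpace_add he hv)
      · rw [lie_zero]; exact zero_mem _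
      · intro x y hx hy
        rw [lie_add]; exact add_mem hx hy
  · obtain ⟨χ, hχ⟩ := exists_nontrivial_weightSpace_of_isSolvable ℂ H M
    intro hbot
    obtain ⟨v, hv⟩ := exists_ne (0 : weightSpace M χ)
    apply hv
    have : (v : M) ∈ ⨆ χ : H → ℂ, (weightSpace M χ).toSubmodule :=
      Submodule.mem_iSup_of_mem (χ : H → ℂ) v.2
    rw [hbot] at this
    exact Subtype.ext (by simpa using this)

theorem weight_eq_of_mem {χ χ' : H → ℂ} {m : M} (hm : m ∈ weightSpace M χ)
    (hm' : m ∈ weightSpace M χ') (h0 : m ≠ 0) : χ = χ' := by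
  ext t
  rw [mem_weightSpace] at hm hm'
  have := (hm t).symm.trans (hm' t)
  rw [← sub_eq_zero, ← sub_smul] at this
  exact sub_eq_zero.mp ((smul_eq_zero.mp this).resolve_right h0)

namespace IsMomentMap

variable {q : M →ₗ[ℂ] M →ₗ[ℂ] ℂ} {T : M →ₗ[ℂ] M →ₗ[ℂ] 𝔤}

theorem form_eq_zero (h : IsMomentMap q T) {β γ : H → ℂ} (hβγ : γ ≠ -β) {m n : M}
    (hm : m ∈ weightSpace M β) (hn : n ∈ weightSpace M γ) : q m n = 0 := by
  obtain ⟨t, ht⟩ := Function.ne_iff.mp hβγ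
  rw [mem_weightSpace] at hm hn
  have h1 := h.skew (t : 𝔤) m n
  have h2 := hm t
  have h3 := hn t
  rw [LieSubalgebra.coe_bracket_of_module] at h2 h3
  rw [h2, h3] at h1
  simp only [map_smul, LinearMap.smul_apply, smul_eq_mul] at h1
  have h4 : (γ t + β t) * q m n = 0 := by linear_combination h1
  refine (mul_eq_zero.mp h4).resolve_left fun h5 => ht ?_
  simpa using eq_neg_of_add_eq_zero_left h5

theorem map_mem_rootSpace (h : IsMomentMap q T) {β γ : H → ℂ} {m n : M}
    (hm : m ∈ weightSpace M β) (hn : n ∈ weightSpace M γ) : T m n ∈ rootSpace H (β + γ) := by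
  apply weightSpace_le_genWeightSpace
  rw [mem_weightSpace] at hm hn ⊢
  intro t
  have h2 := hm t
  have h3 := hn t
  rw [LieSubalgebra.coe_bracket_of_module] at h2 h3 ⊢
  rw [h.equivariant, h2, h3]
  simp [add_smul]

theorem map_mem_cartan (h : IsMomentMap q T) {β : H → ℂ} {m n : M}
    (hm : m ∈ weightSpace M β) (hn : n ∈ weightSpace M (-β)) : T m n ∈ H := by
  have := h.map_mem_rootSpace hm hn
  rw [add_neg_cancel, rootSpace_zero_eq] at this
  exact this

theorem exists_dual (h : IsMomentMap q T)
    (hW : ⨆ χ : H → ℂ, (weightSpace M χ).toSubmodule = ⊤) {β : H → ℂ} {m : M}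
    (hm : m ∈ weightSpace M β) (h0 : m ≠ 0) : ∃ p ∈ weightSpace M (-β), q m p = 1 := by
  by_contra! hc
  apply h0
  refine h.nondeg m fun n => ?_
  have hn : n ∈ ⨆ χ : H → ℂ, (weightSpace M χ).toSubmodule := hW ▸ Submodule.mem_top
  refine Submodule.iSup_induction _ (motive := fun n => q m n = 0) hn ?_ (by simp) ?_
  · intro χ p hp
    by_cases hχ : χ = -β
    · subst hχ
      by_contra hq
      exact hc ((q m p)⁻¹ • p) (Submodule.smul_mem _ _ hp) (by simp [hq])
    · exact h.form_eq_zero hχ hm hp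
  · intro x y hx hy
    simp [hx, hy]

/-- Multiplicity one is inherited from root spaces. If a weight `γ ≠ ±β` exists, the line of root `γ
- β` contains all `T n p` with `n` of weight `γ` and `p` of weight `-β`; these act on the `β`-weight
space as `m ↦ k q(m, p) n`, which forces that space to be a line. If the only weights are `±β`, a
single vector of weight `β` and its images of weight `-β` already span `M`. -/
theorem exists_smul_of_mem_weightSpace (h : IsMomentMap q T)
    (hirr : ∀ U : Submodule ℂ M, (∀ (a : 𝔤), ∀ m ∈ U, ⁅a, m⁆ ∈ U) → U = ⊥ ∨ U = ⊤)
    (hW : ⨆ χ : H → ℂ, (weightSpace M χ).toSubmodule = ⊤) {β : H → ℂ} {m m' : M}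
    (hm : m ∈ weightSpace M β) (hm' : m' ∈ weightSpace M β) (h0 : m ≠ 0) :
    ∃ c : ℂ, c • m = m' := by
  have key : ∀ (γ : H → ℂ) (n : M) (k : ℂ), n ∈ weightSpace M γ → n ≠ 0 → γ ≠ β → k ≠ 0 →
      (∀ m ∈ weightSpace M β, ∀ p ∈ weightSpace M (-β), ⁅T n p, m⁆ = (k * q m p) • n) →
      ∃ c : ℂ, c • m = m' := by
    intro γ n k hn hn0 hγ hk hT
    obtain ⟨p, hp, hmp⟩ := h.exists_dual hW hm h0
    refine ⟨q m' p, ?_⟩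
    by_contra hne
    -- `T n p` kills this vector and `T n p'` does not, although the two are proportional and `T n p
    -- ≠ 0`.
    have hm2 : m' - q m' p • m ∈ weightSpace M β := sub_mem hm' (Submodule.smul_mem _ _ hm)
    obtain ⟨p', hp', hmp'⟩ := h.exists_dual hW hm2 (sub_ne_zero.mpr (Ne.symm hne))
    have h1 := hT _ hm _ hp
    have h2 := hT _ hm2 _ hp
    have h3 := hT _ hm2 _ hp'
    have hz : q (m' - q m' p • m) p = 0 := by simp [hmp]
    rw [hz, mul_zero, zero_smul] at h2
    rw [hmp', mul_one] at h3
    rw [hmp, mul_one] at h1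
    have hne' : T n p ≠ 0 := by
      intro hT0
      rw [hT0, zero_lie] at h1
      exact (smul_ne_zero hk hn0) h1.symm
    obtain ⟨c, hc⟩ := exists_smul_of_mem_rootSpace H (α := γ + -β)
      (fun h0 => hγ (by rwa [← sub_eq_add_neg, sub_eq_zero] at h0))
      (h.map_mem_rootSpace hn hp) (h.map_mem_rootSpace hn hp') hne'
    rw [← hc, smul_lie, h2, smul_zero] at h3
    exact (smul_ne_zero hk hn0) h3.symm
  have key2 : ∀ (γ : H → ℂ) (n n' : M), n ∈ weightSpace M γ → n' ∈ weightSpace M (-γ) →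
      q n n' = 1 → γ ≠ β → γ ≠ -β → ∃ t : H, T n n' = t ∧
      (∀ m ∈ weightSpace M β, ∀ p ∈ weightSpace M (-β),
        ⁅T n p, m⁆ = ((1 - β t) * q m p) • n) := by
    intro γ n n' hn hn' hnn' hγ hγ'
    refine ⟨⟨T n n', h.map_mem_cartan hn hn'⟩, rfl, fun m hm p hp => ?_⟩
    have h1 := h.jacobi m n p
    rw [h.form_eq_zero (by simpa using hγ.symm) hn hp, h.form_eq_zero hγ' hm hn] at h1
    have h2 := (mem_weightSpace γ n).mp hn ⟨T m p, h.map_mem_cartan hm hp⟩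
    have h3 := (mem_weightSpace β m).mp hm ⟨T n n', h.map_mem_cartan hn hn'⟩
    rw [LieSubalgebra.coe_bracket_of_module] at h2 h3
    have h4 := h.pair_symm m p n n'
    simp only at h2 h3
    rw [h2, h3] at h4
    simp only [map_smul, LinearMap.smul_apply, smul_eq_mul, hnn', mul_one] at h4
    rw [h2, h4] at h1
    rw [eq_sub_of_add_eq h1]
    module
  by_cases hex : ∃ γ : H → ℂ, γ ≠ β ∧ γ ≠ -β ∧ ∃ n ∈ weightSpace M γ, n ≠ 0
  · obtain ⟨γ, hγ, hγ', n, hn, hn0⟩ := hex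
    obtain ⟨n', hn', hnn'⟩ := h.exists_dual hW hn hn0
    obtain ⟨t, ht, hT⟩ := key2 γ n n' hn hn' hnn' hγ hγ'
    -- Replacing `γ` by `-γ` changes `t` into `-t`; the factors `1 - β t` and `1 + β t` cannot both
    -- vanish.
    by_cases hk : 1 - β t = 0
    · obtain ⟨t', ht', hT'⟩ := key2 (-γ) n' n hn' (by simpa using hn) (by rw [h.symm, hnn'])
        (fun hc => hγ' (by rw [← hc, neg_neg])) (fun hc => hγ (neg_injective hc))
      have hm0 := (mem_weightSpace β m).mp hm
      have htt : t' = -t := by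
        apply Subtype.ext
        rw [← ht', h.map_skew, ht]; rfl
      have hβ : β t' = -β t := by
        have e1 := hm0 t'
        rw [htt, neg_lie, hm0 t, ← neg_smul] at e1
        rw [htt]
        have e2 : (-β t - β (-t)) • m = 0 := by rw [sub_smul, e1, sub_self]
        exact (sub_eq_zero.mp ((smul_eq_zero.mp e2).resolve_right h0)).symm
      refine key (-γ) n' _ hn' (fun hc => by simp [hc] at hnn')
        (fun hc => hγ' (by rw [← hc, neg_neg])) ?_ hT'
      rw [hβ]
      intro hk'
      have : (2 : ℂ) = 0 := by linear_combination hk + hk'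
      exact two_ne_zero this
    · exact key γ n _ hn hn0 hγ hk hT
  · push Not at hex
    let F : rootSpace H (-β - β) →ₗ[ℂ] M :=
      { toFun := fun f => ⁅(f : 𝔤), m⁆
        map_add' := fun a b => by simp
        map_smul' := fun c a => by simp }
    have hF : ∀ f ∈ rootSpace H (-β - β), ⁅f, m⁆ ∈ weightSpace M (-β) := by
      intro f hf
      have := lie_mem_weightSpace_add hf hm
      convert this using 2
      abel
    let U : Submodule ℂ M := Submodule.span ℂ {m} ⊔ LinearMap.range F
    have hmU : m ∈ U := Submodule.mem_sup_left (Submodule.mem_span_singleton_self m)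
    have hFU : ∀ f ∈ rootSpace H (-β - β), ⁅f, m⁆ ∈ U := fun f hf =>
      Submodule.mem_sup_right ⟨⟨f, hf⟩, rfl⟩
    have hHm : ∀ t : H, ⁅(t : 𝔤), m⁆ = β t • m := (mem_weightSpace β m).mp hm
    have hUinv : ∀ (a : 𝔤), ∀ x ∈ U, ⁅a, x⁆ ∈ U := by
      intro a x hx
      refine lie_induction (H := H) (P := fun a => ⁅a, x⁆ ∈ U) (fun a b ha hb => ?_) ?_ ?_ a
      · rw [add_lie]; exact add_mem ha hb
      · rw [zero_lie]; exact zero_mem _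
      intro α e he
      obtain ⟨x1, hx1, x2, ⟨⟨f, hf⟩, rfl⟩, rfl⟩ := Submodule.mem_sup.mp hx
      obtain ⟨c, rfl⟩ := Submodule.mem_span_singleton.mp hx1
      change ⁅e, c • m + ⁅f, m⁆⁆ ∈ U
      rw [lie_add, lie_smul]
      refine add_mem (U.smul_mem _ ?_) ?_
      · by_cases hα : α = 0
        · subst hα
          rw [rootSpace_zero_eq] at he
          rw [hHm ⟨e, he⟩]
          exact U.smul_mem _ hmU
        · have h1 := lie_mem_weightSpace_add he hm
          by_cases hα2 : β + α = -β
          · have : α = -β - β := by rw [← hα2]; abel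
            exact hFU e (this ▸ he)
          · rw [hex (β + α) (by simpa using hα) hα2 _ h1]
            exact zero_mem _
      · by_cases hα : α = 0
        · subst hα
          rw [rootSpace_zero_eq] at he
          have := (mem_weightSpace _ _).mp (hF f hf) ⟨e, he⟩
          rw [LieSubalgebra.coe_bracket_of_module] at this
          rw [this]
          exact U.smul_mem _ (hFU f hf)
        · have h1 := lie_mem_weightSpace_add he (hF f hf)
          by_cases hα2 : -β + α = β
          -- The vector `e` of root `2β` sends `m` to weight `3β`, which does not occur, so `[e, [f,
          -- m]] = [[e, f], m]` with `[e, f]` in the Cartan subalgebra.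
          · have hα3 : α = β + β := neg_add_eq_iff_eq_add.mp hα2
            have hβ : β ≠ 0 := by rintro rfl; exact hα (by simpa using hα3)
            have hem : ⁅e, m⁆ = 0 := by
              refine hex (β + α) (by simpa using hα) (fun hc => hβ ?_) _
                (lie_mem_weightSpace_add he hm)
              rw [hα3] at hc
              ext t
              have := congrFun hc t
              simp only [Pi.add_apply, Pi.neg_apply] at this
              simp only [Pi.zero_apply]
              linear_combination this / 4
            have hef : ⁅e, f⁆ ∈ H := by
              have := lie_mem_genWeightSpace_of_mem_genWeightSpace he hf
              rw [hα3, show β + β + (-β - β) = 0 by abel] at this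
              rw [← LieSubalgebra.mem_toLieSubmodule, ← rootSpace_zero_eq]
              exact this
            rw [leibniz_lie, hem, lie_zero, add_zero, hHm ⟨_, hef⟩]
            exact U.smul_mem _ hmU
          · by_cases hα3 : -β + α = -β
            · exact absurd (by simpa using hα3) hα
            · rw [hex _ hα2 hα3 _ h1]
              exact zero_mem _
    have hU : U = ⊤ := (hirr U hUinv).resolve_left fun hb => h0 (by
      rw [hb] at hmU; simpa using hmU)
    have hm'U : m' ∈ U := hU ▸ Submodule.mem_top
    obtain ⟨x1, hx1, x2, ⟨⟨f, hf⟩, rfl⟩, hx⟩ := Submodule.mem_sup.mp hm'U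
    obtain ⟨c, rfl⟩ := Submodule.mem_span_singleton.mp hx1
    change c • m + ⁅f, m⁆ = m' at hx
    refine ⟨c, ?_⟩
    have h1 : ⁅f, m⁆ ∈ weightSpace M β := by
      rw [← eq_sub_iff_add_eq'] at hx
      rw [hx]; exact sub_mem hm' (Submodule.smul_mem _ _ hm)
    suffices ⁅f, m⁆ = 0 by rw [← hx, this, add_zero]
    by_contra hne
    have hβ : β = -β := weight_eq_of_mem h1 (hF f hf) hne
    have hβ0 : β = 0 := by
      ext t
      have := congrFun hβ t
      simp only [Pi.neg_apply] at this
      simp only [Pi.zero_apply]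
      linear_combination this / 2
    subst hβ0
    simp only [neg_zero, sub_zero] at hf
    rw [rootSpace_zero_eq] at hf
    exact hne (by rw [hHm ⟨f, hf⟩]; simp)

end IsMomentMap
end Roots

/-! ### Weight bases and rank one identities. -/

section WeightBasis

variable {𝔤 : Type*} [LieRing 𝔤] [LieAlgebra ℂ 𝔤] [FiniteDimensional ℂ 𝔤]
  [LieAlgebra.IsKilling ℂ 𝔤] {H : LieSubalgebra ℂ 𝔤} [H.IsCartanSubalgebra]
  {M : Type*} [AddCommGroup M] [Module ℂ M] [LieRingModule 𝔤 M] [LieModule ℂ 𝔤 M]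

open LieAlgebra LieModule

/-- A basis of weight vectors, with pairwise distinct weights, adapted to the form. -/
structure IsWeightBasis {ι : Type*} [DecidableEq ι] (q : M →ₗ[ℂ] M →ₗ[ℂ] ℂ)
    (b : Module.Basis ι ℂ M) (wt : ι → H → ℂ) (ν : ι → ι) : Prop where
  mem : ∀ i, b i ∈ weightSpace M (wt i)
  injective : Function.Injective wt
  neg : ∀ i, wt (ν i) = -wt i
  involutive : ∀ i, ν (ν i) = i
  form : ∀ i j, q (b i) (b j) = if j = ν i then 1 else 0

namespace IsMomentMap

variable {q : M →ₗ[ℂ] M →ₗ[ℂ] ℂ} {T : M →ₗ[ℂ] M →ₗ[ℂ] 𝔤}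

theorem exists_isWeightBasis [FiniteDimensional ℂ M] (h : IsMomentMap q T)
    (hirr : ∀ U : Submodule ℂ M, (∀ (a : 𝔤), ∀ m ∈ U, ⁅a, m⁆ ∈ U) → U = ⊥ ∨ U = ⊤)
    (hW : ⨆ χ : H → ℂ, (weightSpace M χ).toSubmodule = ⊤) :
    ∃ (n : ℕ) (b : Module.Basis (Fin n) ℂ M) (wt : Fin n → H → ℂ) (ν : Fin n → Fin n),
      IsWeightBasis q b wt ν := by
  classical
  have hex : ∀ χ : H → ℂ, weightSpace M χ ≠ ⊥ → ∃ v ∈ weightSpace M χ, v ≠ 0 := fun χ hχ =>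
    Submodule.exists_mem_ne_zero_of_ne_bot fun hc => hχ (by
      rwa [← LieSubmodule.toSubmodule_eq_bot])
  let ι := {χ : H → ℂ // weightSpace M χ ≠ ⊥}
  have hind : iSupIndep fun χ : H → ℂ => (weightSpace M χ).toSubmodule := by
    refine iSupIndep.mono
      ((LieSubmodule.iSupIndep_toSubmodule).mpr (iSupIndep_genWeightSpace ℂ H M)) fun χ => ?_
    exact weightSpace_le_genWeightSpace M χ
  have : Finite ι := WellFoundedGT.finite_ne_bot_of_iSupIndep hind |>.to_subtype |>.of_injective
    (fun χ : ι => ⟨χ.1, fun hc => χ.2 (by simpa using hc)⟩)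
    (fun a b hab => Subtype.ext (congrArg (fun x => x.1) hab))
  have := Fintype.ofFinite ι
  have hneg : ∀ χ : ι, weightSpace M (-χ.1) ≠ ⊥ := by
    rintro ⟨χ, hχ⟩ hc
    obtain ⟨v, hv, hv0⟩ := hex χ hχ
    obtain ⟨p, hp, hp1⟩ := h.exists_dual hW hv hv0
    have hc' : weightSpace M (-χ) = ⊥ := hc
    rw [hc', LieSubmodule.mem_bot] at hp
    rw [hp] at hp1
    simp at hp1
  let ν : ι → ι := fun χ => ⟨-χ.1, hneg χ⟩
  have hνν : ∀ i, ν (ν i) = i := fun i => Subtype.ext (neg_neg _)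
  choose v hv hv0 using fun χ : ι => hex χ.1 χ.2
  have hq0 : ∀ i j, j ≠ ν i → q (v i) (v j) = 0 := fun i j hij =>
    h.form_eq_zero (fun hc => hij (Subtype.ext hc)) (hv i) (hv j)
  have hqν : ∀ i, q (v i) (v (ν i)) ≠ 0 := by
    intro i hc
    obtain ⟨p, hp, hp1⟩ := h.exists_dual hW (hv i) (hv0 i)
    obtain ⟨c, rfl⟩ := h.exists_smul_of_mem_weightSpace hirr hW (hv (ν i)) hp (hv0 _)
    simp [hc] at hp1
  -- Symmetry of `q` gives the same square root for `i` and `ν i`, so dividing by it normalises all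
  -- pairings at once, including the case `ν i = i`.
  let s : ι → ℂ := fun i => (q (v i) (v (ν i))) ^ (((2 : ℕ) : ℂ)⁻¹)
  have hs : ∀ i, s i * s i = q (v i) (v (ν i)) := fun i => by
    rw [← sq]; exact Complex.cpow_nat_inv_pow _ two_ne_zero
  have hs0 : ∀ i, s i ≠ 0 := fun i hc => hqν i (by rw [← hs, hc, zero_mul])
  have hsν : ∀ i, s (ν i) = s i := fun i => by
    simp only [s]; rw [hνν, h.symm]
  let w : ι → M := fun i => (s i)⁻¹ • v i
  have hw : ∀ i, w i ∈ weightSpace M i.1 := fun i => Submodule.smul_mem _ _ (hv i)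
  have hw0 : ∀ i, w i ≠ 0 := fun i => smul_ne_zero (inv_ne_zero (hs0 i)) (hv0 i)
  have hli : LinearIndependent ℂ w :=
    (hind.comp (f := fun i : ι => i.1) Subtype.val_injective).linearIndependent _ hw hw0
  have hsp : ⊤ ≤ Submodule.span ℂ (Set.range w) := by
    rw [← hW, iSup_le_iff]
    intro χ x hx
    by_cases hχ : weightSpace M χ = ⊥
    · have : x ∈ weightSpace M χ := hx
      rw [hχ, LieSubmodule.mem_bot] at this
      rw [this]; exact zero_mem _
    · obtain ⟨c, rfl⟩ := h.exists_smul_of_mem_weightSpace hirr hW (hw ⟨χ, hχ⟩) hx (hw0 _)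
      exact Submodule.smul_mem _ _ (Submodule.subset_span ⟨_, rfl⟩)
  let e := Fintype.equivFin ι
  refine ⟨Fintype.card ι, (Module.Basis.mk hli hsp).reindex e, fun i => (e.symm i).1,
    fun i => e (ν (e.symm i)), ?_, ?_, ?_, ?_, ?_⟩
  · intro i; simpa using hw _
  · intro i j hij
    exact e.symm.injective (Subtype.ext hij)
  · intro i; simp [ν]
  · intro i; simp [hνν]
  · intro i j
    simp only [Module.Basis.reindex_apply, Module.Basis.mk_apply, w, map_smul,
      LinearMap.smul_apply, smul_eq_mul]
    by_cases hij : j = e (ν (e.symm i))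
    · rw [if_pos hij, hij, Equiv.symm_apply_apply, hsν, ← hs]
      field_simp [hs0]
    · rw [if_neg hij, hq0 _ _ fun hc => hij (by rw [← hc]; simp)]
      simp

end IsMomentMap

namespace IsWeightBasis

variable {q : M →ₗ[ℂ] M →ₗ[ℂ] ℂ} {T : M →ₗ[ℂ] M →ₗ[ℂ] 𝔤}
  {ι : Type*} [Fintype ι] [DecidableEq ι] {b : Module.Basis ι ℂ M} {wt : ι → H → ℂ} {ν : ι → ι}

theorem form_eq (w : IsWeightBasis q b wt ν) (m : M) (i : ι) : q m (b (ν i)) = b.repr m i := by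
  have := congrArg (fun v => q v (b (ν i))) (b.sum_repr m)
  simp only [map_sum, LinearMap.sum_apply, map_smul, LinearMap.smul_apply, w.form] at this
  rw [← this]
  rw [Finset.sum_eq_single i]
  · simp
  · intro j _ hj
    rw [if_neg fun hc => hj (by rw [← w.involutive j, ← hc, w.involutive]), smul_zero]
  · simp

theorem wt_apply (w : IsWeightBasis q b wt ν) (t : H) (i : ι) : ⁅(t : 𝔤), b i⁆ = wt i t • b i :=
  (mem_weightSpace _ _).mp (w.mem i) t

theorem eq_smul_of_mem (w : IsWeightBasis q b wt ν) (h : IsMomentMap q T) {m : M} {i : ι}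
    (hm : m ∈ weightSpace M (wt i)) : m = q m (b (ν i)) • b i := by
  refine b.ext_elem fun j => ?_
  rw [← w.form_eq, ← w.form_eq, map_smul, LinearMap.smul_apply, w.form]
  by_cases hij : i = j
  · subst hij; simp
  · rw [if_neg fun hc => hij (by rw [← w.involutive i, ← hc, w.involutive]), smul_zero]
    refine h.form_eq_zero (fun hc => hij (w.injective ?_)) hm (w.mem _)
    rw [w.neg] at hc
    exact (neg_injective hc).symm

/-- `T (b j) (b (ν i))` shifts weights by `wt j - wt i`. -/
theorem map_mem (w : IsWeightBasis q b wt ν) (h : IsMomentMap q T) (i j : ι) :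
    T (b j) (b (ν i)) ∈ rootSpace H (wt j - wt i) := by
  have := h.map_mem_rootSpace (w.mem j) (w.mem (ν i))
  rwa [w.neg, ← sub_eq_add_neg] at this

theorem coeff_eq_zero (w : IsWeightBasis q b wt ν) (h : IsMomentMap q T) {α : H → ℂ} {e : 𝔤}
    (he : e ∈ rootSpace H α) {k l : ι} (hkl : wt l - wt k ≠ α) : q ⁅e, b k⁆ (b (ν l)) = 0 := by
  refine h.form_eq_zero (fun hc => hkl ?_) (lie_mem_weightSpace_add he (w.mem k)) (w.mem _)
  rw [w.neg] at hc
  have := neg_injective hc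
  rw [this]; abel

theorem lie_eq_smul (w : IsWeightBasis q b wt ν) (h : IsMomentMap q T) {α : H → ℂ} {e : 𝔤}
    (he : e ∈ rootSpace H α) {k l : ι} (hkl : wt l - wt k = α) :
    ⁅e, b k⁆ = q ⁅e, b k⁆ (b (ν l)) • b l := by
  refine w.eq_smul_of_mem h ?_
  have := lie_mem_weightSpace_add he (w.mem k)
  rwa [← hkl, add_sub_cancel] at this

theorem diag_symm (h : IsMomentMap q T) (i j : ι) :
    q ⁅T (b i) (b (ν i)), b j⁆ (b (ν j)) = q ⁅T (b j) (b (ν j)), b i⁆ (b (ν i)) :=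
  h.pair_symm ..

theorem diag_of_wt_eq_zero (w : IsWeightBasis q b wt ν) (h : IsMomentMap q T) {i : ι}
    (hi : wt i = 0) (j : ι) : q ⁅T (b i) (b (ν i)), b j⁆ (b (ν j)) = 0 := by
  have : ν i = i := w.injective (by rw [w.neg, hi, neg_zero])
  rw [this, h.map_self]; simp

theorem diag_self (w : IsWeightBasis q b wt ν) (h : IsMomentMap q T) {i : ι}
    (hi : wt i ≠ 0) : q ⁅T (b i) (b (ν i)), b i⁆ (b (ν i)) = 1 := by
  have hne : i ≠ ν i := fun hc => hi (by
    have := w.neg i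
    rw [← hc] at this
    ext t
    have := congrFun this t
    simp only [Pi.neg_apply] at this
    simp only [Pi.zero_apply]
    linear_combination this / 2)
  rw [h.lie_map_self, map_sub, LinearMap.sub_apply, map_smul, map_smul, LinearMap.smul_apply,
    LinearMap.smul_apply, w.form, w.form, w.form]
  simp [hne]

/-- The basic rank one computation. -/
theorem edge_eq (w : IsWeightBasis q b wt ν) (h : IsMomentMap q T) {i j : ι} (hij : j ≠ i)
    (hij' : j ≠ ν i) : q ⁅T (b j) (b (ν i)), b i⁆ (b (ν j)) =
      1 - q ⁅T (b i) (b (ν i)), b j⁆ (b (ν j)) := by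
  have h1 := h.form_eq (b i) (b j) (b (ν i)) (b (ν j))
  simp only [w.form] at h1
  rw [if_neg fun hc => hij (by rw [← w.involutive j, ← hc, w.involutive]), if_neg hij'] at h1
  simp only [if_true] at h1
  linear_combination h1

theorem edge_symm (h : IsMomentMap q T) (i j k l : ι) :
    q ⁅T (b j) (b (ν i)), b k⁆ (b (ν l)) = q ⁅T (b k) (b (ν l)), b j⁆ (b (ν i)) :=
  h.pair_symm ..

theorem wt_map_self (w : IsWeightBasis q b wt ν) (t : H) (k : ι) :
    wt k t = q ⁅(t : 𝔤), b k⁆ (b (ν k)) := by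
  rw [w.wt_apply, map_smul, LinearMap.smul_apply, w.form]; simp

/-- `A = T(b_j, b_νi)` and `F = T(b_k, b_νl)` are opposite root vectors, so the root does not vanish
on `[A, F] = Y (T(b_l, b_νl) - T(b_k, b_νk))`. If the edge coefficient `1 - c` were zero, with `c`
the mixed diagonal coefficient, the root would take the value `Y (1 - c - c + 1) = 0` there. -/
theorem edge_ne_zero_aux (w : IsWeightBasis q b wt ν) (h : IsMomentMap q T) {i j k l : ι}
    (hij : i ≠ j) (hY : q ⁅T (b j) (b (ν i)), b k⁆ (b (ν l)) ≠ 0) :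
    q ⁅T (b l) (b (ν k)), b k⁆ (b (ν l)) ≠ 0 := by
  have hα : wt l - wt k = wt j - wt i := by
    by_contra hc
    exact hY (w.coeff_eq_zero h (w.map_mem h i j) hc)
  have hα0 : wt l - wt k ≠ 0 := by
    rw [hα, sub_ne_zero]; exact fun hc => hij (w.injective hc).symm
  have hkl : l ≠ k := fun hc => hα0 (by rw [hc, sub_self])
  have hkl' : l ≠ ν k := by
    rintro rfl
    apply hY
    rw [w.involutive]
    have := h.form_skew_right (b j) (b (ν i)) (b k) (b k)
    linear_combination this / 2
  set Y := q ⁅T (b j) (b (ν i)), b k⁆ (b (ν l)) with hYdef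
  have hA := w.map_mem h i j
  rw [← hα] at hA
  set A := T (b j) (b (ν i)) with hAdef
  have hF := w.map_mem h l k
  have hneg : wt k - wt l = -(wt l - wt k) := by abel
  rw [hneg] at hF
  set F := T (b k) (b (ν l)) with hFdef
  have hA0 : A ≠ 0 := fun hc => hY (by rw [hYdef, hc]; simp)
  have hF0 : F ≠ 0 := fun hc => hY (by
    rw [hYdef, hAdef, edge_symm h, ← hFdef, hc]; simp)
  obtain ⟨t, ht, hαt⟩ := exists_lie_eq_of_mem_rootSpace H hα0 hA hF hA0 hF0
  have hAk : ⁅A, b k⁆ = Y • b l := w.lie_eq_smul h hA rfl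
  have hAl : ⁅A, b (ν l)⁆ = -Y • b (ν k) := by
    have h1 := w.lie_eq_smul h hA (k := ν l) (l := ν k) (by rw [w.neg, w.neg]; abel)
    rw [h1, w.involutive, h.skew, hAk, map_smul, w.form, w.involutive]
    simp
  have ht' : (t : 𝔤) = Y • (T (b l) (b (ν l)) - T (b k) (b (ν k))) := by
    rw [← ht, hFdef, h.equivariant, hAk, hAl]; simp; module
  intro hz
  rw [w.edge_eq h hkl hkl', sub_eq_zero] at hz
  have hk0 : wt k ≠ 0 := fun hc => by
    rw [w.diag_of_wt_eq_zero h hc] at hz; exact one_ne_zero hz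
  have hl0 : wt l ≠ 0 := fun hc => by
    rw [diag_symm h, w.diag_of_wt_eq_zero h hc] at hz; exact one_ne_zero hz
  apply hαt
  rw [Pi.sub_apply, w.wt_map_self, w.wt_map_self, ht']
  simp only [smul_lie, sub_lie, map_smul, map_sub, LinearMap.smul_apply, LinearMap.sub_apply,
    w.diag_self h hk0, w.diag_self h hl0, diag_symm h l k, ← hz]
  simp

theorem edge_ne_zero (w : IsWeightBasis q b wt ν) (h : IsMomentMap q T) {i j k l : ι}
    (hij : i ≠ j) (hY : q ⁅T (b j) (b (ν i)), b k⁆ (b (ν l)) ≠ 0) :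
    q ⁅T (b j) (b (ν i)), b i⁆ (b (ν j)) ≠ 0 := by
  have hα : wt l - wt k = wt j - wt i := by
    by_contra hc
    exact hY (w.coeff_eq_zero h (w.map_mem h i j) hc)
  have hkl : l ≠ k := by
    rintro rfl
    rw [sub_self] at hα
    exact hij (w.injective (sub_eq_zero.mp hα.symm)).symm
  rw [edge_symm h] at hY
  have := w.edge_ne_zero_aux h hkl hY
  rwa [edge_symm h] at this

/-- A vanishing `2 × 2` minor: both values of `T` lie on the same root line. -/
theorem edge_mul (w : IsWeightBasis q b wt ν) (h : IsMomentMap q T) {i j k l : ι}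
    (hij : i ≠ j) (hkl : wt l - wt k = wt j - wt i) :
    q ⁅T (b j) (b (ν i)), b k⁆ (b (ν l)) * q ⁅T (b l) (b (ν k)), b i⁆ (b (ν j)) =
      q ⁅T (b j) (b (ν i)), b i⁆ (b (ν j)) * q ⁅T (b l) (b (ν k)), b k⁆ (b (ν l)) := by
  have hA := w.map_mem h i j
  have hA' := w.map_mem h k l
  rw [hkl] at hA'
  by_cases h0 : T (b j) (b (ν i)) = 0
  · simp [h0]
  · obtain ⟨c, hc⟩ := exists_smul_of_mem_rootSpace H
      (sub_ne_zero.mpr fun hc => hij (w.injective hc).symm) hA hA' h0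
    rw [← hc]
    simp only [smul_lie, map_smul, LinearMap.smul_apply, smul_eq_mul]
    ring

/-- This makes the support of `momentTensor` symmetric, as the Kempf–Ness argument requires. Off the
diagonal, `edge_mul` writes a product containing the transposed coefficient as a product of two
nonzero ones. -/
theorem edge_transpose_ne_zero (w : IsWeightBasis q b wt ν) (h : IsMomentMap q T) {i j k l : ι}
    (hY : q ⁅T (b j) (b (ν i)), b k⁆ (b (ν l)) ≠ 0) :
    q ⁅T (b i) (b (ν j)), b l⁆ (b (ν k)) ≠ 0 := by
  have hα : wt l - wt k = wt j - wt i := by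
    by_contra hc
    exact hY (w.coeff_eq_zero h (w.map_mem h i j) hc)
  by_cases hij : i = j
  · subst hij
    rw [sub_self, sub_eq_zero] at hα
    rwa [← w.injective hα]  at hY ⊢
  · rw [edge_symm h]
    have h1 := w.edge_mul h hij hα
    intro hc
    rw [hc, mul_zero] at h1
    exact mul_ne_zero (w.edge_ne_zero h hij hY) (w.edge_ne_zero_aux h hij hY) h1.symm

end IsWeightBasis
end WeightBasis

/-! ### Critical weight bases are compact. -/

section CompactBasis

variable {𝔤 : Type*} [LieRing 𝔤] [LieAlgebra ℂ 𝔤]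
  {M : Type*} [AddCommGroup M] [Module ℂ M] [LieRingModule 𝔤 M] [LieModule ℂ 𝔤 M]
  {q : M →ₗ[ℂ] M →ₗ[ℂ] ℂ} {T : M →ₗ[ℂ] M →ₗ[ℂ] 𝔤}
  {ι : Type*} [Fintype ι] [DecidableEq ι] {b : Module.Basis ι ℂ M} {ν : ι → ι}

open LieAlgebra LieModule

/-- The matrix of the Casimir-like operator defined by `T` on the tensor square of `M`. -/
noncomputable def momentTensor (q : M →ₗ[ℂ] M →ₗ[ℂ] ℂ) (T : M →ₗ[ℂ] M →ₗ[ℂ] 𝔤) (b : Module.Basis ι ℂ M)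
    (ν : ι → ι) : Matrix (ι × ι) (ι × ι) ℂ :=
  fun x y => q ⁅T (b y.1) (b (ν x.1)), b y.2⁆ (b (ν x.2))

/-- For `E` skew with respect to `q`, commuting with the tensor is the same as being a derivation of
`(m, n, p) ↦ [T(m, n), p]`. -/
theorem momentTensor_commutator_apply (hν : ∀ i, ν (ν i) = i)
    (hform : ∀ i j, q (b i) (b j) = if j = ν i then 1 else 0)
    (a : Matrix ι ι ℂ) (ha : ∀ i j, a (ν j) (ν i) = -a i j)
    (E : M →ₗ[ℂ] M) (hE : ∀ j, E (b j) = ∑ i, a i j • b i) (i j k l : ι) :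
    (tensorSquareAction a * momentTensor q T b ν - momentTensor q T b ν * tensorSquareAction a)
      (i, j) (k, l) =
    q (E ⁅T (b k) (b (ν i)), b l⁆ - ⁅T (E (b k)) (b (ν i)), b l⁆ - ⁅T (b k) (E (b (ν i))), b l⁆ -
      ⁅T (b k) (b (ν i)), E (b l)⁆) (b (ν j)) := by
  have hEν : ∀ i, E (b (ν i)) = -∑ i', a i i' • b (ν i') := by
    intro i
    rw [hE, ← Finset.sum_neg_distrib]
    let σ : Equiv.Perm ι := ⟨ν, ν, hν, hν⟩
    rw [← Equiv.sum_comp σ]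
    refine Finset.sum_congr rfl fun i' _ => ?_
    change a (ν i') (ν i) • b (ν i') = _
    rw [ha, neg_smul]
  have hskew : ∀ v i, q (E v) (b (ν i)) = ∑ i', a i i' * q v (b (ν i')) := by
    intro v i
    suffices h : (q.flip (b (ν i))) ∘ₗ E = ∑ i', a i i' • q.flip (b (ν i')) by
      simpa using LinearMap.congr_fun h v
    refine b.ext fun j => ?_
    have hinj : ∀ i j, ν i = ν j ↔ i = j := fun i j =>
      ⟨fun h => by rw [← hν i, h, hν], fun h => by rw [h]⟩
    simp [hE, hform, hinj]
  have e1 : (tensorSquareAction a * momentTensor q T b ν) (i, j) (k, l) =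
      ∑ i', a i i' * q ⁅T (b k) (b (ν i')), b l⁆ (b (ν j)) +
      ∑ j', a j j' * q ⁅T (b k) (b (ν i)), b l⁆ (b (ν j')) := by
    simp only [tensorSquareAction, Matrix.add_apply, Matrix.mul_apply,
      Fintype.sum_prod_type, Matrix.kroneckerMap_apply, Matrix.one_apply, momentTensor, add_mul, Finset.sum_add_distrib]
    congr 1
    · simp
    · rw [Finset.sum_comm]; simp
  have e2 : (momentTensor q T b ν * tensorSquareAction a) (i, j) (k, l) =
      ∑ k', a k' k * q ⁅T (b k') (b (ν i)), b l⁆ (b (ν j)) +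
      ∑ l', a l' l * q ⁅T (b k) (b (ν i)), b l'⁆ (b (ν j)) := by
    simp only [tensorSquareAction, Matrix.add_apply, Matrix.mul_apply,
      Fintype.sum_prod_type, Matrix.kroneckerMap_apply, Matrix.one_apply, momentTensor, mul_add, Finset.sum_add_distrib]
    congr 1
    · simp [mul_comm]
    · rw [Finset.sum_comm]; simp [mul_comm]
  rw [Matrix.sub_apply, e1, e2]
  simp only [map_sub, LinearMap.sub_apply, hskew, hEν i, hE k, hE l, map_neg, neg_lie, map_sum,
    map_smul, LinearMap.sum_apply, LinearMap.smul_apply, sum_lie, smul_lie, lie_sum, lie_smul,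
    LinearMap.neg_apply, smul_eq_mul]
  ring

variable [FiniteDimensional ℂ 𝔤] [LieAlgebra.IsKilling ℂ 𝔤] {H : LieSubalgebra ℂ 𝔤}
  [H.IsCartanSubalgebra] {wt : ι → H → ℂ}

theorem IsWeightBasis.exists_critical (w : IsWeightBasis q b wt ν) (h : IsMomentMap q T) :
    ∃ b' : Module.Basis ι ℂ M, IsWeightBasis q b' wt ν ∧
      ∀ D : ι → ℝ, (∀ i, D (ν i) = -D i) →
        ∑ x, ∑ y, (D x.1 + D x.2 - D y.1 - D y.2) * ‖momentTensor q T b' ν x y‖ ^ 2 = 0 := by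
  obtain ⟨τ, hτ, hcrit⟩ := exists_critical_torus_point ν
    (fun x y => ‖momentTensor q T b ν x y‖ ^ 2) (fun _ _ => by positivity) (fun x y hxy => by
      have h1 : momentTensor q T b ν x y ≠ 0 := fun hc => hxy (by rw [hc]; simp)
      have h2 := w.edge_transpose_ne_zero h h1
      exact pow_ne_zero 2 (norm_ne_zero_iff.mpr h2))
  -- The half compensates the square in the norm, and the sign matches the exponent of the critical
  -- point equation. Oddness of `τ` under `ν` preserves the normalisation of `q`.
  let c : ι → ℝ := fun i => Real.exp (-τ i / 2)
  have hc : ∀ i, (c i : ℂ) ≠ 0 := fun i => by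
    exact_mod_cast (Real.exp_pos (-τ i / 2)).ne'
  have hcν : ∀ i, c (ν i) * c i = 1 := fun i => by
    simp only [c]; rw [← Real.exp_add, hτ]
    rw [show -(-τ i) / 2 + -τ i / 2 = 0 by ring, Real.exp_zero]
  let b' : Module.Basis ι ℂ M := b.unitsSMul fun i => Units.mk0 (c i : ℂ) (hc i)
  have hb' : ∀ i, b' i = (c i : ℂ) • b i := fun i => by
    simp [b', Module.Basis.unitsSMul_apply, Units.smul_def]
  refine ⟨b', ⟨fun i => ?_, w.injective, w.neg, w.involutive, fun i j => ?_⟩, fun D hD => ?_⟩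
  · rw [hb']; exact Submodule.smul_mem _ _ (w.mem i)
  · rw [hb', hb', map_smul, map_smul, LinearMap.smul_apply, w.form]
    by_cases hij : j = ν i
    · subst hij
      rw [if_pos rfl, smul_eq_mul, smul_eq_mul, mul_one]
      exact_mod_cast hcν i
    · simp [hij]
  · rw [← hcrit D hD]
    refine Finset.sum_congr rfl fun x _ => Finset.sum_congr rfl fun y _ => ?_
    congr 1
    have h1 : momentTensor q T b' ν x y =
        ((c y.1 * c (ν x.1) * c y.2 * c (ν x.2) : ℝ) : ℂ) * momentTensor q T b ν x y := by
      simp only [momentTensor, hb', map_smul, LinearMap.smul_apply, smul_lie, lie_smul,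
        smul_eq_mul]
      push_cast; ring
    rw [h1, norm_mul, mul_pow, mul_comm, Complex.norm_real, Real.norm_eq_abs, sq_abs]
    congr 1
    simp only [c, hτ]
    rw [← Real.exp_add, ← Real.exp_add, ← Real.exp_add, ← Real.exp_nat_mul]
    congr 1
    push_cast; ring

/-- The Kempf–Ness argument: at a critical basis, the image of `𝔤` is closed under adjoints. -/
theorem IsWeightBasis.exists_adjoint (w : IsWeightBasis q b wt ν) (h : IsMomentMap q T)
    (hcrit : ∀ D : ι → ℝ, (∀ i, D (ν i) = -D i) →
        ∑ x, ∑ y, (D x.1 + D x.2 - D y.1 - D y.2) * ‖momentTensor q T b ν x y‖ ^ 2 = 0)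
    {i j : ι} (hij : i ≠ j) (hs : q ⁅T (b j) (b (ν i)), b i⁆ (b (ν j)) ≠ 0) :
    ∃ G ∈ rootSpace H (wt i - wt j), ∀ k l,
      q ⁅G, b l⁆ (b (ν k)) = conj (q ⁅T (b j) (b (ν i)), b k⁆ (b (ν l))) := by
  set A := T (b j) (b (ν i)) with hAdef
  have hA : A ∈ rootSpace H (wt j - wt i) := w.map_mem h i j
  have hinj : ∀ i j, ν i = ν j ↔ i = j := fun i j =>
      ⟨fun h => by rw [← w.involutive i, h, w.involutive], fun h => by rw [h]⟩
  let a : Matrix ι ι ℂ := fun k l => q ⁅A, b l⁆ (b (ν k))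
  have ha : ∀ k l, a (ν l) (ν k) = -a k l := fun k l => by
    simp only [a]
    rw [w.involutive, h.skew, h.symm]
  have ha0 : ∀ k l, a k l ≠ 0 → wt k = wt l + (wt j - wt i) := fun k l hkl => by
    by_contra hc
    exact hkl (w.coeff_eq_zero h hA fun hc' => hc (by rw [← hc']; abel))
  have haE : ∀ l, ⁅A, b l⁆ = ∑ k, a k l • b k := fun l => by
    rw [← b.sum_repr ⁅A, b l⁆]
    exact Finset.sum_congr rfl fun k _ => by rw [← w.form_eq]
  have hcomm : tensorSquareAction a * momentTensor q T b ν =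
      momentTensor q T b ν * tensorSquareAction a := by
    rw [← sub_eq_zero]
    ext ⟨x, y⟩ ⟨z, u⟩
    rw [momentTensor_commutator_apply w.involutive w.form a ha (toEnd ℂ 𝔤 M A) haE]
    simp only [toEnd_apply_apply]
    rw [leibniz_lie A, h.equivariant, add_lie]
    simp
    ring
  -- The operator `a aᴴ - aᴴ a` preserves weights, and distinct basis vectors have distinct weights.
  have hdiag : ∀ k l, k ≠ l → (a * a.conjTranspose - a.conjTranspose * a) k l = 0 := by
    intro k l hkl
    rw [Matrix.sub_apply, Matrix.mul_apply, Matrix.mul_apply, Finset.sum_eq_zero,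
      Finset.sum_eq_zero, sub_zero]
    · intro m _
      by_contra hc
      have h1 := ha0 m k fun h0 => hc (by simp [h0])
      have h2 := ha0 m l fun h0 => hc (by simp [h0])
      exact hkl (w.injective (by simpa using h1.symm.trans h2))
    · intro m _
      by_contra hc
      have h1 := ha0 k m fun h0 => hc (by simp [h0])
      have h2 := ha0 l m fun h0 => hc (by simp [h0])
      exact hkl (w.injective (by rw [h1, h2]))
  have hadj := tensorSquareAction_conjTranspose_commute ν w.involutive _ hcrit a ha hdiag hcomm
  have haH : ∀ k l, a.conjTranspose (ν l) (ν k) = -a.conjTranspose k l := fun k l => by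
    simp only [Matrix.conjTranspose_apply]
    rw [ha, star_neg]
  let E : M →ₗ[ℂ] M := Matrix.toLin b b a.conjTranspose
  have hE : ∀ l, E (b l) = ∑ k, a.conjTranspose k l • b k := fun l => Matrix.toLin_self ..
  have hEwt : ∀ l, E (b l) ∈ weightSpace M (wt l - (wt j - wt i)) := fun l => by
    rw [hE]
    refine Submodule.sum_mem _ fun k _ => ?_
    by_cases hk : a l k = 0
    · simp [Matrix.conjTranspose_apply, hk]
    · refine Submodule.smul_mem _ _ ?_
      have := ha0 l k hk
      rw [this, add_sub_cancel_right]
      exact w.mem k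
  have hder : ∀ k i l, E ⁅T (b k) (b (ν i)), b l⁆ = ⁅T (E (b k)) (b (ν i)), b l⁆ +
      ⁅T (b k) (E (b (ν i))), b l⁆ + ⁅T (b k) (b (ν i)), E (b l)⁆ := by
    intro k i l
    rw [← sub_eq_zero]
    refine b.ext_elem fun m => ?_
    rw [← w.form_eq, ← w.form_eq]
    have h1 := momentTensor_commutator_apply (T := T) w.involutive w.form _ haH E hE i m k l
    rw [hadj, sub_self, Matrix.zero_apply] at h1
    rw [LinearMap.map_zero, LinearMap.zero_apply, h1]
    congr 2
    abel
  -- a weight vector whose Cartan element is not killed by the root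
  obtain ⟨d, hd⟩ : ∃ d, q ⁅T (b d) (b (ν d)), b j⁆ (b (ν j)) -
      q ⁅T (b d) (b (ν d)), b i⁆ (b (ν i)) ≠ 0 := by
    have hij' : j ≠ ν i := by
      rintro rfl
      rw [h.map_self] at hAdef
      apply hs; rw [hAdef]; simp
    rw [w.edge_eq h hij.symm hij'] at hs
    by_cases hj : wt j = 0
    · refine ⟨i, ?_⟩
      have hi : wt i ≠ 0 := fun hc => hij (w.injective (hc.trans hj.symm))
      rw [w.diag_self h hi, IsWeightBasis.diag_symm h, w.diag_of_wt_eq_zero h hj]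
      simp
    · refine ⟨j, ?_⟩
      rw [w.diag_self h hj, IsWeightBasis.diag_symm h j i]
      exact hs
  have ht : T (b d) (b (ν d)) ∈ H := h.map_mem_cartan (w.mem d) (by rw [← w.neg]; exact w.mem _)
  set α : ℂ := q ⁅T (b d) (b (ν d)), b j⁆ (b (ν j)) - q ⁅T (b d) (b (ν d)), b i⁆ (b (ν i)) with hα
  have hα' : (wt j - wt i) ⟨_, ht⟩ = α := by
    rw [Pi.sub_apply, w.wt_map_self, w.wt_map_self]
  -- The adjoint `E` is a derivation lowering weights by `wt j - wt i`. For `t = T(b_d, b_νd)` the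
  -- commutator `[E, t]` is therefore `α E`, while the derivation property writes it as the action
  -- of an element of `𝔤`.
  refine ⟨α⁻¹ • (T (E (b d)) (b (ν d)) + T (b d) (E (b (ν d)))),
    Submodule.smul_mem _ _ (add_mem ?_ ?_), fun k l => ?_⟩
  · have := h.map_mem_rootSpace (hEwt d) (w.mem (ν d))
    rwa [w.neg, show wt d - (wt j - wt i) + -wt d = wt i - wt j by abel] at this
  · have := h.map_mem_rootSpace (w.mem d) (hEwt (ν d))
    rwa [w.neg, show wt d + (-wt d - (wt j - wt i)) = wt i - wt j by abel] at this
  · have h1 := hder d d l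
    have h2 := w.wt_apply ⟨_, ht⟩ l
    have h3 := (mem_weightSpace _ _).mp (hEwt l) ⟨_, ht⟩
    rw [LieSubalgebra.coe_bracket_of_module] at h3
    simp only at h2 h3
    rw [h2, h3, map_smul, Pi.sub_apply, hα'] at h1
    have h4 : ⁅T (E (b d)) (b (ν d)) + T (b d) (E (b (ν d))), b l⁆ = α • E (b l) := by
      rw [add_lie]
      rw [← sub_eq_iff_eq_add] at h1
      rw [← h1]; module
    rw [smul_lie, h4, smul_smul, inv_mul_cancel₀ hd, one_smul, hE]
    simp only [map_sum, LinearMap.sum_apply, map_smul, LinearMap.smul_apply, w.form, hinj]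
    simp only [smul_eq_mul, mul_ite, mul_one, mul_zero, Finset.sum_ite_eq, Finset.mem_univ, if_true]
    rfl

/-- The adjoint of `T(b_j, b_νi)` lies on the root line of `T(b_i, b_νj)`, so it is `c` times it.
Comparing the edge coefficients, equal by pair symmetry and real because `edge_eq` makes them `1`
minus a diagonal coefficient, gives `c = 1`. Skewness turns this statement on adjoints into the
symmetry under `ν`. -/
theorem IsWeightBasis.isCompactBasis (w : IsWeightBasis q b wt ν) (h : IsMomentMap q T)
    (hcrit : ∀ D : ι → ℝ, (∀ i, D (ν i) = -D i) →
        ∑ x, ∑ y, (D x.1 + D x.2 - D y.1 - D y.2) * ‖momentTensor q T b ν x y‖ ^ 2 = 0)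
    (hreal : ∀ i j, wt i ≠ 0 →
      conj (q ⁅T (b i) (b (ν i)), b j⁆ (b (ν j))) = q ⁅T (b i) (b (ν i)), b j⁆ (b (ν j))) :
    IsCompactBasis q T b ν := by
  have hreal' : ∀ i j,
      conj (q ⁅T (b i) (b (ν i)), b j⁆ (b (ν j))) = q ⁅T (b i) (b (ν i)), b j⁆ (b (ν j)) := by
    intro i j
    by_cases hi : wt i = 0
    · rw [w.diag_of_wt_eq_zero h hi, map_zero]
    · exact hreal i j hi
  have key : ∀ i j k l, conj (q ⁅T (b j) (b (ν i)), b k⁆ (b (ν l))) =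
      q ⁅T (b i) (b (ν j)), b l⁆ (b (ν k)) := by
    intro i j k l
    by_cases hY : q ⁅T (b j) (b (ν i)), b k⁆ (b (ν l)) = 0
    · rw [hY, map_zero]
      by_contra hc
      exact w.edge_transpose_ne_zero h (Ne.symm hc) hY
    by_cases hij : i = j
    · subst hij
      have hα : wt l - wt k = wt i - wt i := by
        by_contra hc
        exact hY (w.coeff_eq_zero h (w.map_mem h i i) hc)
      rw [sub_self, sub_eq_zero] at hα
      rw [w.injective hα]
      exact hreal' i k
    have hs := w.edge_ne_zero h hij hY
    obtain ⟨G, hG, hGA⟩ := w.exists_adjoint h hcrit hij hs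
    have hF := w.map_mem h j i
    have hs' : q ⁅T (b i) (b (ν j)), b j⁆ (b (ν i)) = q ⁅T (b j) (b (ν i)), b i⁆ (b (ν j)) :=
      IsWeightBasis.edge_symm h ..
    have hF0 : T (b i) (b (ν j)) ≠ 0 := fun hc => hs (by rw [← hs', hc]; simp)
    obtain ⟨c, rfl⟩ := exists_smul_of_mem_rootSpace H
      (sub_ne_zero.mpr fun hc => hij (w.injective hc)) hF hG hF0
    have hij' : j ≠ ν i := by
      rintro rfl
      rw [h.map_self] at hs; simp at hs
    have h1 := hGA i j
    have h2 : conj (q ⁅T (b j) (b (ν i)), b i⁆ (b (ν j))) =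
        q ⁅T (b j) (b (ν i)), b i⁆ (b (ν j)) := by
      rw [w.edge_eq h (Ne.symm hij) hij', map_sub, map_one, hreal']
    rw [h2, smul_lie, map_smul, LinearMap.smul_apply, hs', smul_eq_mul] at h1
    have hc : c = 1 := mul_right_cancel₀ hs (by rw [h1, one_mul])
    rw [← hGA k l, hc, one_smul]
  refine ⟨w.involutive, w.form, fun i j k l => ?_⟩
  have h1 := key (ν j) i k (ν l)
  rw [w.involutive, w.involutive] at h1
  rw [h1, h.form_skew_left, h.form_skew_right, neg_neg]

end CompactBasis

/-! ### Existence of compact bases. -/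

section Existence

variable {𝔤 : Type*} [LieRing 𝔤] [LieAlgebra ℂ 𝔤]
  {M : Type*} [AddCommGroup M] [Module ℂ M] [LieRingModule 𝔤 M] [LieModule ℂ 𝔤 M]
  {q : M →ₗ[ℂ] M →ₗ[ℂ] ℂ} {T : M →ₗ[ℂ] M →ₗ[ℂ] 𝔤}

open LieAlgebra LieModule

theorem IsCompactBasis.reindex {ι κ : Type*} [DecidableEq ι] [DecidableEq κ]
    {b : Module.Basis ι ℂ M} {ν : ι → ι} (hb : IsCompactBasis q T b ν) (e : ι ≃ κ) :
    IsCompactBasis q T (b.reindex e) fun i => e (ν (e.symm i)) := by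
  refine ⟨fun i => by simp [hb.involutive], fun i j => ?_, fun i j k l => ?_⟩
  · simp only [Module.Basis.reindex_apply, hb.form]
    congr 1
    rw [Equiv.symm_apply_eq]
  · simpa using hb.real (e.symm i) (e.symm j) (e.symm k) (e.symm l)

/-- Through `q` the operator of `a` is conjugate to minus its transpose. -/
theorem IsMomentMap.trace_toEnd_eq_zero [FiniteDimensional ℂ M] (h : IsMomentMap q T) (a : 𝔤) :
    LinearMap.trace ℂ M (toEnd ℂ 𝔤 M a) = 0 := by
  have hinj : Function.Injective q := by
    rw [← LinearMap.ker_eq_bot, LinearMap.ker_eq_bot']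
    intro m hm
    exact h.nondeg m fun n => by rw [hm]; rfl
  let e : M ≃ₗ[ℂ] Module.Dual ℂ M := LinearEquiv.ofInjectiveOfFinrankEq q hinj
    (Subspace.dual_finrank_eq (K := ℂ) (V := M)).symm
  have he : ∀ m n, e m n = q m n := fun _ _ => rfl
  have h1 : e.conj (toEnd ℂ 𝔤 M a) = -Module.Dual.transpose (R := ℂ) (toEnd ℂ 𝔤 M a) := by
    ext f m
    obtain ⟨n, rfl⟩ := e.surjective f
    simp [LinearEquiv.conj_apply, he, Module.Dual.transpose_apply, h.skew]
  have h2 := LinearMap.trace_conj' (toEnd ℂ 𝔤 M a) e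
  rw [h1, map_neg, LinearMap.trace_transpose'] at h2
  have h3 : (2 : ℂ) * LinearMap.trace ℂ M (toEnd ℂ 𝔤 M a) = 0 := by linear_combination -h2
  exact (mul_eq_zero.mp h3).resolve_left two_ne_zero

theorem IsMomentMap.isKilling [FiniteDimensional ℂ 𝔤] [FiniteDimensional ℂ M] [Nontrivial M]
    (h : IsMomentMap q T)
    (hirr : ∀ U : Submodule ℂ M, (∀ (a : 𝔤), ∀ m ∈ U, ⁅a, m⁆ ∈ U) → U = ⊥ ∨ U = ⊤) :
    IsKilling ℂ 𝔤 := by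
  have : IsFaithful ℂ 𝔤 M := ⟨fun a b hab => by
    refine sub_eq_zero.mp (h.faithful _ fun m => ?_)
    rw [sub_lie, sub_eq_zero]
    exact LinearMap.congr_fun hab m⟩
  have : IsIrreducible ℂ 𝔤 M := by
    have : Nontrivial (LieSubmodule ℂ 𝔤 M) := inferInstance
    refine IsIrreducible.mk fun N hN => ?_
    have := (hirr N.toSubmodule fun a m hm => N.lie_mem hm).resolve_left fun hc => hN (by
      rwa [← LieSubmodule.toSubmodule_eq_bot])
    rwa [← LieSubmodule.toSubmodule_eq_top]
  have := hasTrivialRadical_of_isIrreducible_of_isFaithful ℂ 𝔤 M h.trace_toEnd_eq_zero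
  infer_instance

/-- Only the irreducible case uses weights and `hreal`; there a faithful irreducible representation
by traceless operators makes `𝔤` semisimple. -/
theorem IsMomentMap.exists_isCompactBasis [FiniteDimensional ℂ 𝔤] [FiniteDimensional ℂ M]
    (h : IsMomentMap q T) (H : LieSubalgebra ℂ 𝔤) [H.IsCartanSubalgebra]
    (hreal : ∀ (β γ : H → ℂ) (m p n k : M), β ≠ 0 → m ∈ weightSpace M β →
      p ∈ weightSpace M (-β) → n ∈ weightSpace M γ → k ∈ weightSpace M (-γ) → q m p = 1 →
      q n k = 1 → ∃ r : ℝ, q ⁅T m p, n⁆ k = r) :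
    ∃ (n : ℕ) (b : Module.Basis (Fin n) ℂ M) (ν : Fin n → Fin n), IsCompactBasis q T b ν := by
  rcases subsingleton_or_nontrivial M with _ | _
  · exact ⟨0, Module.Basis.empty M, id, fun i => i.elim0, fun i => i.elim0, fun i => i.elim0⟩
  by_cases hirr : ∀ U : Submodule ℂ M, (∀ (a : 𝔤), ∀ m ∈ U, ⁅a, m⁆ ∈ U) → U = ⊥ ∨ U = ⊤
  · have := h.isKilling hirr
    obtain ⟨n, b, wt, ν, w⟩ := h.exists_isWeightBasis (H := H) hirr (iSup_weightSpace_eq_top hirr)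
    obtain ⟨b', w', hcrit⟩ := w.exists_critical h
    refine ⟨n, b', ν, w'.isCompactBasis h hcrit fun i j hi => ?_⟩
    obtain ⟨r, hr⟩ := hreal (wt i) (wt j) (b' i) (b' (ν i)) (b' j) (b' (ν j)) hi
      (w'.mem i) (by rw [← w'.neg]; exact w'.mem _) (w'.mem j) (by rw [← w'.neg]; exact w'.mem _)
      (by rw [w'.form]; simp) (by rw [w'.form]; simp)
    rw [hr, Complex.conj_ofReal]
  · push Not at hirr
    obtain ⟨U, hinv, hU0, hU⟩ := hirr
    obtain ⟨n, b, hb⟩ := h.exists_isCompactBasis_of_invariant U hU hU0 hinv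
    exact ⟨_, _, _, hb.reindex finSumFinEquiv⟩

end Existence

/-! ### The graded structure of the superalgebra. -/

namespace LieSuperalgebra

variable {V : Type*} [AddCommGroup V] [Module ℂ V] (L : LieSuperalgebra V)

theorem exists_add_eq (b : V) : ∃ b₀ ∈ L.part 0, ∃ b₁ ∈ L.part 1, b = b₀ + b₁ := by
  have : b ∈ L.part 0 ⊔ L.part 1 := L.isCompl.sup_eq_top ▸ Submodule.mem_top
  obtain ⟨b₀, h₀, b₁, h₁, rfl⟩ := Submodule.mem_sup.mp this
  exact ⟨b₀, h₀, b₁, h₁, rfl⟩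

theorem part_induction {P : V → Prop} (hadd : ∀ a b, P a → P b → P (a + b))
    (h0 : ∀ a ∈ L.part 0, P a) (h1 : ∀ a ∈ L.part 1, P a) (b : V) : P b := by
  obtain ⟨b₀, h₀, b₁, h₁, rfl⟩ := L.exists_add_eq b
  exact hadd _ _ (h0 _ h₀) (h1 _ h₁)

theorem even_jacobi {a : V} (ha : a ∈ L.part 0) (b c : V) :
    L.br a (L.br b c) = L.br (L.br a b) c + L.br b (L.br a c) := by
  refine L.part_induction (P := fun b => L.br a (L.br b c) = L.br (L.br a b) c + L.br b (L.br a c))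
    (fun b b' h h' => ?_) (fun b hb => ?_) (fun b hb => ?_) b
  · simp only [map_add, LinearMap.add_apply] at h h' ⊢
    rw [h, h']; abel
  · simpa using L.jacobi 0 0 a b c ha hb
  · simpa using L.jacobi 0 1 a b c ha hb

theorem even_skew {a : V} (ha : a ∈ L.part 0) (b : V) : L.br a b = -L.br b a := by
  refine L.part_induction (P := fun b => L.br a b = -L.br b a)
    (fun b b' h h' => ?_) (fun b hb => ?_) (fun b hb => ?_) b
  · simp only [map_add, LinearMap.add_apply] at h h' ⊢
    rw [h, h']; abel
  · simpa using L.skew 0 0 a b ha hb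
  · simpa using L.skew 0 1 a b ha hb

theorem odd_comm {a b : V} (ha : a ∈ L.part 1) (hb : b ∈ L.part 1) : L.br a b = L.br b a := by
  simpa [ZMod.val_one] using L.skew 1 1 a b ha hb

theorem odd_jacobi {a b : V} (ha : a ∈ L.part 1) (hb : b ∈ L.part 1) (c : V) :
    L.br a (L.br b c) = L.br (L.br a b) c - L.br b (L.br a c) := by
  have := L.jacobi 1 1 a b c ha hb
  simpa [ZMod.val_one, sub_eq_add_neg] using this

theorem br_even_odd {a b : V} (ha : a ∈ L.part 0) (hb : b ∈ L.part 1) : L.br a b ∈ L.part 1 :=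
  L.br_mem 0 1 a b ha hb

theorem br_odd_odd {a b : V} (ha : a ∈ L.part 1) (hb : b ∈ L.part 1) : L.br a b ∈ L.part 0 :=
  L.br_mem 1 1 a b ha hb

/-- The centralizer of `{e, x, f}` in the even part, as a Lie algebra. -/
def evenCentralizer (e x f : V) : LieSubalgebra ℂ L.Even where
  carrier := {a | L.br a e = 0 ∧ L.br a x = 0 ∧ L.br a f = 0}
  add_mem' := by
    rintro a b ⟨h1, h2, h3⟩ ⟨h4, h5, h6⟩
    simp [h1, h2, h3, h4, h5, h6]
  zero_mem' := by simp
  smul_mem' := by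
    rintro c a ⟨h1, h2, h3⟩
    simp [h1, h2, h3]
  lie_mem' := by
    rintro a b ⟨h1, h2, h3⟩ ⟨h4, h5, h6⟩
    have key : ∀ v : V, L.br a v = 0 → L.br b v = 0 → L.br (⁅a, b⁆ : L.Even) v = 0 := by
      intro v ha hb
      have := L.even_jacobi a.2 b v
      rw [ha, hb, map_zero, map_zero, add_zero] at this
      exact this.symm
    exact ⟨key e h1 h4, key x h2 h5, key f h3 h6⟩

/-- The odd eigenspace of `ad x` for the eigenvalue `-1/2`. -/
noncomputable def oddHalf (x : V) : Submodule ℂ V := L.part 1 ⊓ L.eigen x (-(1 / 2))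

theorem mem_eigen {x v : V} {j : ℂ} : v ∈ L.eigen x j ↔ L.br x v = j • v :=
  Module.End.mem_eigenspace_iff

variable {L}

theorem br_mem_oddHalf {e x f : V} (a : L.evenCentralizer e x f) {m : V} (hm : m ∈ L.oddHalf x) :
    L.br ((a : L.Even) : V) m ∈ L.oddHalf x := by
  refine ⟨L.br_even_odd (a : L.Even).2 hm.1, ?_⟩
  have h1 := L.even_jacobi (a : L.Even).2 x m
  rw [a.2.2.1, L.mem_eigen.mp hm.2] at h1
  rw [SetLike.mem_coe, L.mem_eigen]
  simpa using h1.symm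

instance (e x f : V) : LieRingModule (L.evenCentralizer e x f) (L.oddHalf x) where
  bracket a m := ⟨L.br ((a : L.Even) : V) m, br_mem_oddHalf a m.2⟩
  add_lie a b m := Subtype.ext (by simp)
  lie_add a m n := Subtype.ext (by simp)
  leibniz_lie a b m := Subtype.ext (L.even_jacobi (a : L.Even).2 b m)

theorem coe_lie_oddHalf {e x f : V} (a : L.evenCentralizer e x f) (m : L.oddHalf x) :
    ((⁅a, m⁆ : L.oddHalf x) : V) = L.br ((a : L.Even) : V) m := rfl

instance (e x f : V) : LieModule ℂ (L.evenCentralizer e x f) (L.oddHalf x) where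
  smul_lie t a m := Subtype.ext (by simp [coe_lie_oddHalf])
  lie_smul t a m := Subtype.ext (by simp [coe_lie_oddHalf])

variable (L)

/-- A basic Lie superalgebra with a minimal `sl₂`-triple splitting off its even part. -/
structure IsMinimalTriple (B : V →ₗ[ℂ] V →ₗ[ℂ] ℂ) (e x f : V) : Prop where
  basic : L.IsBasic B
  triple : L.IsTriple e x f
  splits : L.EvenPartSplits e x f
  minimal : L.IsMinimalGrading x f

namespace IsMinimalTriple

variable {L} {B : V →ₗ[ℂ] V →ₗ[ℂ] ℂ} {e x f : V}

section Basics

variable (h : L.IsMinimalTriple B e x f)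
include h

theorem e_ne_zero : e ≠ 0 := fun hc => h.triple.x_ne_zero (by rw [← h.triple.br_e_f, hc]; simp)

theorem f_ne_zero : f ≠ 0 := fun hc => h.triple.x_ne_zero (by rw [← h.triple.br_e_f, hc]; simp)

theorem br_self {a : V} (ha : a ∈ L.part 0) : L.br a a = 0 := by
  have h1 := L.even_skew ha a
  have h2 : (2 : ℂ) • L.br a a = 0 := by rw [two_smul]; nth_rewrite 1 [h1]; simp
  exact (smul_eq_zero.mp h2).resolve_left two_ne_zero

theorem br_f_e : L.br f e = -x := by rw [L.even_skew h.triple.f_even, h.triple.br_e_f]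
theorem br_e_x : L.br e x = -e := by rw [L.even_skew h.triple.e_even, h.triple.br_x_e]
theorem br_f_x : L.br f x = f := by rw [L.even_skew h.triple.f_even, h.triple.br_x_f, neg_neg]

theorem natural_le : L.natural e x f ≤ L.part 0 := h.splits.2 ▸ le_sup_right

theorem mem_natural {a : V} : a ∈ L.natural e x f ↔ L.br e a = 0 ∧ L.br x a = 0 ∧ L.br f a = 0 := by
  simp [natural, and_assoc]

theorem mem_evenCentralizer (a : L.Even) :
    a ∈ L.evenCentralizer e x f ↔ (a : V) ∈ L.natural e x f := by
  rw [h.mem_natural, L.even_skew h.triple.e_even, L.even_skew h.triple.x_even,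
    L.even_skew h.triple.f_even, neg_eq_zero, neg_eq_zero, neg_eq_zero]
  rfl

theorem exists_split {a : V} (ha : a ∈ L.part 0) : ∃ α β γ : ℂ, ∃ g ∈ L.natural e x f,
    a = α • e + β • x + γ • f + g := by
  rw [← h.splits.2] at ha
  obtain ⟨s, hs, g, hg, rfl⟩ := Submodule.mem_sup.mp ha
  obtain ⟨α, β, γ, rfl⟩ := Submodule.mem_span_triple.mp hs
  exact ⟨α, β, γ, g, hg, rfl⟩

theorem odd_sq {m : V} (hm : m ∈ L.part 1) : L.br x (L.br x m) = (1 / 4 : ℂ) • m := by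
  obtain ⟨a, ha, b, hb, rfl⟩ := Submodule.mem_sup.mp (h.minimal.odd_le hm)
  rw [L.mem_eigen] at ha hb
  simp only [map_add, ha, hb, map_smul, smul_add, smul_smul]
  norm_num

/-- It serves to kill the odd vectors of eigenvalue `±3/2` produced by `ad e` and `ad f`. -/
theorem odd_eigen_eq_zero {m : V} (hm : m ∈ L.part 1) {j : ℂ} (hj : L.br x m = j • m)
    (hj' : j ^ 2 ≠ 1 / 4) : m = 0 := by
  have h1 := h.odd_sq hm
  rw [hj, map_smul, hj, smul_smul, ← sub_eq_zero, ← sub_smul] at h1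
  refine (smul_eq_zero.mp h1).resolve_left fun hc => hj' ?_
  linear_combination hc

theorem form_eigen {u v : V} {i j : ℂ} (hu : L.br x u = i • u) (hv : L.br x v = j • v)
    (hij : i + j ≠ 0) : B u v = 0 := by
  have h1 : B (L.br x u) v = -B u (L.br x v) := by
    rw [L.even_skew h.triple.x_even, map_neg, LinearMap.neg_apply, h.basic.form.invariant]
  rw [hu, hv] at h1
  simp only [map_smul, LinearMap.smul_apply, smul_eq_mul] at h1
  have h2 : (i + j) * B u v = 0 := by linear_combination h1
  exact (mul_eq_zero.mp h2).resolve_left hij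

theorem form_odd_even {u v : V} (hu : u ∈ L.part 1) (hv : v ∈ L.part 0) : B u v = 0 := by
  have := h.basic.form.supersymm 1 0 u v hu hv
  rw [this, h.basic.form.even v hv u hu, mul_zero]

theorem form_comm {u v : V} (hu : u ∈ L.part 0) (hv : v ∈ L.part 0) : B u v = B v u := by
  simpa using h.basic.form.supersymm 0 0 u v hu hv

/-- By invariance `e` pairs nontrivially only with the `-1`-eigenspace, which is the line of `f`. -/
theorem form_e_f_ne_zero : B e f ≠ 0 := by
  intro hc
  apply h.e_ne_zero
  refine h.basic.form.nondegenerate e fun b => ?_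
  refine L.part_induction (P := fun b => B e b = 0) (fun a b ha hb => by simp [ha, hb])
    (fun b hb => ?_) (fun b hb => h.basic.form.even e h.triple.e_even b hb) b
  obtain ⟨y, hy, z, hz, rfl⟩ := Submodule.mem_sup.mp (h.minimal.even_le hb)
  obtain ⟨u, hu, v, hv, rfl⟩ := Submodule.mem_sup.mp hy
  have he : L.br x e = (1 : ℂ) • e := by rw [h.triple.br_x_e, one_smul]
  rw [h.minimal.eigen_neg_one] at hu
  obtain ⟨c, rfl⟩ := Submodule.mem_span_singleton.mp hu
  rw [map_add, map_add, map_smul, hc, h.form_eigen he (L.mem_eigen.mp hv) (by norm_num),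
    h.form_eigen he (L.mem_eigen.mp hz) (by norm_num)]
  simp

theorem form_x_natural {a : V} (ha : a ∈ L.natural e x f) : B x a = 0 := by
  rw [← h.triple.br_e_f, h.basic.form.invariant, (h.mem_natural.mp ha).2.2, map_zero]

theorem form_e_natural {a : V} (ha : a ∈ L.natural e x f) : B e a = 0 := by
  rw [← neg_neg e, ← h.br_e_x, map_neg, LinearMap.neg_apply, h.basic.form.invariant,
    (h.mem_natural.mp ha).2.1, map_zero, neg_zero]

theorem form_f_natural {a : V} (ha : a ∈ L.natural e x f) : B f a = 0 := by
  rw [← h.br_f_x, h.basic.form.invariant, (h.mem_natural.mp ha).2.1, map_zero]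

theorem form_natural_nondeg {a : V} (ha : a ∈ L.natural e x f)
    (hB : ∀ b ∈ L.natural e x f, B a b = 0) : a = 0 := by
  have ha0 := h.natural_le ha
  refine h.basic.form.nondegenerate a fun b => ?_
  refine L.part_induction (P := fun b => B a b = 0) (fun a b ha hb => by simp [ha, hb])
    (fun b hb => ?_) (fun b hb => h.basic.form.even a ha0 b hb) b
  obtain ⟨α, β, γ, g, hg, rfl⟩ := h.exists_split hb
  simp only [map_add, map_smul]
  rw [hB g hg, h.form_comm ha0 h.triple.e_even, h.form_comm ha0 h.triple.x_even,
    h.form_comm ha0 h.triple.f_even, h.form_e_natural ha, h.form_x_natural ha, h.form_f_natural ha]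
  simp

/-! ### Brackets with the odd part -/

theorem br_x_half {m : V} (hm : m ∈ L.oddHalf x) : L.br x m = -(1 / 2 : ℂ) • m :=
  L.mem_eigen.mp hm.2

theorem br_f_half {m : V} (hm : m ∈ L.oddHalf x) : L.br f m = 0 := by
  refine h.odd_eigen_eq_zero (L.br_even_odd h.triple.f_even hm.1) (j := -(3 / 2)) ?_ (by norm_num)
  rw [L.even_jacobi h.triple.x_even, h.triple.br_x_f, h.br_x_half hm]
  simp only [map_neg, LinearMap.neg_apply, map_smul]
  module

theorem br_x_br_e_half {m : V} (hm : m ∈ L.oddHalf x) :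
    L.br x (L.br e m) = (1 / 2 : ℂ) • L.br e m := by
  rw [L.even_jacobi h.triple.x_even, h.triple.br_x_e, h.br_x_half hm, map_smul]
  module

theorem br_e_half_odd {m : V} (hm : m ∈ L.oddHalf x) : L.br e m ∈ L.part 1 :=
  L.br_even_odd h.triple.e_even hm.1

theorem br_e_br_e_half {m : V} (hm : m ∈ L.oddHalf x) : L.br e (L.br e m) = 0 := by
  refine h.odd_eigen_eq_zero (L.br_even_odd h.triple.e_even (h.br_e_half_odd hm)) (j := 3 / 2) ?_
    (by norm_num)
  rw [L.even_jacobi h.triple.x_even, h.triple.br_x_e, h.br_x_br_e_half hm, map_smul]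
  module

theorem br_f_br_e_half {m : V} (hm : m ∈ L.oddHalf x) : L.br f (L.br e m) = (1 / 2 : ℂ) • m := by
  rw [L.even_jacobi h.triple.f_even, h.br_f_e, h.br_f_half hm, map_zero, add_zero, map_neg,
    LinearMap.neg_apply, h.br_x_half hm]
  module

theorem exists_half_add {v : V} (hv : v ∈ L.part 1) :
    ∃ m ∈ L.oddHalf x, ∃ n ∈ L.oddHalf x, v = m + L.br e n := by
  have hx := L.br_even_odd h.triple.x_even hv
  have hsq := h.odd_sq hv
  have hw : (1 / 2 : ℂ) • v + L.br x v ∈ L.part 1 := add_mem (Submodule.smul_mem _ _ hv) hx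
  have hw' : L.br x ((1 / 2 : ℂ) • v + L.br x v) = (1 / 2 : ℂ) • ((1 / 2 : ℂ) • v + L.br x v) := by
    rw [map_add, map_smul, hsq]; module
  -- `1/2 ∓ ad x` are the projections to the eigenvalues `∓1/2`. The factor `2` inverts `ad e ∘ ad
  -- f`, which is `1/2` on the eigenvalue `1/2`.
  refine ⟨(1 / 2 : ℂ) • v - L.br x v, ⟨sub_mem (Submodule.smul_mem _ _ hv) hx, ?_⟩,
    (2 : ℂ) • L.br f ((1 / 2 : ℂ) • v + L.br x v),
    Submodule.smul_mem _ _ ⟨L.br_even_odd h.triple.f_even hw, ?_⟩, ?_⟩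
  · rw [SetLike.mem_coe, L.mem_eigen, map_sub, map_smul, hsq]; module
  · rw [SetLike.mem_coe, L.mem_eigen, L.even_jacobi h.triple.x_even, h.triple.br_x_f, hw']
    simp only [map_neg, LinearMap.neg_apply, map_smul]
    module
  · have he : L.br e ((1 / 2 : ℂ) • v + L.br x v) = 0 := by
      refine h.odd_eigen_eq_zero (L.br_even_odd h.triple.e_even hw) (j := 3 / 2) ?_ (by norm_num)
      rw [L.even_jacobi h.triple.x_even, h.triple.br_x_e, hw', map_smul]; module
    have h2 : L.br e (L.br f ((1 / 2 : ℂ) • v + L.br x v)) =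
        (1 / 2 : ℂ) • ((1 / 2 : ℂ) • v + L.br x v) := by
      rw [L.even_jacobi h.triple.e_even, h.triple.br_e_f, he, map_zero, add_zero, hw']
    rw [map_smul, h2]; module

end Basics
end IsMinimalTriple
end LieSuperalgebra

/-! ### The moment map of a minimal `sl₂`-triple. -/

namespace LieSuperalgebra

variable {V : Type*} [AddCommGroup V] [Module ℂ V] (L : LieSuperalgebra V)

/-- The scalar product on the `-1/2`-eigenspace of `ad x` given by `[m, n] = (m, n) f`. -/
noncomputable def halfForm (B : V →ₗ[ℂ] V →ₗ[ℂ] ℂ) (e x f : V) :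
    L.oddHalf x →ₗ[ℂ] L.oddHalf x →ₗ[ℂ] ℂ :=
  LinearMap.mk₂ ℂ (fun m n => (B e f)⁻¹ * B e (L.br m n))
    (fun m m' n => by simp; ring) (fun c m n => by simp; ring)
    (fun m n n' => by simp; ring) (fun c m n => by simp; ring)

theorem halfForm_apply (B : V →ₗ[ℂ] V →ₗ[ℂ] ℂ) (e x f : V) (m n : L.oddHalf x) :
    L.halfForm B e x f m n = (B e f)⁻¹ * B e (L.br m n) := rfl

namespace IsMinimalTriple

variable {L} {B : V →ₗ[ℂ] V →ₗ[ℂ] ℂ} {e x f : V} (h : L.IsMinimalTriple B e x f)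
include h

theorem br_half_half (m n : L.oddHalf x) :
    L.br (m : V) n = L.halfForm B e x f m n • f := by
  have h1 : L.br (m : V) n ∈ L.eigen x (-1) := by
    rw [L.mem_eigen, L.even_jacobi h.triple.x_even, h.br_x_half m.2, h.br_x_half n.2]
    simp only [map_smul, LinearMap.smul_apply]
    module
  rw [h.minimal.eigen_neg_one] at h1
  obtain ⟨c, hc⟩ := Submodule.mem_span_singleton.mp h1
  rw [halfForm_apply, ← hc, map_smul, smul_eq_mul, mul_comm c, inv_mul_cancel_left₀
    h.form_e_f_ne_zero]

theorem halfForm_symm (m n : L.oddHalf x) :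
    L.halfForm B e x f m n = L.halfForm B e x f n m := by
  rw [halfForm_apply, halfForm_apply, L.odd_comm m.2.1 n.2.1]

theorem br_natural_e {a : V} (ha : a ∈ L.natural e x f) : L.br a e = 0 := by
  rw [L.even_skew (h.natural_le ha), (h.mem_natural.mp ha).1, neg_zero]

theorem br_natural_x {a : V} (ha : a ∈ L.natural e x f) : L.br a x = 0 := by
  rw [L.even_skew (h.natural_le ha), (h.mem_natural.mp ha).2.1, neg_zero]

theorem br_natural_f {a : V} (ha : a ∈ L.natural e x f) : L.br a f = 0 := by
  rw [L.even_skew (h.natural_le ha), (h.mem_natural.mp ha).2.2, neg_zero]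

theorem coe_mem_natural (a : L.evenCentralizer e x f) : ((a : L.Even) : V) ∈ L.natural e x f :=
  (h.mem_evenCentralizer _).mp a.2

theorem br_natural_br_e {a : V} (ha : a ∈ L.natural e x f) (v : V) :
    L.br a (L.br e v) = L.br e (L.br a v) := by
  rw [L.even_jacobi (h.natural_le ha), h.br_natural_e ha]; simp

theorem halfForm_skew (a : L.evenCentralizer e x f) (m n : L.oddHalf x) :
    L.halfForm B e x f ⁅a, m⁆ n = -L.halfForm B e x f m ⁅a, n⁆ := by
  have h1 := L.even_jacobi (a : L.Even).2 (m : V) n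
  rw [h.br_half_half, map_smul, h.br_natural_f (h.coe_mem_natural a), smul_zero] at h1
  rw [halfForm_apply, halfForm_apply, coe_lie_oddHalf, coe_lie_oddHalf, ← mul_neg, ← map_neg]
  congr 2
  exact eq_neg_of_add_eq_zero_left h1.symm

theorem form_br_e_half (m n : L.oddHalf x) :
    B (L.br e m) n = B e f * L.halfForm B e x f m n := by
  rw [h.basic.form.invariant, halfForm_apply, mul_inv_cancel_left₀ h.form_e_f_ne_zero]

theorem halfForm_nondeg (m : L.oddHalf x) (hm : ∀ n, L.halfForm B e x f m n = 0) : m = 0 := by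
  have h1 : L.br e (m : V) = 0 := by
    refine h.basic.form.nondegenerate _ fun b => ?_
    refine L.part_induction (P := fun b => B (L.br e (m : V)) b = 0)
      (fun a b ha hb => by simp [ha, hb])
      (fun b hb => h.form_odd_even (h.br_e_half_odd m.2) hb) (fun b hb => ?_) b
    obtain ⟨n, hn, p, hp, rfl⟩ := h.exists_half_add hb
    have h2 := h.form_br_e_half m ⟨n, hn⟩
    rw [hm, mul_zero] at h2
    rw [map_add, h2, h.form_eigen (h.br_x_br_e_half m.2) (h.br_x_br_e_half hp) (by norm_num),
      add_zero]
  have h2 := h.br_f_br_e_half m.2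
  rw [h1, map_zero] at h2
  exact Subtype.ext ((smul_eq_zero.mp h2.symm).resolve_left (by norm_num))

/-- The bracket `[[e, m], n]` is even of degree zero, so it lies in `ℂ x ⊕ g^♮`, and applying `ad f`
reads off its `x`-component. The factor `-4` normalises the coefficients in `moment_jacobi`. -/
theorem moment_mem (m n : L.oddHalf x) :
    (-4 : ℂ) • L.br (L.br e m) n + (2 * L.halfForm B e x f m n) • x ∈ L.natural e x f := by
  have h0 : L.br (L.br e (m : V)) n ∈ L.part 0 := L.br_odd_odd (h.br_e_half_odd m.2) n.2.1
  have hx : L.br x (L.br (L.br e (m : V)) n) = 0 := by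
    rw [L.even_jacobi h.triple.x_even, h.br_x_br_e_half m.2, h.br_x_half n.2]
    simp only [map_smul, LinearMap.smul_apply]
    module
  have hf : L.br f (L.br (L.br e (m : V)) n) = (1 / 2 * L.halfForm B e x f m n) • f := by
    rw [L.even_jacobi h.triple.f_even, h.br_f_br_e_half m.2, h.br_f_half n.2, map_zero, add_zero,
      map_smul, LinearMap.smul_apply, h.br_half_half, smul_smul]
  obtain ⟨α, β, γ, g, hg, hu⟩ := h.exists_split h0
  obtain ⟨hg1, hg2, hg3⟩ := h.mem_natural.mp hg
  have hee : L.br e e = 0 := h.br_self h.triple.e_even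
  have hxx : L.br x x = 0 := h.br_self h.triple.x_even
  have hff : L.br f f = 0 := h.br_self h.triple.f_even
  have h1 : α • e - γ • f = 0 := by
    rw [hu] at hx
    simp only [map_add, map_smul, h.triple.br_x_e, hxx, h.triple.br_x_f, hg2] at hx
    rw [← hx]; module
  have hγ : γ = 0 := by
    have := congrArg (L.br e) h1
    simp only [map_sub, map_smul, hee, h.triple.br_e_f, map_zero, smul_zero, zero_sub,
      neg_eq_zero] at this
    exact (smul_eq_zero.mp this).resolve_right h.triple.x_ne_zero
  have hα : α = 0 := by
    rw [hγ, zero_smul, sub_zero] at h1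
    exact (smul_eq_zero.mp h1).resolve_right h.e_ne_zero
  subst hγ hα
  have hβ : β = 1 / 2 * L.halfForm B e x f m n := by
    rw [hu] at hf
    simp only [map_add, map_smul, h.br_f_x, hg3, zero_smul, zero_add, add_zero] at hf
    rw [← sub_eq_zero, ← sub_smul] at hf
    exact sub_eq_zero.mp ((smul_eq_zero.mp hf).resolve_right h.f_ne_zero)
  have : (-4 : ℂ) • L.br (L.br e (m : V)) n + (2 * L.halfForm B e x f m n) • x = (-4 : ℂ) • g := by
    rw [hu, hβ]; module
  rw [this]
  exact Submodule.smul_mem _ _ hg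

/-- The map `T` with `[[e, m], n] = (m, n) x / 2 - T (m, n) / 4`. -/
noncomputable def moment :
    L.oddHalf x →ₗ[ℂ] L.oddHalf x →ₗ[ℂ] L.evenCentralizer e x f :=
  LinearMap.mk₂ ℂ (fun m n =>
    ⟨⟨(-4 : ℂ) • L.br (L.br e m) n + (2 * L.halfForm B e x f m n) • x,
      h.natural_le (h.moment_mem m n)⟩, (h.mem_evenCentralizer _).mpr (h.moment_mem m n)⟩)
    (fun m m' n => Subtype.ext (Subtype.ext (by simp; module)))
    (fun c m n => Subtype.ext (Subtype.ext (by simp; module)))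
    (fun m n n' => Subtype.ext (Subtype.ext (by simp; module)))
    (fun c m n => Subtype.ext (Subtype.ext (by simp; module)))

theorem coe_moment (m n : L.oddHalf x) : ((h.moment m n : L.Even) : V) =
    (-4 : ℂ) • L.br (L.br e m) n + (2 * L.halfForm B e x f m n) • x := rfl

theorem br_br_e_half_half (m n : L.oddHalf x) : L.br (L.br e (m : V)) n =
    (1 / 2 * L.halfForm B e x f m n) • x - (1 / 4 : ℂ) • ((h.moment m n : L.Even) : V) := by
  rw [h.coe_moment]; module

theorem ext_evenCentralizer {a b : L.evenCentralizer e x f}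
    (hab : ((a : L.Even) : V) = ((b : L.Even) : V)) : a = b :=
  Subtype.ext (Subtype.ext hab)

theorem coe_add_evenCentralizer (a b : L.evenCentralizer e x f) :
    (((a + b : L.evenCentralizer e x f) : L.Even) : V) = ((a : L.Even) : V) + ((b : L.Even) : V) :=
  rfl

theorem coe_neg_evenCentralizer (a : L.evenCentralizer e x f) :
    (((-a : L.evenCentralizer e x f) : L.Even) : V) = -((a : L.Even) : V) :=
  rfl

theorem moment_skew (m n : L.oddHalf x) : h.moment m n = -h.moment n m := by
  apply h.ext_evenCentralizer
  have h1 := L.even_jacobi h.triple.e_even (m : V) n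
  rw [L.odd_comm m.2.1 (h.br_e_half_odd n.2), h.br_half_half, map_smul, h.triple.br_e_f,
    h.br_br_e_half_half, h.br_br_e_half_half, h.halfForm_symm n m] at h1
  have h2 : (1 / 4 : ℂ) • (((h.moment m n : L.Even) : V) + ((h.moment n m : L.Even) : V)) = 0 := by
    rw [← sub_eq_zero] at h1
    rw [← h1]; module
  have h3 := (smul_eq_zero.mp h2).resolve_left (by norm_num)
  simpa using eq_neg_of_add_eq_zero_left h3

theorem coe_lie_evenCentralizer (a b : L.evenCentralizer e x f) :
    (((⁅a, b⁆ : L.evenCentralizer e x f) : L.Even) : V) = L.br ((a : L.Even) : V) (b : L.Even) :=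
  rfl

theorem moment_equivariant (a : L.evenCentralizer e x f) (m n : L.oddHalf x) :
    ⁅a, h.moment m n⁆ = h.moment ⁅a, m⁆ n + h.moment m ⁅a, n⁆ := by
  apply h.ext_evenCentralizer
  have ha := h.coe_mem_natural a
  rw [h.coe_lie_evenCentralizer, h.coe_add_evenCentralizer, h.coe_moment,
    h.coe_moment, h.coe_moment, h.halfForm_skew, coe_lie_oddHalf, coe_lie_oddHalf, map_add,
    map_smul, map_smul, h.br_natural_x ha, L.even_jacobi (h.natural_le ha), h.br_natural_br_e ha]
  module

/-- This is `-4` times the super Jacobi identity for `[e, p]`, `n`, `m`. -/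
theorem moment_jacobi (m n p : L.oddHalf x) :
    ⁅h.moment n p, m⁆ + ⁅h.moment m p, n⁆ = L.halfForm B e x f n p • m +
      L.halfForm B e x f m p • n - (2 * L.halfForm B e x f m n) • p := by
  apply Subtype.ext
  have h1 := L.odd_jacobi (h.br_e_half_odd p.2) n.2.1 (m : V)
  rw [h.br_br_e_half_half, h.br_br_e_half_half, h.br_half_half, map_smul,
    ← neg_neg (L.br (L.br e (p : V)) f), ← L.even_skew h.triple.f_even, h.br_f_br_e_half p.2,
    h.moment_skew p n, h.moment_skew p m, h.halfForm_symm n m, h.halfForm_symm p n,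
    h.halfForm_symm p m, map_sub, map_smul, map_smul, map_sub, map_smul, map_smul,
    ← neg_neg (L.br (n : V) x), ← L.even_skew h.triple.x_even, h.br_x_half n.2] at h1
  simp only [LinearMap.sub_apply, LinearMap.smul_apply, h.br_x_half m.2, h.coe_neg_evenCentralizer,
    map_neg, LinearMap.neg_apply] at h1
  rw [← neg_neg (L.br (n : V) ((h.moment m p : L.Even) : V)),
    ← L.even_skew (h.moment m p : L.Even).2] at h1
  simp only [Submodule.coe_add, Submodule.coe_sub, Submodule.coe_smul, coe_lie_oddHalf]
  rw [← sub_eq_zero] at h1 ⊢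
  have h2 := congrArg (fun v : V => (-4 : ℂ) • v) h1
  rw [smul_zero] at h2
  rw [← h2]; module

/-- `T` is dual to the action, as for a moment map. Pair symmetry and the spanning property both
follow from this. -/
theorem form_moment (m n : L.oddHalf x) (a : L.evenCentralizer e x f) :
    B ((h.moment m n : L.Even) : V) (a : L.Even) =
      -(4 * B e f * L.halfForm B e x f ⁅a, m⁆ n) := by
  have ha := h.coe_mem_natural a
  rw [h.coe_moment, map_add, map_smul, map_smul, LinearMap.add_apply, LinearMap.smul_apply,
    LinearMap.smul_apply, h.form_x_natural ha, h.basic.form.invariant,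
    ← neg_neg (L.br (n : V) _), ← L.even_skew (a : L.Even).2, ← coe_lie_oddHalf, map_neg,
    h.form_br_e_half, h.halfForm_skew]
  simp only [smul_eq_mul]; ring

theorem form_comm_evenCentralizer (a b : L.evenCentralizer e x f) :
    B ((a : L.Even) : V) (b : L.Even) = B ((b : L.Even) : V) (a : L.Even) :=
  h.form_comm (a : L.Even).2 (b : L.Even).2

theorem moment_pair_symm (m n p r : L.oddHalf x) :
    L.halfForm B e x f ⁅h.moment m n, p⁆ r = L.halfForm B e x f ⁅h.moment p r, m⁆ n := by
  have h1 := h.form_comm_evenCentralizer (h.moment p r) (h.moment m n)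
  rw [h.form_moment, h.form_moment, neg_inj] at h1
  exact mul_left_cancel₀ (mul_ne_zero (by norm_num) h.form_e_f_ne_zero) h1

/-- The elements of `g^♮` killing `M` also kill `[e, M]`, so they form a graded ideal. It does not
contain `x`, hence is zero by simplicity. -/
theorem evenCentralizer_faithful (a : L.evenCentralizer e x f)
    (ha : ∀ m : L.oddHalf x, ⁅a, m⁆ = 0) : a = 0 := by
  let K : Submodule ℂ V :=
    { carrier := {b | b ∈ L.natural e x f ∧ ∀ m ∈ L.oddHalf x, L.br b m = 0}
      add_mem' := fun hb hc => ⟨add_mem hb.1 hc.1, fun m hm => by simp [hb.2 m hm, hc.2 m hm]⟩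
      zero_mem' := ⟨zero_mem _, by simp⟩
      smul_mem' := fun c b hb => ⟨Submodule.smul_mem _ c hb.1, fun m hm => by simp [hb.2 m hm]⟩ }
  have hK0 : K ≤ L.part 0 := fun b hb => h.natural_le hb.1
  have hK : K = ⊥ ∨ K = ⊤ := by
    refine h.basic.simple.eq_bot_or_eq_top K (le_antisymm ?_ (sup_le inf_le_left inf_le_left)) ?_
    · exact le_trans (le_inf le_rfl hK0) le_sup_left
    · intro v b hb
      refine L.part_induction (P := fun v => L.br v b ∈ K)
        (fun u v hu hv => by simpa using add_mem hu hv) (fun v hv => ?_) (fun v hv => ?_) v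
      · obtain ⟨α, β, γ, g, hg, rfl⟩ := h.exists_split hv
        obtain ⟨hb1, hb2, hb3⟩ := h.mem_natural.mp hb.1
        have h1 : L.br (α • e + β • x + γ • f + g) b = L.br g b := by simp [hb1, hb2, hb3]
        have hg0 := h.natural_le hg
        rw [h1]
        refine ⟨h.mem_natural.mpr ⟨?_, ?_, ?_⟩, fun m hm => ?_⟩
        · rw [L.even_jacobi h.triple.e_even, hb1, (h.mem_natural.mp hg).1]; simp
        · rw [L.even_jacobi h.triple.x_even, hb2, (h.mem_natural.mp hg).2.1]; simp
        · rw [L.even_jacobi h.triple.f_even, hb3, (h.mem_natural.mp hg).2.2]; simp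
        · have h2 := L.even_jacobi hg0 b m
          have h3 : L.br b (L.br g m) = 0 := by
            refine hb.2 _ ?_
            exact br_mem_oddHalf ⟨⟨g, hg0⟩, (h.mem_evenCentralizer _).mpr hg⟩ hm
          rw [hb.2 m hm, h3, map_zero, add_zero] at h2
          exact h2.symm
      · obtain ⟨m, hm, n, hn, rfl⟩ := h.exists_half_add hv
        have h1 : L.br (m + L.br e n) b = 0 := by
          rw [← neg_neg (L.br (m + L.br e n) b), ← L.even_skew (hK0 hb), map_add, hb.2 m hm,
            h.br_natural_br_e hb.1, hb.2 n hn]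
          simp
        rw [h1]; exact zero_mem _
  have haK : ((a : L.Even) : V) ∈ K :=
    ⟨h.coe_mem_natural a, fun m hm => congrArg Subtype.val (ha ⟨m, hm⟩)⟩
  rcases hK with hK | hK
  · rw [hK, Submodule.mem_bot] at haK
    exact h.ext_evenCentralizer haK
  · have hxK : x ∈ K := hK ▸ Submodule.mem_top
    have := h.br_natural_e hxK.1
    rw [h.triple.br_x_e] at this
    exact absurd this h.e_ne_zero

/-- An element of `g^♮` orthogonal to all values of `T` acts trivially on `M` by `form_moment`, and
`B` is nondegenerate on `g^♮`. -/
theorem span_moment : Submodule.span ℂ {a | ∃ m n, a = h.moment m n} = ⊤ := by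
  have := h.basic.finite
  by_contra hne
  obtain ⟨φ, hφ, hle⟩ := Submodule.exists_le_ker_of_lt_top _ (lt_top_iff_ne_top.mpr hne)
  let β : L.evenCentralizer e x f →ₗ[ℂ] Module.Dual ℂ (L.evenCentralizer e x f) :=
    LinearMap.mk₂ ℂ (fun a b => B ((a : L.Even) : V) (b : L.Even)) (by simp) (by simp) (by simp)
      (by simp)
  have hβ : ∀ a b, β a b = B ((a : L.Even) : V) (b : L.Even) := fun _ _ => rfl
  have hinj : Function.Injective β := by
    rw [← LinearMap.ker_eq_bot, LinearMap.ker_eq_bot']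
    intro a ha
    refine h.ext_evenCentralizer (h.form_natural_nondeg (h.coe_mem_natural a) fun b hb => ?_)
    exact LinearMap.congr_fun ha ⟨⟨b, h.natural_le hb⟩, (h.mem_evenCentralizer _).mpr hb⟩
  have hsurj : Function.Surjective β :=
    (LinearMap.injective_iff_surjective_of_finrank_eq_finrank
      (Subspace.dual_finrank_eq).symm).mp hinj
  obtain ⟨a, rfl⟩ := hsurj φ
  have ha : a = 0 := by
    refine h.evenCentralizer_faithful a fun m => h.halfForm_nondeg _ fun n => ?_
    have h1 : β a (h.moment m n) = 0 := hle (Submodule.subset_span ⟨m, n, rfl⟩)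
    rw [hβ, h.form_comm_evenCentralizer, h.form_moment, neg_eq_zero] at h1
    exact (mul_eq_zero.mp h1).resolve_left (mul_ne_zero (by norm_num) h.form_e_f_ne_zero)
  exact hφ (by rw [ha, map_zero])

theorem isMomentMap : IsMomentMap (L.halfForm B e x f) h.moment where
  symm := h.halfForm_symm
  nondeg := h.halfForm_nondeg
  skew := h.halfForm_skew
  map_skew := h.moment_skew
  equivariant := h.moment_equivariant
  pair_symm := h.moment_pair_symm
  jacobi := h.moment_jacobi
  faithful := h.evenCentralizer_faithful
  span := h.span_moment

end IsMinimalTriple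
end LieSuperalgebra

/-! ### Cartan subalgebras, odd roots, and reality. -/

namespace LieSuperalgebra

variable {V : Type*} [AddCommGroup V] [Module ℂ V] {L : LieSuperalgebra V}

theorem coe_toEnd_pow (H : LieSubalgebra ℂ L.Even) (y : H) (z : L.Even) (k : ℕ) :
    (((LieModule.toEnd ℂ H L.Even y ^ k) z : L.Even) : V) = (L.br ((y : L.Even) : V) ^ k) z := by
  induction k with
  | zero => rfl
  | succ k ih => rw [pow_succ', pow_succ', Module.End.mul_apply, Module.End.mul_apply, ← ih]; rfl

theorem mem_cartan_iff [FiniteDimensional ℂ V] (H : LieSubalgebra ℂ L.Even) [H.IsCartanSubalgebra]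
    (z : L.Even) : z ∈ H ↔ ∀ y ∈ H, ∃ k : ℕ, (L.br ((y : L.Even) : V) ^ k) (z : V) = 0 := by
  conv_lhs => rw [← LieAlgebra.zeroRootSubalgebra_eq_of_is_cartan ℂ L.Even H,
    LieAlgebra.mem_zeroRootSubalgebra]
  constructor
  · intro hz y hy
    obtain ⟨k, hk⟩ := hz ⟨y, hy⟩
    exact ⟨k, by rw [← coe_toEnd_pow H ⟨y, hy⟩, hk]; rfl⟩
  · rintro hz ⟨y, hy⟩
    obtain ⟨k, hk⟩ := hz y hy
    exact ⟨k, Subtype.ext (by rw [coe_toEnd_pow, hk]; rfl)⟩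

theorem pow_apply_mem {W : Submodule ℂ V} {g : V →ₗ[ℂ] V} (hg : ∀ w ∈ W, g w ∈ W) (k : ℕ) {w : V}
    (hw : w ∈ W) : (g ^ k) w ∈ W := by
  induction k with
  | zero => exact hw
  | succ k ih => rw [pow_succ', Module.End.mul_apply]; exact hg _ ih

namespace IsMinimalTriple

variable {B : V →ₗ[ℂ] V →ₗ[ℂ] ℂ} {e x f : V} (h : L.IsMinimalTriple B e x f)
include h

theorem br_sl2 (p q r p' q' r' : ℂ) :
    L.br (p • e + q • x + r • f) (p' • e + q' • x + r' • f) =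
      (q * p' - p * q') • e + (p * r' - r * p') • x + (r * q' - q * r') • f := by
  simp only [map_add, map_smul, LinearMap.add_apply, LinearMap.smul_apply, h.triple.br_e_f,
    h.triple.br_x_e, h.triple.br_x_f, h.br_f_e, h.br_e_x, h.br_f_x, h.br_self h.triple.e_even,
    h.br_self h.triple.x_even, h.br_self h.triple.f_even]
  module

theorem br_sl2_natural (p q r : ℂ) {n : V} (hn : n ∈ L.natural e x f) :
    L.br (p • e + q • x + r • f) n = 0 := by
  obtain ⟨h1, h2, h3⟩ := h.mem_natural.mp hn
  simp [h1, h2, h3]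

theorem br_natural_sl2 (p q r : ℂ) {n : V} (hn : n ∈ L.natural e x f) :
    L.br n (p • e + q • x + r • f) = 0 := by
  simp [h.br_natural_e hn, h.br_natural_x hn, h.br_natural_f hn]

theorem sl2_mem (p q r : ℂ) : p • e + q • x + r • f ∈ L.part 0 :=
  add_mem (add_mem (Submodule.smul_mem _ _ h.triple.e_even)
    (Submodule.smul_mem _ _ h.triple.x_even)) (Submodule.smul_mem _ _ h.triple.f_even)

theorem sl2_add_natural_eq_zero {α β γ : ℂ} {g : V} (hg : g ∈ L.natural e x f)
    (h0 : α • e + β • x + γ • f + g = 0) : α = 0 ∧ β = 0 ∧ γ = 0 ∧ g = 0 := by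
  have h1 := congrArg (L.br x) h0
  have h2 := congrArg (L.br e) h0
  have h3 := congrArg (L.br e) h1
  obtain ⟨hg1, hg2, hg3⟩ := h.mem_natural.mp hg
  simp only [map_add, map_smul, h.triple.br_e_f, h.triple.br_x_e, h.triple.br_x_f, h.br_e_x,
    h.br_self h.triple.e_even, h.br_self h.triple.x_even, hg1, hg2, map_zero, smul_zero,
    zero_add, add_zero, smul_neg, map_neg, neg_eq_zero] at h1 h2 h3
  have hγ := (smul_eq_zero.mp h3).resolve_right h.triple.x_ne_zero
  subst hγ
  simp only [zero_smul, neg_zero, add_zero, neg_eq_zero] at h0 h1 h2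
  have hα := (smul_eq_zero.mp h1).resolve_right h.e_ne_zero
  have hβ := (smul_eq_zero.mp h2).resolve_right h.e_ne_zero
  subst hα hβ
  simpa using h0

theorem br_mem_natural {a n : V} (ha : a ∈ L.part 0) (hn : n ∈ L.natural e x f) :
    L.br a n ∈ L.natural e x f := by
  obtain ⟨α, β, γ, g, hg, rfl⟩ := h.exists_split ha
  rw [map_add, LinearMap.add_apply, h.br_sl2_natural _ _ _ hn, zero_add]
  obtain ⟨hb1, hb2, hb3⟩ := h.mem_natural.mp hn
  obtain ⟨hg1, hg2, hg3⟩ := h.mem_natural.mp hg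
  refine h.mem_natural.mpr ⟨?_, ?_, ?_⟩
  · rw [L.even_jacobi h.triple.e_even, hb1, hg1]; simp
  · rw [L.even_jacobi h.triple.x_even, hb2, hg2]; simp
  · rw [L.even_jacobi h.triple.f_even, hb3, hg3]; simp

theorem br_mem_span {a s : V} (ha : a ∈ L.part 0) (hs : s ∈ Submodule.span ℂ {e, x, f}) :
    L.br a s ∈ Submodule.span ℂ {e, x, f} := by
  obtain ⟨α, β, γ, g, hg, rfl⟩ := h.exists_split ha
  obtain ⟨p, q, r, rfl⟩ := Submodule.mem_span_triple.mp hs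
  rw [LinearMap.map_add₂, h.br_natural_sl2 _ _ _ hg, add_zero, h.br_sl2]
  exact Submodule.mem_span_triple.mpr ⟨_, _, _, rfl⟩

theorem br_sl2_sq (p q r p' q' r' : ℂ) :
    L.br (p • e + q • x + r • f) (L.br (p • e + q • x + r • f)
      (L.br (p • e + q • x + r • f) (p' • e + q' • x + r' • f))) =
      (q ^ 2 + 2 * p * r) • L.br (p • e + q • x + r • f) (p' • e + q' • x + r' • f) := by
  rw [h.br_sl2, h.br_sl2, h.br_sl2]
  module

theorem form_sl2 (p q r p' q' r' : ℂ) :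
    B (p • e + q • x + r • f) (p' • e + q' • x + r' • f) = B e f * (q * q' + p * r' + r * p') := by
  have hxx : L.br x x = 0 := h.br_self h.triple.x_even
  have he : L.br x e = (1 : ℂ) • e := by rw [h.triple.br_x_e, one_smul]
  have hf : L.br x f = (-1 : ℂ) • f := by rw [h.triple.br_x_f, neg_one_smul]
  have hx : L.br x x = (0 : ℂ) • x := by rw [hxx, zero_smul]
  have h1 : B e e = 0 := h.form_eigen he he (by norm_num)
  have h2 : B e x = 0 := h.form_eigen he hx (by norm_num)
  have h3 : B x e = 0 := h.form_eigen hx he (by norm_num)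
  have h4 : B x f = 0 := h.form_eigen hx hf (by norm_num)
  have h5 : B f x = 0 := h.form_eigen hf hx (by norm_num)
  have h6 : B f f = 0 := h.form_eigen hf hf (by norm_num)
  have h7 : B f e = B e f := h.form_comm h.triple.f_even h.triple.e_even
  have h8 : B x x = B e f := by
    nth_rewrite 2 [← h.triple.br_e_f]
    rw [← h.basic.form.invariant, h.triple.br_x_e]
  simp only [map_add, map_smul, LinearMap.add_apply, LinearMap.smul_apply, smul_eq_mul, h1, h2, h3,
    h4, h5, h6, h7, h8]
  ring

theorem form_sl2_natural (p q r : ℂ) {n : V} (hn : n ∈ L.natural e x f) :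
    B (p • e + q • x + r • f) n = 0 := by
  simp [h.form_e_natural hn, h.form_x_natural hn, h.form_f_natural hn]

section Cartan

variable (H : LieSubalgebra ℂ L.Even) [H.IsCartanSubalgebra]

/-- Even elements preserve both summands `s` and `g^♮`, so nilpotency of `ad y` on `z` passes to the
components of `z`. -/
theorem natural_mem_cartan {z n : L.Even} (hz : z ∈ H) (hn : (n : V) ∈ L.natural e x f)
    (hzn : (z : V) - n ∈ Submodule.span ℂ {e, x, f}) : n ∈ H := by
  have := h.basic.finite
  rw [mem_cartan_iff] at hz ⊢
  intro y hy
  obtain ⟨k, hk⟩ := hz y hy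
  refine ⟨k, ?_⟩
  have h1 := pow_apply_mem (fun w hw => h.br_mem_natural y.2 hw) k hn
  have h2 := pow_apply_mem (fun w hw => h.br_mem_span y.2 hw) k hzn
  rw [map_sub, hk, zero_sub, neg_mem_iff] at h2
  exact (Submodule.disjoint_def.mp h.splits.1) _ h2 h1

/-- `H` need not contain `x`, only some semisimple `y` of `s`. On `s` one has `(ad y)³ = (q² + 2pr)
ad y`. The number `ν` is half a nonzero eigenvalue there, hence an eigenvalue of `y` on the odd
doublets. If `x` is not in `H`, some `z` in `H` acts non-nilpotently on it, and its `s`-component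
works. -/
theorem exists_sl2_mem_cartan : ∃ (y : L.Even) (p q r ν : ℂ), y ∈ H ∧
    (y : V) = p • e + q • x + r • f ∧ ν ≠ 0 ∧ q ^ 2 + 2 * p * r = 4 * ν ^ 2 := by
  have := h.basic.finite
  suffices ∃ (y : L.Even) (p q r : ℂ), y ∈ H ∧ (y : V) = p • e + q • x + r • f ∧
      q ^ 2 + 2 * p * r ≠ 0 by
    obtain ⟨y, p, q, r, hy, hyV, hD⟩ := this
    obtain ⟨ν, hν⟩ := IsAlgClosed.exists_pow_nat_eq ((q ^ 2 + 2 * p * r) / 4) two_pos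
    refine ⟨y, p, q, r, ν, hy, hyV, ?_, by rw [hν]; ring⟩
    rintro rfl
    apply hD
    linear_combination -4 * hν
  by_cases hx : (⟨x, h.triple.x_even⟩ : L.Even) ∈ H
  · exact ⟨_, 0, 1, 0, hx, by simp, by norm_num⟩
  · rw [mem_cartan_iff] at hx
    push Not at hx
    obtain ⟨z, hz, hzx⟩ := hx
    obtain ⟨p, q, r, n, hn, hzV⟩ := h.exists_split z.2
    have hnH : (⟨n, h.natural_le hn⟩ : L.Even) ∈ H := by
      refine h.natural_mem_cartan H hz hn ?_
      rw [hzV, add_sub_cancel_right]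
      exact Submodule.mem_span_triple.mpr ⟨_, _, _, rfl⟩
    refine ⟨z - ⟨n, h.natural_le hn⟩, p, q, r, sub_mem hz hnH, ?_, fun hD => ?_⟩
    · rw [Submodule.coe_sub, hzV, add_sub_cancel_right]
    · apply hzx 3
      have hs : ∀ p' q' r' : ℂ, L.br (z : V) (p' • e + q' • x + r' • f) =
          L.br (p • e + q • x + r • f) (p' • e + q' • x + r' • f) := by
        intro p' q' r'
        rw [hzV, LinearMap.map_add₂, h.br_natural_sl2 _ _ _ hn, add_zero]
      have hx1 : x = (0 : ℂ) • e + (1 : ℂ) • x + (0 : ℂ) • f := by simp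
      change L.br (z : V) (L.br (z : V) (L.br (z : V) x)) = 0
      rw [hx1, hs, h.br_sl2, hs, h.br_sl2, hs, h.br_sl2]
      linear_combination (norm := module) (-p * hD) • e + (r * hD) • f

theorem exists_cartan_decomposition : ∃ (y : L.Even) (p q r ν : ℂ), y ∈ H ∧
    (y : V) = p • e + q • x + r • f ∧ ν ≠ 0 ∧ q ^ 2 + 2 * p * r = 4 * ν ^ 2 ∧
    ∀ z ∈ H, ∃ θ : ℂ, ∃ n ∈ H, (n : V) ∈ L.natural e x f ∧ z = θ • y + n := by
  have := h.basic.finite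
  obtain ⟨y, p, q, r, ν, hy, hyV, hν, hD⟩ := h.exists_sl2_mem_cartan H
  refine ⟨y, p, q, r, ν, hy, hyV, hν, hD, fun z hz => ?_⟩
  obtain ⟨p', q', r', n, hn, hzV⟩ := h.exists_split z.2
  have hnH : (⟨n, h.natural_le hn⟩ : L.Even) ∈ H := by
    refine h.natural_mem_cartan H hz hn ?_
    rw [hzV, add_sub_cancel_right]
    exact Submodule.mem_span_triple.mpr ⟨_, _, _, rfl⟩
  obtain ⟨k, hk⟩ := (mem_cartan_iff H _).mp (sub_mem hz hnH) y hy
  have hsV : ((z - ⟨n, h.natural_le hn⟩ : L.Even) : V) = p' • e + q' • x + r' • f := by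
    rw [Submodule.coe_sub, hzV, add_sub_cancel_right]
  rw [hsV] at hk
  -- Since `(ad y)³ = 4ν² ad y` on `s`, nilpotency on a vector means that `ad y` kills it, so that
  -- vector is proportional to `y`.
  have hpow : ∀ j : ℕ, (L.br (y : V) ^ (2 * j + 1)) (p' • e + q' • x + r' • f) =
      (4 * ν ^ 2) ^ j • L.br (y : V) (p' • e + q' • x + r' • f) := by
    intro j
    induction j with
    | zero => simp
    | succ j ih =>
      rw [show 2 * (j + 1) + 1 = (2 * j + 1) + 1 + 1 by ring, pow_succ', pow_succ',
        Module.End.mul_apply, Module.End.mul_apply, ih, map_smul, map_smul, hyV, h.br_sl2_sq, hD,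
        smul_smul, pow_succ (4 * ν ^ 2)]
  have h0 : L.br (y : V) (p' • e + q' • x + r' • f) = 0 := by
    have h1 := hpow k
    rw [show 2 * k + 1 = (k + 1) + k by ring, pow_add, Module.End.mul_apply, hk, map_zero] at h1
    exact (smul_eq_zero.mp h1.symm).resolve_left
      (pow_ne_zero _ (mul_ne_zero (by norm_num) (pow_ne_zero _ hν)))
  rw [hyV, h.br_sl2, ← add_zero (_ + _)] at h0
  obtain ⟨h1, h2, h3, -⟩ := h.sl2_add_natural_eq_zero (zero_mem _) h0
  have hD' : q ^ 2 + 2 * p * r ≠ 0 := by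
    rw [hD]; exact mul_ne_zero (by norm_num) (pow_ne_zero _ hν)
  -- The coefficient is that of the orthogonal projection to `y` inside `s`.
  refine ⟨(q * q' + p * r' + r * p') / (q ^ 2 + 2 * p * r), _, hnH, hn, Subtype.ext ?_⟩
  rw [Submodule.coe_add, Submodule.coe_smul, hyV, hzV]
  have e1 : (q * q' + p * r' + r * p') / (q ^ 2 + 2 * p * r) * p = p' := by
    rw [div_mul_eq_mul_div, div_eq_iff hD']; linear_combination -q * h1 + p * h2
  have e2 : (q * q' + p * r' + r * p') / (q ^ 2 + 2 * p * r) * q = q' := by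
    rw [div_mul_eq_mul_div, div_eq_iff hD']; linear_combination r * h1 - p * h3
  have e3 : (q * q' + p * r' + r * p') / (q ^ 2 + 2 * p * r) * r = r' := by
    rw [div_mul_eq_mul_div, div_eq_iff hD']; linear_combination -r * h2 + q * h3
  rw [smul_add, smul_add, smul_smul, smul_smul, smul_smul, e1, e2, e3]

end Cartan

/-! ### Odd roots -/

theorem br_sl2_half (p q r : ℂ) {m : V} (hm : m ∈ L.oddHalf x) :
    L.br (p • e + q • x + r • f) m = p • L.br e m - (q / 2) • m := by
  simp only [map_add, map_smul, LinearMap.add_apply, LinearMap.smul_apply, h.br_x_half hm,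
    h.br_f_half hm]
  module

theorem br_sl2_br_e_half (p q r : ℂ) {m : V} (hm : m ∈ L.oddHalf x) :
    L.br (p • e + q • x + r • f) (L.br e m) = (q / 2) • L.br e m + (r / 2) • m := by
  simp only [map_add, map_smul, LinearMap.add_apply, LinearMap.smul_apply, h.br_e_br_e_half hm,
    h.br_x_br_e_half hm, h.br_f_br_e_half hm]
  module

theorem half_add_eq_zero {m n : V} (hm : m ∈ L.oddHalf x) (hn : n ∈ L.oddHalf x)
    (h0 : m + L.br e n = 0) : m = 0 ∧ n = 0 := by
  have h1 := congrArg (L.br f) h0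
  rw [map_add, h.br_f_half hm, h.br_f_br_e_half hn, zero_add, map_zero] at h1
  have h2 := (smul_eq_zero.mp h1).resolve_left (by norm_num)
  subst h2
  simpa using h0

/-- The element `y` of `sl₂` has on `span {m, [e, m]}` both eigenvalues `± ν`. -/
theorem exists_eigenvector {p q r ν : ℂ} (hν : ν ≠ 0) (hD : q ^ 2 + 2 * p * r = 4 * ν ^ 2)
    {m : V} (hm : m ∈ L.oddHalf x) (hm0 : m ≠ 0) : ∃ a b : ℂ, a • m + b • L.br e m ≠ 0 ∧
      L.br (p • e + q • x + r • f) (a • m + b • L.br e m) = ν • (a • m + b • L.br e m) := by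
  have hne : ∀ a b : ℂ, a • m + b • L.br e m = 0 → a = 0 ∧ b = 0 := by
    intro a b hab
    rw [← map_smul] at hab
    obtain ⟨h1, h2⟩ := h.half_add_eq_zero (Submodule.smul_mem _ a hm) (Submodule.smul_mem _ b hm) hab
    exact ⟨(smul_eq_zero.mp h1).resolve_right hm0, (smul_eq_zero.mp h2).resolve_right hm0⟩
  -- As `y² = ν²` on the doublet, `y + ν` maps it to eigenvectors. The witnesses are its values on
  -- `[e, m]` and on `m`; when the `m`-coefficient `ν - q / 2` of the second vanishes, the `[e,
  -- m]`-coefficient of the first is `2ν`.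
  by_cases hc : ν - q / 2 = 0
  · refine ⟨r / 2, ν + q / 2, fun h0 => hν ?_, ?_⟩
    · linear_combination (1 / 2) * hc + (1 / 2) * (hne _ _ h0).2
    · rw [map_add, map_smul, map_smul, h.br_sl2_half _ _ _ hm, h.br_sl2_br_e_half _ _ _ hm]
      linear_combination (norm := module) ((1 / 4) * hD) • L.br e m
  · refine ⟨ν - q / 2, p, fun h0 => hc (hne _ _ h0).1, ?_⟩
    rw [map_add, map_smul, map_smul, h.br_sl2_half _ _ _ hm, h.br_sl2_br_e_half _ _ _ hm]
    linear_combination (norm := module) ((1 / 4) * hD) • m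

section Real

open LieModule LieAlgebra

variable (H : LieSubalgebra ℂ L.Even) [H.IsCartanSubalgebra]

/-- An element of `H` acts on `g^♮` through its `g^♮`-component, which is again in `H`. -/
theorem isCartanSubalgebra_comap :
    (H.comap (L.evenCentralizer e x f).incl).IsCartanSubalgebra := by
  have := h.basic.finite
  have : LieRing.IsNilpotent (H.comap (L.evenCentralizer e x f).incl) := by
    let g : H.comap (L.evenCentralizer e x f).incl →ₗ⁅ℂ⁆ H :=
      { toFun := fun a => ⟨((a : L.evenCentralizer e x f) : L.Even), a.2⟩
        map_add' := fun _ _ => rfl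
        map_smul' := fun _ _ => rfl
        map_lie' := rfl }
    exact Function.Injective.lieAlgebra_isNilpotent (f := g) fun a b hab =>
      Subtype.ext (Subtype.ext (congrArg (Subtype.val : H → L.Even) hab))
  refine is_cartan_of_zeroRootSubalgebra_eq ℂ _ _ (le_antisymm (fun a ha => ?_)
    (le_zeroRootSubalgebra ℂ _ _))
  rw [mem_zeroRootSubalgebra] at ha
  change (a : L.Even) ∈ H
  rw [mem_cartan_iff]
  intro z hz
  obtain ⟨p, q, r, n, hn, hzV⟩ := h.exists_split z.2
  have hnH : (⟨n, h.natural_le hn⟩ : L.Even) ∈ H := by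
    refine h.natural_mem_cartan H hz hn ?_
    rw [hzV, add_sub_cancel_right]
    exact Submodule.mem_span_triple.mpr ⟨_, _, _, rfl⟩
  let y : H.comap (L.evenCentralizer e x f).incl :=
    ⟨⟨⟨n, h.natural_le hn⟩, (h.mem_evenCentralizer _).mpr hn⟩, hnH⟩
  have hpow : ∀ k : ℕ, (L.br (z : V) ^ k) ((a : L.Even) : V) =
      (((toEnd ℂ _ (L.evenCentralizer e x f) y ^ k) a : L.evenCentralizer e x f) : L.Even) := by
    intro k
    induction k with
    | zero => rfl
    | succ k ih =>
      rw [pow_succ', pow_succ', Module.End.mul_apply, Module.End.mul_apply, ih, hzV,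
        LinearMap.map_add₂, h.br_sl2_natural _ _ _ (h.coe_mem_natural _), zero_add]
      rfl
  obtain ⟨k, hk⟩ := ha y
  exact ⟨k, by rw [hpow, hk]; rfl⟩

/-- Weight vectors `m, p` of `M` of opposite weights with `(m, p) = 1` give two odd roots of `L`,
represented by `-T (m, p) / (4 (e | f)) ± y` with `y` in the `sl₂`-subalgebra. -/
theorem exists_odd_roots : ∃ y : V, (∀ n ∈ L.natural e x f, B y n = 0 ∧ B n y = 0) ∧
    ∀ (β : H.comap (L.evenCentralizer e x f).incl → ℂ) (m p : L.oddHalf x),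
      m ∈ weightSpace (L.oddHalf x) β → p ∈ weightSpace (L.oddHalf x) (-β) →
      L.halfForm B e x f m p = 1 → ∀ ε : ℂ, ε ^ 2 = 1 →
      ∃ (t : H) (α : Module.Dual ℂ H), L.IsRoot H α ∧ L.Represents B H t α ∧
        ((t : L.Even) : V) = -(4 * B e f)⁻¹ • ((h.moment m p : L.Even) : V) + ε • y := by
  have := h.basic.finite
  have := h.isCartanSubalgebra_comap H
  obtain ⟨y, p₀, q₀, r₀, ν, hy, hyV, hν, hD, hdec⟩ := h.exists_cartan_decomposition H
  have hκ := h.form_e_f_ne_zero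
  have hyn : ∀ n ∈ L.natural e x f, B (y : V) n = 0 := fun n hn => by
    rw [hyV, h.form_sl2_natural _ _ _ hn]
  have hyy : B (y : V) y = 4 * B e f * ν ^ 2 := by
    rw [hyV, h.form_sl2]; linear_combination B e f * hD
  -- Because `(y | y) = 4 (e | f) ν²`, this multiple of `y` represents the functional taking the
  -- value `ν` on `y`.
  refine ⟨(ν / (4 * B e f * ν ^ 2)) • (y : V), fun n hn => ⟨by simp [hyn n hn],
    by simp [h.form_comm (h.natural_le hn) y.2, hyn n hn]⟩, ?_⟩
  intro β m p hm hp hmp ε hε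
  -- The opposite weights cancel, so `T(m, p)` centralizes a self-normalizing subalgebra.
  have hT : h.moment m p ∈ H.comap (L.evenCentralizer e x f).incl := by
    rw [← LieSubalgebra.IsCartanSubalgebra.self_normalizing
      (H := H.comap (L.evenCentralizer e x f).incl), LieSubalgebra.mem_normalizer_iff']
    intro z hz
    have h1 : ⁅z, m⁆ = β ⟨z, hz⟩ • m := (mem_weightSpace _ _).mp hm ⟨z, hz⟩
    have h2 : ⁅z, p⁆ = (-β) ⟨z, hz⟩ • p := (mem_weightSpace _ _).mp hp ⟨z, hz⟩
    have h3 : ⁅z, h.moment m p⁆ = 0 := by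
      rw [h.moment_equivariant, h1, h2, map_smul, map_smul, LinearMap.smul_apply, Pi.neg_apply]
      module
    rw [h3]
    exact zero_mem _
  have hε0 : ε ≠ 0 := by rintro rfl; norm_num at hε
  let t : H := -(4 * B e f)⁻¹ • ⟨(h.moment m p : L.Even), hT⟩ +
    (ε * (ν / (4 * B e f * ν ^ 2))) • ⟨y, hy⟩
  have htV : ((t : L.Even) : V) = -(4 * B e f)⁻¹ • ((h.moment m p : L.Even) : V) +
      (ε * (ν / (4 * B e f * ν ^ 2))) • (y : V) := rfl
  let α : Module.Dual ℂ H := B ((t : L.Even) : V) ∘ₗ (L.part 0).subtype ∘ₗ H.toSubmodule.subtype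
  have hα : ∀ z : H, α z = B ((t : L.Even) : V) ((z : L.Even) : V) := fun _ => rfl
  have hαy : α ⟨y, hy⟩ = ε * ν := by
    rw [hα, htV, map_add, map_smul, map_smul, LinearMap.add_apply, LinearMap.smul_apply,
      LinearMap.smul_apply, hyy, h.form_comm (h.moment m p : L.Even).2 y.2,
      hyn _ (h.coe_mem_natural _), smul_zero, zero_add, smul_eq_mul]
    field_simp
  have hαn : ∀ (n : L.Even) (hn : n ∈ H) (hnat : (n : V) ∈ L.natural e x f),
      α ⟨n, hn⟩ = β ⟨⟨n, (h.mem_evenCentralizer _).mpr hnat⟩, hn⟩ := by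
    intro n hn hnat
    have h1 := h.form_moment m p ⟨n, (h.mem_evenCentralizer _).mpr hnat⟩
    have h2 := (mem_weightSpace _ _).mp hm ⟨⟨n, (h.mem_evenCentralizer _).mpr hnat⟩, hn⟩
    rw [LieSubalgebra.coe_bracket_of_module] at h2
    rw [h2, map_smul, LinearMap.smul_apply, hmp, smul_eq_mul, mul_one] at h1
    rw [hα, htV, map_add, map_smul, map_smul, LinearMap.add_apply, LinearMap.smul_apply,
      LinearMap.smul_apply, hyn _ hnat, smul_zero, add_zero, h1, smul_eq_mul]
    field_simp
  refine ⟨t, α, ⟨fun h0 => ?_, ?_⟩, fun s => rfl, by rw [htV, smul_smul]⟩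
  · rw [h0, LinearMap.zero_apply] at hαy
    exact mul_ne_zero hε0 hν hαy.symm
  · have hm0 : (m : V) ≠ 0 := by
      intro h0
      have : m = 0 := Subtype.ext h0
      rw [this, map_zero, LinearMap.zero_apply] at hmp
      exact zero_ne_one hmp
    obtain ⟨a, b, hv, hyv⟩ := h.exists_eigenvector (p := p₀) (q := q₀) (r := r₀)
      (mul_ne_zero hε0 hν) (by rw [hD, mul_pow, hε, one_mul]) m.2 hm0
    refine ⟨_, hv, ?_⟩
    rintro ⟨z, hz⟩
    obtain ⟨θ, n, hn, hnat, hzn⟩ := hdec z hz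
    have hz' : (⟨z, hz⟩ : H) = θ • ⟨y, hy⟩ + ⟨n, hn⟩ := Subtype.ext hzn
    have h2 := (mem_weightSpace _ _).mp hm ⟨⟨n, (h.mem_evenCentralizer _).mpr hnat⟩, hn⟩
    have h3 : L.br (n : V) m = β ⟨⟨n, (h.mem_evenCentralizer _).mpr hnat⟩, hn⟩ • (m : V) :=
      congrArg Subtype.val h2
    have hzV : (z : V) = θ • (y : V) + n := congrArg Subtype.val hzn
    have hαz : α ⟨z, hz⟩ = θ * (ε * ν) + β ⟨⟨n, (h.mem_evenCentralizer _).mpr hnat⟩, hn⟩ := by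
      rw [hz', map_add, map_smul, hαy, hαn n hn hnat, smul_eq_mul]
    change L.br (z : V) _ = _
    rw [hαz, hzV, LinearMap.map_add₂, LinearMap.map_smul₂, hyV, hyv, map_add (L.br (n : V)), map_smul,
      map_smul, h.br_natural_br_e hnat, h3, map_smul]
    module

/-- Averaging over the two roots `ε = ±1` removes the `sl₂`-contribution and shows that the
coefficient divided by `-4 (e | f)` is real. When the two pairs coincide the coefficient is `1`,
because `β ≠ 0` forces `q(m, m) = 0`. Hence `(e | f)` is itself real. -/
theorem exists_real_halfForm (hreal : L.HasRealRootProducts B H)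
    (β γ : H.comap (L.evenCentralizer e x f).incl → ℂ) (m p n k : L.oddHalf x) (hβ : β ≠ 0)
    (hm : m ∈ weightSpace (L.oddHalf x) β) (hp : p ∈ weightSpace (L.oddHalf x) (-β))
    (hn : n ∈ weightSpace (L.oddHalf x) γ) (hk : k ∈ weightSpace (L.oddHalf x) (-γ))
    (hmp : L.halfForm B e x f m p = 1) (hnk : L.halfForm B e x f n k = 1) :
    ∃ r : ℝ, L.halfForm B e x f ⁅h.moment m p, n⁆ k = r := by
  obtain ⟨y, hyn, hroots⟩ := h.exists_odd_roots H
  have hκ := h.form_e_f_ne_zero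
  have key : ∀ (β γ : H.comap (L.evenCentralizer e x f).incl → ℂ) (m p n k : L.oddHalf x),
      m ∈ weightSpace (L.oddHalf x) β → p ∈ weightSpace (L.oddHalf x) (-β) →
      n ∈ weightSpace (L.oddHalf x) γ → k ∈ weightSpace (L.oddHalf x) (-γ) →
      L.halfForm B e x f m p = 1 → L.halfForm B e x f n k = 1 →
      ∃ r : ℝ, L.halfForm B e x f ⁅h.moment m p, n⁆ k = -(4 * B e f) * r := by
    intro β γ m p n k hm hp hn hk hmp hnk
    obtain ⟨t, α, hα, ht, htV⟩ := hroots γ n k hn hk hnk 1 (by norm_num)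
    obtain ⟨u, α', hα', hu, huV⟩ := hroots γ n k hn hk hnk (-1) (by norm_num)
    obtain ⟨s, α'', hα'', hs, hsV⟩ := hroots β m p hm hp hmp 1 (by norm_num)
    obtain ⟨r₁, hr₁⟩ := hreal _ _ hα hα'' t s ht hs
    obtain ⟨r₂, hr₂⟩ := hreal _ _ hα' hα'' u s hu hs
    refine ⟨(r₁ + r₂) / 2, ?_⟩
    have h1 := h.form_moment n k (h.moment m p)
    rw [htV, hsV] at hr₁
    rw [huV, hsV] at hr₂
    simp only [map_add, map_smul, LinearMap.add_apply, LinearMap.smul_apply, smul_eq_mul,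
      (hyn _ (h.coe_mem_natural _)).1, (hyn _ (h.coe_mem_natural _)).2, h1] at hr₁ hr₂
    push_cast
    rw [← hr₁, ← hr₂]
    field_simp
    ring
  have hmm : L.halfForm B e x f m m = 0 := by
    obtain ⟨z, hz⟩ := Function.ne_iff.mp hβ
    have h1 := h.halfForm_skew z m m
    have h2 := (mem_weightSpace _ _).mp hm z
    rw [LieSubalgebra.coe_bracket_of_module] at h2
    rw [h2] at h1
    simp only [map_smul, LinearMap.smul_apply, smul_eq_mul] at h1
    have h3 : (2 * β z) * L.halfForm B e x f m m = 0 := by linear_combination h1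
    exact (mul_eq_zero.mp h3).resolve_left (mul_ne_zero two_ne_zero hz)
  obtain ⟨r, hr⟩ := key β γ m p n k hm hp hn hk hmp hnk
  obtain ⟨r₀, hr₀⟩ := key β β m p m p hm hp hm hp hmp hmp
  rw [h.isMomentMap.lie_map_self, hmp, hmm, one_smul, zero_smul, sub_zero, hmp] at hr₀
  have hr₀0 : (r₀ : ℂ) ≠ 0 := by
    intro hc
    rw [hc, mul_zero] at hr₀
    exact one_ne_zero hr₀
  refine ⟨r₀⁻¹ * r, ?_⟩
  rw [hr]
  push_cast
  rw [eq_inv_of_mul_eq_one_left hr₀.symm]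

theorem exists_isCompactBasis (hreal : L.HasRealRootProducts B H) :
    ∃ (n : ℕ) (b : Module.Basis (Fin n) ℂ (L.oddHalf x)) (ν : Fin n → Fin n),
      IsCompactBasis (L.halfForm B e x f) h.moment b ν := by
  have := h.basic.finite
  have := h.isCartanSubalgebra_comap H
  exact h.isMomentMap.exists_isCompactBasis _ (h.exists_real_halfForm H hreal)

end Real

end IsMinimalTriple
end LieSuperalgebra

/-! ### From a compact basis to compatible conjugations. -/

section CompactConjugation

open LieModule

variable {𝔤 M : Type*} [LieRing 𝔤] [LieAlgebra ℂ 𝔤] [AddCommGroup M] [Module ℂ M]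
  [LieRingModule 𝔤 M] [LieModule ℂ 𝔤 M]

/-- A pair of compatible conjugations of `M` and of `𝔤`, the second one being compact. -/
structure IsCompactConjugation (q : M →ₗ[ℂ] M →ₗ[ℂ] ℂ) (T : M →ₗ[ℂ] M →ₗ[ℂ] 𝔤)
    (J : M →ₛₗ[starRingEnd ℂ] M) (σ : 𝔤 →ₛₗ[starRingEnd ℂ] 𝔤) : Prop where
  involutive : ∀ m, J (J m) = m
  involutive_lie : ∀ a, σ (σ a) = a
  form : ∀ m n, q (J m) (J n) = conj (q m n)
  moment : ∀ m n, σ (T m n) = T (J m) (J n)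
  lie : ∀ a m, ⁅σ a, J m⁆ = J ⁅a, m⁆
  neg : ∀ a, σ a = a → a ≠ 0 → (traceForm ℂ 𝔤 M a a).re < 0

theorem Module.Basis.forall_of_forall {ι : Type*} (b : Module.Basis ι ℂ M) {P : M → Prop}
    (h0 : P 0)
    (hadd : ∀ m n, P m → P n → P (m + n)) (hsmul : ∀ (c : ℂ) m, P m → P (c • m))
    (hb : ∀ i, P (b i)) (m : M) : P m := by
  have hm : m ∈ Submodule.span ℂ (Set.range b) := b.mem_span m
  induction hm using Submodule.span_induction with
  | mem x hx => obtain ⟨i, rfl⟩ := hx; exact hb i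
  | zero => exact h0
  | add x y _ _ hx hy => exact hadd _ _ hx hy
  | smul c x _ hx => exact hsmul _ _ hx

variable {ι : Type*} [Fintype ι] [DecidableEq ι]

/-- The conjugation of `M` which permutes a basis by `ν`. -/
noncomputable def Module.Basis.conjugation (b : Module.Basis ι ℂ M) (ν : ι → ι) :
    M →ₛₗ[starRingEnd ℂ] M where
  toFun m := ∑ i, conj (b.repr m i) • b (ν i)
  map_add' m n := by simp [add_smul, Finset.sum_add_distrib]
  map_smul' c m := by simp [mul_smul, Finset.smul_sum]

theorem Module.Basis.conjugation_apply_self (b : Module.Basis ι ℂ M) (ν : ι → ι) (i : ι) :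
    b.conjugation ν (b i) = b (ν i) := by
  change ∑ j, conj (b.repr (b i) j) • b (ν j) = _
  rw [Finset.sum_eq_single i (fun j _ hj => by simp [hj]) (by simp)]
  simp

namespace IsCompactBasis

variable {q : M →ₗ[ℂ] M →ₗ[ℂ] ℂ} {T : M →ₗ[ℂ] M →ₗ[ℂ] 𝔤} {b : Module.Basis ι ℂ M} {ν : ι → ι}
  (hb : IsCompactBasis q T b ν)
include hb

theorem conjugation_involutive (m : M) : b.conjugation ν (b.conjugation ν m) = m := by
  refine b.forall_of_forall (P := fun m => b.conjugation ν (b.conjugation ν m) = m)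
    (by simp) (fun m n hm hn => by simp [hm, hn]) (fun c m hm => by simp [hm]) (fun i => ?_) m
  rw [b.conjugation_apply_self, b.conjugation_apply_self, hb.involutive]

theorem form_conjugation (m n : M) :
    q (b.conjugation ν m) (b.conjugation ν n) = conj (q m n) := by
  refine b.forall_of_forall
    (P := fun m => q (b.conjugation ν m) (b.conjugation ν n) = conj (q m n))
    (by simp) (fun _ _ h1 h2 => by simp [h1, h2]) (fun c _ h1 => by simp [h1]) (fun i => ?_) m
  refine b.forall_of_forall
    (P := fun n => q (b.conjugation ν (b i)) (b.conjugation ν n) = conj (q (b i) n))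
    (by simp) (fun _ _ h1 h2 => by simp [h1, h2]) (fun c _ h1 => by simp [h1]) (fun j => ?_) n
  rw [b.conjugation_apply_self, b.conjugation_apply_self, hb.form, hb.form, hb.involutive]
  by_cases hij : j = ν i
  · simp [hij, hb.involutive]
  · rw [if_neg hij, if_neg fun hc => hij (by rw [← hb.involutive j, hc, ← hc, hc]), map_zero]

theorem form_lie_conjugation (m n p r : M) :
    q ⁅T (b.conjugation ν m) (b.conjugation ν n), b.conjugation ν p⁆ (b.conjugation ν r) =
      conj (q ⁅T m n, p⁆ r) := by
  refine b.forall_of_forall (P := fun m =>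
    q ⁅T (b.conjugation ν m) (b.conjugation ν n), b.conjugation ν p⁆ (b.conjugation ν r) =
      conj (q ⁅T m n, p⁆ r))
    (by simp) (fun _ _ h1 h2 => by simp [h1, h2]) (fun c _ h1 => by simp [h1]) (fun i => ?_) m
  refine b.forall_of_forall (P := fun n =>
    q ⁅T (b.conjugation ν (b i)) (b.conjugation ν n), b.conjugation ν p⁆ (b.conjugation ν r) =
      conj (q ⁅T (b i) n, p⁆ r))
    (by simp) (fun _ _ h1 h2 => by simp [h1, h2]) (fun c _ h1 => by simp [h1]) (fun j => ?_) n
  refine b.forall_of_forall (P := fun p =>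
    q ⁅T (b.conjugation ν (b i)) (b.conjugation ν (b j)), b.conjugation ν p⁆ (b.conjugation ν r) =
      conj (q ⁅T (b i) (b j), p⁆ r))
    (by simp) (fun _ _ h1 h2 => by simp [h1, h2]) (fun c _ h1 => by simp [h1]) (fun k => ?_) p
  refine b.forall_of_forall (P := fun r =>
    q ⁅T (b.conjugation ν (b i)) (b.conjugation ν (b j)), b.conjugation ν (b k)⁆
      (b.conjugation ν r) = conj (q ⁅T (b i) (b j), b k⁆ r))
    (by simp) (fun _ _ h1 h2 => by simp [h1, h2]) (fun c _ h1 => by simp [h1]) (fun l => ?_) r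
  simp only [b.conjugation_apply_self, hb.real]

variable (h : IsMomentMap q T)
include h

theorem lie_conjugation (m n p : M) :
    ⁅T (b.conjugation ν m) (b.conjugation ν n), b.conjugation ν p⁆ =
      b.conjugation ν ⁅T m n, p⁆ := by
  refine h.ext_form fun r => ?_
  rw [← hb.conjugation_involutive r, hb.form_lie_conjugation, hb.form_conjugation]

/-- Conjugating `T(m, n)` by `J` gives the action of `T(J m, J n)`, and the values of `T` span.
Faithfulness later makes `a'` unique, which defines `σ`. -/
theorem exists_lie_eq (a : 𝔤) : ∃ a' : 𝔤, ∀ m,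
    ⁅a', m⁆ = b.conjugation ν ⁅a, b.conjugation ν m⁆ := by
  have ha : a ∈ Submodule.span ℂ {a | ∃ m n, a = T m n} := h.span ▸ Submodule.mem_top
  induction ha using Submodule.span_induction with
  | mem a ha =>
    obtain ⟨m, n, rfl⟩ := ha
    exact ⟨T (b.conjugation ν m) (b.conjugation ν n), fun p => by
      rw [← hb.lie_conjugation h, hb.conjugation_involutive]⟩
  | zero => exact ⟨0, by simp⟩
  | add x y _ _ hx hy =>
    obtain ⟨u, hu⟩ := hx
    obtain ⟨v, hv⟩ := hy
    exact ⟨u + v, fun m => by simp [hu, hv]⟩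
  | smul c x _ hx =>
    obtain ⟨u, hu⟩ := hx
    exact ⟨conj c • u, fun m => by simp [hu]⟩

/-- Commuting with the conjugation and skewness for `q` together make the matrix `A` of `a` in the
basis `b` skew-Hermitian, so the trace of `A²` is `-∑ |A_ij|²`. -/
theorem traceForm_neg {a : 𝔤} (hfix : ∀ m, ⁅a, b.conjugation ν m⁆ = b.conjugation ν ⁅a, m⁆)
    (ha : a ≠ 0) : (traceForm ℂ 𝔤 M a a).re < 0 := by
  let A : Matrix ι ι ℂ := LinearMap.toMatrix b b (toEnd ℂ 𝔤 M a)
  have hA : ∀ i j, A i j = b.repr ⁅a, b j⁆ i := fun i j =>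
    LinearMap.toMatrix_apply b b _ i j
  have hqA : ∀ i j, q ⁅a, b j⁆ (b i) = A (ν i) j := by
    intro i j
    rw [hA]
    conv_lhs => rw [← b.sum_repr ⁅a, b j⁆]
    rw [map_sum, LinearMap.sum_apply, Finset.sum_eq_single (ν i)]
    · simp [hb.form, hb.involutive]
    · intro k _ hk
      have : i ≠ ν k := fun hc => hk (by rw [hc, hb.involutive])
      simp [hb.form, this]
    · simp
  have hconj : ∀ i j, A (ν i) (ν j) = conj (A i j) := by
    intro i j
    rw [← hqA, ← hb.involutive i, ← hqA, ← b.conjugation_apply_self ν j, hfix,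
      ← b.conjugation_apply_self ν, hb.form_conjugation]
  have hskew : ∀ i j, A j i = -conj (A i j) := by
    intro i j
    have h1 := h.skew a (b j) (b (ν i))
    rw [hqA, hb.involutive, h.symm, hqA] at h1
    rw [h1, map_neg, neg_neg, ← hconj, hb.involutive, hb.involutive]
  have htr : traceForm ℂ 𝔤 M a a = -((∑ i, ∑ j, Complex.normSq (A i j) : ℝ) : ℂ) := by
    rw [traceForm_apply_apply, LinearMap.trace_eq_matrix_trace ℂ b, LinearMap.toMatrix_comp b b b]
    change ∑ i, ∑ j, A i j * A j i = _
    push_cast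
    rw [← Finset.sum_neg_distrib]
    refine Finset.sum_congr rfl fun i _ => ?_
    rw [← Finset.sum_neg_distrib]
    refine Finset.sum_congr rfl fun j _ => ?_
    rw [hskew i j, mul_neg, Complex.mul_conj]
  rw [htr, Complex.neg_re, Complex.ofReal_re, neg_lt_zero]
  have hnn : ∀ i, 0 ≤ ∑ j, Complex.normSq (A i j) := fun i =>
    Finset.sum_nonneg fun j _ => Complex.normSq_nonneg _
  refine (Finset.sum_nonneg fun i _ => hnn i).lt_of_ne' fun h0 => ha ?_
  have hA0 : ∀ i j, A i j = 0 := by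
    intro i j
    have h1 := (Finset.sum_eq_zero_iff_of_nonneg fun i _ => hnn i).mp h0 i (Finset.mem_univ i)
    exact Complex.normSq_eq_zero.mp ((Finset.sum_eq_zero_iff_of_nonneg fun j _ =>
      Complex.normSq_nonneg _).mp h1 j (Finset.mem_univ j))
  have h2 : toEnd ℂ 𝔤 M a = 0 := by
    apply (LinearMap.toMatrix b b).injective
    rw [map_zero]
    ext i j
    exact hA0 i j
  exact h.faithful a fun m => LinearMap.congr_fun h2 m

theorem exists_isCompactConjugation : ∃ (J : M →ₛₗ[starRingEnd ℂ] M)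
    (σ : 𝔤 →ₛₗ[starRingEnd ℂ] 𝔤), IsCompactConjugation q T J σ := by
  choose σ hσ using hb.exists_lie_eq h
  have hext : ∀ a a' : 𝔤, (∀ m : M, ⁅a, m⁆ = ⁅a', m⁆) → a = a' := fun a a' haa =>
    sub_eq_zero.mp (h.faithful _ fun m => by rw [sub_lie, haa, sub_self])
  have hlie : ∀ a m, ⁅σ a, b.conjugation ν m⁆ = b.conjugation ν ⁅a, m⁆ := fun a m => by
    rw [hσ, hb.conjugation_involutive]
  refine ⟨b.conjugation ν, { toFun := σ, map_add' := ?_, map_smul' := ?_ },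
    hb.conjugation_involutive, ?_, hb.form_conjugation, ?_, hlie, ?_⟩
  · exact fun a a' => hext _ _ fun m => by simp [hσ]
  · exact fun c a => hext _ _ fun m => by simp [hσ]
  · exact fun a => hext _ _ fun m => by simp [hσ, hb.conjugation_involutive]
  · refine fun m n => hext _ _ fun p => ?_
    change ⁅σ (T m n), p⁆ = _
    rw [hσ, ← hb.lie_conjugation h, hb.conjugation_involutive]
  · intro a hfix ha
    change σ a = a at hfix
    refine hb.traceForm_neg h (fun m => ?_) ha
    rw [← hlie, hfix]

end IsCompactBasis

end CompactConjugation

/-! ### Extension of the conjugations to the whole superalgebra. -/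

namespace LieSuperalgebra

variable {V : Type*} [AddCommGroup V] [Module ℂ V] {L : LieSuperalgebra V}

/-- The parametrisation of `L` by `sl₂`, the centralizer of `sl₂` and two copies of the odd
eigenspace of `ad x` for the eigenvalue `-1/2`. -/
noncomputable def assemble (L : LieSuperalgebra V) (e x f : V) :
    (ℂ × ℂ × ℂ) × L.evenCentralizer e x f × L.oddHalf x × L.oddHalf x →ₗ[ℂ] V where
  toFun u := u.1.1 • e + u.1.2.1 • x + u.1.2.2 • f + ((u.2.1 : L.Even) : V) +
    ((u.2.2.1 : V) + L.br e u.2.2.2)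
  map_add' u v := by
    simp only [Prod.fst_add, Prod.snd_add, Submodule.coe_add, map_add]
    change _ + (((u.2.1 : L.Even) : V) + ((v.2.1 : L.Even) : V)) + _ = _
    module
  map_smul' c u := by
    simp only [Prod.smul_fst, Prod.smul_snd, Submodule.coe_smul, map_smul, RingHom.id_apply]
    change _ + c • ((u.2.1 : L.Even) : V) + _ = _
    module

/-- `φ` fixes `e, x, f`, restricts to `σ` on the centralizer of `sl₂`, and to `J` on both odd
eigenspaces of `ad x`. -/
structure IsExtension (L : LieSuperalgebra V) (e x f : V)
    (J : L.oddHalf x →ₛₗ[starRingEnd ℂ] L.oddHalf x)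
    (σ : L.evenCentralizer e x f →ₛₗ[starRingEnd ℂ] L.evenCentralizer e x f)
    (φ : V →ₛₗ[starRingEnd ℂ] V) : Prop where
  map_e : φ e = e
  map_x : φ x = x
  map_f : φ f = f
  map_even : ∀ a : L.evenCentralizer e x f, φ ((a : L.Even) : V) = ((σ a : L.Even) : V)
  map_half : ∀ m : L.oddHalf x, φ m = J m
  map_br_e_half : ∀ m : L.oddHalf x, φ (L.br e m) = L.br e (J m)

namespace IsMinimalTriple

open LieModule

variable {B : V →ₗ[ℂ] V →ₗ[ℂ] ℂ} {e x f : V} (h : L.IsMinimalTriple B e x f)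
include h

theorem assemble_injective : Function.Injective (L.assemble e x f) := by
  rw [← LinearMap.ker_eq_bot, LinearMap.ker_eq_bot']
  rintro ⟨⟨α, β, γ⟩, a, m, n⟩ h0
  change α • e + β • x + γ • f + ((a : L.Even) : V) + ((m : V) + L.br e n) = 0 at h0
  have hodd : (m : V) + L.br e n ∈ L.part 1 := add_mem m.2.1 (h.br_e_half_odd n.2)
  have heven : α • e + β • x + γ • f + ((a : L.Even) : V) ∈ L.part 0 :=
    add_mem (h.sl2_mem _ _ _) (a : L.Even).2
  have h1 : (m : V) + L.br e n = 0 := by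
    refine (Submodule.disjoint_def.mp L.isCompl.disjoint) _ ?_ hodd
    rw [eq_neg_of_add_eq_zero_right h0]
    exact neg_mem heven
  rw [h1, add_zero] at h0
  obtain ⟨rfl, rfl, rfl, ha⟩ := h.sl2_add_natural_eq_zero (h.coe_mem_natural a) h0
  obtain ⟨hm, hn⟩ := h.half_add_eq_zero m.2 n.2 h1
  obtain rfl : m = 0 := Subtype.ext hm
  obtain rfl : n = 0 := Subtype.ext hn
  obtain rfl : a = 0 := h.ext_evenCentralizer ha
  rfl

theorem exists_even_eq {v : V} (hv : v ∈ L.part 0) : ∃ (α β γ : ℂ) (a : L.evenCentralizer e x f),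
    v = α • e + β • x + γ • f + ((a : L.Even) : V) := by
  obtain ⟨α, β, γ, g, hg, rfl⟩ := h.exists_split hv
  exact ⟨α, β, γ, ⟨⟨g, h.natural_le hg⟩, (h.mem_evenCentralizer _).mpr hg⟩, rfl⟩

theorem exists_odd_eq {v : V} (hv : v ∈ L.part 1) : ∃ (m n : L.oddHalf x),
    v = (m : V) + L.br e n := by
  obtain ⟨m, hm, n, hn, rfl⟩ := h.exists_half_add hv
  exact ⟨⟨m, hm⟩, ⟨n, hn⟩, rfl⟩

theorem assemble_surjective : Function.Surjective (L.assemble e x f) := by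
  intro v
  obtain ⟨v₀, h₀, v₁, h₁, rfl⟩ := L.exists_add_eq v
  obtain ⟨α, β, γ, a, rfl⟩ := h.exists_even_eq h₀
  obtain ⟨m, n, rfl⟩ := h.exists_odd_eq h₁
  exact ⟨⟨⟨α, β, γ⟩, a, m, n⟩, rfl⟩

theorem forall_of_forall {P : V → Prop} (hadd : ∀ u v, P u → P v → P (u + v))
    (hsmul : ∀ (c : ℂ) u, P u → P (c • u)) (he : P e) (hx : P x) (hf : P f)
    (ha : ∀ a : L.evenCentralizer e x f, P ((a : L.Even) : V)) (hm : ∀ m : L.oddHalf x, P m)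
    (hn : ∀ m : L.oddHalf x, P (L.br e m)) (v : V) : P v := by
  obtain ⟨⟨⟨α, β, γ⟩, a, m, n⟩, rfl⟩ := h.assemble_surjective v
  exact hadd _ _ (hadd _ _ (hadd _ _ (hadd _ _ (hsmul _ _ he) (hsmul _ _ hx)) (hsmul _ _ hf))
    (ha a)) (hadd _ _ (hm m) (hn n))

theorem exists_extension (J : L.oddHalf x →ₛₗ[starRingEnd ℂ] L.oddHalf x)
    (σ : L.evenCentralizer e x f →ₛₗ[starRingEnd ℂ] L.evenCentralizer e x f) :
    ∃ φ : V →ₛₗ[starRingEnd ℂ] V, L.IsExtension e x f J σ φ := by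
  let F : (ℂ × ℂ × ℂ) × L.evenCentralizer e x f × L.oddHalf x × L.oddHalf x
      →ₛₗ[starRingEnd ℂ] (ℂ × ℂ × ℂ) × L.evenCentralizer e x f × L.oddHalf x × L.oddHalf x :=
    { toFun := fun u => ((conj u.1.1, conj u.1.2.1, conj u.1.2.2), σ u.2.1, J u.2.2.1, J u.2.2.2)
      map_add' := fun u v => by simp
      map_smul' := fun c u => by simp }
  let Φ := LinearEquiv.ofBijective (L.assemble e x f) ⟨h.assemble_injective, h.assemble_surjective⟩
  let φ : V →ₛₗ[starRingEnd ℂ] V :=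
    (Φ.toLinearMap.comp F).comp Φ.symm.toLinearMap
  have hφ : ∀ u, φ (L.assemble e x f u) = L.assemble e x f (F u) := fun u => by
    change Φ (F (Φ.symm (Φ u))) = _
    rw [LinearEquiv.symm_apply_apply]; rfl
  have hφ' : ∀ (α β γ : ℂ) (a : L.evenCentralizer e x f) (m n : L.oddHalf x),
      φ (α • e + β • x + γ • f + ((a : L.Even) : V) + ((m : V) + L.br e n)) =
      conj α • e + conj β • x + conj γ • f + ((σ a : L.Even) : V) + ((J m : V) + L.br e (J n)) :=
    fun α β γ a m n => hφ ⟨⟨α, β, γ⟩, a, m, n⟩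
  have h0 : (((0 : L.evenCentralizer e x f) : L.Even) : V) = 0 := rfl
  refine ⟨φ, ?_, ?_, ?_, fun a => ?_, fun m => ?_, fun n => ?_⟩
  · simpa [h0] using hφ' 1 0 0 0 0 0
  · simpa [h0] using hφ' 0 1 0 0 0 0
  · simpa [h0] using hφ' 0 0 1 0 0 0
  · simpa [h0] using hφ' 0 0 0 a 0 0
  · simpa [h0] using hφ' 0 0 0 0 m 0
  · simpa [h0] using hφ' 0 0 0 0 0 n

section Extension

variable {J : L.oddHalf x →ₛₗ[starRingEnd ℂ] L.oddHalf x}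
  {σ : L.evenCentralizer e x f →ₛₗ[starRingEnd ℂ] L.evenCentralizer e x f}
  {φ : V →ₛₗ[starRingEnd ℂ] V} (hφ : L.IsExtension e x f J σ φ)
include hφ

theorem extension_even {v : V} (hv : v ∈ L.part 0) : φ v ∈ L.part 0 := by
  obtain ⟨α, β, γ, a, rfl⟩ := h.exists_even_eq hv
  simp only [map_add, LinearMap.map_smulₛₗ, hφ.map_e, hφ.map_x, hφ.map_f, hφ.map_even]
  exact add_mem (h.sl2_mem _ _ _) (σ a : L.Even).2

theorem extension_odd {v : V} (hv : v ∈ L.part 1) : φ v ∈ L.part 1 := by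
  obtain ⟨m, n, rfl⟩ := h.exists_odd_eq hv
  rw [map_add, hφ.map_half, hφ.map_br_e_half]
  exact add_mem (J m).2.1 (h.br_e_half_odd (J n).2)

theorem extension_natural {v : V} (hv : v ∈ L.natural e x f) : φ v ∈ L.natural e x f := by
  have := hφ.map_even ⟨⟨v, h.natural_le hv⟩, (h.mem_evenCentralizer _).mpr hv⟩
  change φ v = _ at this
  rw [this]
  exact h.coe_mem_natural _

variable (hc : IsCompactConjugation (L.halfForm B e x f) h.moment J σ)
include hc

theorem extension_involutive (v : V) : φ (φ v) = v := by
  refine h.forall_of_forall (P := fun v => φ (φ v) = v) (fun u v hu hv => by simp [hu, hv])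
    (fun c u hu => by simp [hu]) ?_ ?_ ?_ (fun a => ?_) (fun m => ?_) (fun m => ?_) v
  · rw [hφ.map_e, hφ.map_e]
  · rw [hφ.map_x, hφ.map_x]
  · rw [hφ.map_f, hφ.map_f]
  · rw [hφ.map_even, hφ.map_even, hc.involutive_lie]
  · rw [hφ.map_half, hφ.map_half, hc.involutive]
  · rw [hφ.map_br_e_half, hφ.map_br_e_half, hc.involutive]

theorem extension_br_e (v : V) : φ (L.br e v) = L.br e (φ v) := by
  refine h.forall_of_forall (P := fun v => φ (L.br e v) = L.br e (φ v))
    (fun u v hu hv => by simp [hu, hv]) (fun c u hu => by simp [hu]) ?_ ?_ ?_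
    (fun a => ?_) (fun m => ?_) (fun m => ?_) v
  · rw [hφ.map_e, h.br_self h.triple.e_even, map_zero]
  · rw [hφ.map_x, h.br_e_x, map_neg, hφ.map_e]
  · rw [hφ.map_f, h.triple.br_e_f, hφ.map_x]
  · rw [hφ.map_even, (h.mem_natural.mp (h.coe_mem_natural a)).1,
      (h.mem_natural.mp (h.coe_mem_natural (σ a))).1, map_zero]
  · rw [hφ.map_half, hφ.map_br_e_half]
  · rw [hφ.map_br_e_half, h.br_e_br_e_half m.2, h.br_e_br_e_half (J m).2, map_zero]

theorem extension_br_f (v : V) : φ (L.br f v) = L.br f (φ v) := by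
  refine h.forall_of_forall (P := fun v => φ (L.br f v) = L.br f (φ v))
    (fun u v hu hv => by simp [hu, hv]) (fun c u hu => by simp [hu]) ?_ ?_ ?_
    (fun a => ?_) (fun m => ?_) (fun m => ?_) v
  · rw [hφ.map_e, h.br_f_e, map_neg, hφ.map_x]
  · rw [hφ.map_x, h.br_f_x, hφ.map_f]
  · rw [hφ.map_f, h.br_self h.triple.f_even, map_zero]
  · rw [hφ.map_even, (h.mem_natural.mp (h.coe_mem_natural a)).2.2,
      (h.mem_natural.mp (h.coe_mem_natural (σ a))).2.2, map_zero]
  · rw [hφ.map_half, h.br_f_half m.2, h.br_f_half (J m).2, map_zero]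
  · rw [hφ.map_br_e_half, h.br_f_br_e_half m.2, h.br_f_br_e_half (J m).2, LinearMap.map_smulₛₗ,
      hφ.map_half]
    simp [map_ofNat]

theorem extension_br_half (m : L.oddHalf x) (v : V) : φ (L.br m v) = L.br (φ m) (φ v) := by
  have hskew : ∀ {a : V}, a ∈ L.part 0 → ∀ w, L.br w a = -L.br a w := fun ha w => by
    rw [L.even_skew ha, neg_neg]
  refine h.forall_of_forall (P := fun v => φ (L.br m v) = L.br (φ m) (φ v))
    (fun u v hu hv => by simp [hu, hv]) (fun c u hu => by simp [hu]) ?_ ?_ ?_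
    (fun a => ?_) (fun n => ?_) (fun n => ?_) v
  · rw [hskew h.triple.e_even, map_neg, h.extension_br_e hφ hc, hφ.map_e, hskew h.triple.e_even]
  · rw [hskew h.triple.x_even, hφ.map_x, hskew h.triple.x_even, h.br_x_half m.2, hφ.map_half,
      h.br_x_half (J m).2, map_neg, LinearMap.map_smulₛₗ, hφ.map_half]
    simp [map_ofNat]
  · rw [hskew h.triple.f_even, map_neg, h.extension_br_f hφ hc, hφ.map_f, hskew h.triple.f_even]
  · rw [hφ.map_even, hskew (a : L.Even).2, hskew (σ a : L.Even).2, map_neg, hφ.map_half,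
      ← coe_lie_oddHalf, ← coe_lie_oddHalf, hφ.map_half, hc.lie]
  · rw [hφ.map_half, hφ.map_half, h.br_half_half, h.br_half_half, hc.form, LinearMap.map_smulₛₗ,
      hφ.map_f]
  · rw [hφ.map_half, hφ.map_br_e_half, L.odd_comm m.2.1 (h.br_e_half_odd n.2),
      L.odd_comm (J m).2.1 (h.br_e_half_odd (J n).2), h.br_br_e_half_half, h.br_br_e_half_half,
      hc.form, map_sub, LinearMap.map_smulₛₗ, LinearMap.map_smulₛₗ, hφ.map_x, hφ.map_even,
      hc.moment]
    simp [map_ofNat]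

theorem extension_br_even {u w : V} (hu : u ∈ L.part 0) (h1 : ∀ v, φ (L.br u v) = L.br (φ u) (φ v))
    (h2 : ∀ v, φ (L.br w v) = L.br (φ w) (φ v)) (v : V) :
    φ (L.br (L.br u w) v) = L.br (φ (L.br u w)) (φ v) := by
  rw [← sub_eq_of_eq_add (L.even_jacobi hu w v), map_sub, h1, h1, h2, h2, h1,
    ← sub_eq_of_eq_add (L.even_jacobi (h.extension_even hφ hu) (φ w) (φ v))]

theorem extension_br_odd {u w : V} (hu : u ∈ L.part 1) (hw : w ∈ L.part 1)
    (h1 : ∀ v, φ (L.br u v) = L.br (φ u) (φ v))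
    (h2 : ∀ v, φ (L.br w v) = L.br (φ w) (φ v)) (v : V) :
    φ (L.br (L.br u w) v) = L.br (φ (L.br u w)) (φ v) := by
  rw [← add_eq_of_eq_sub (L.odd_jacobi hu hw v), map_add, h1, h1, h2, h2, h1,
    ← add_eq_of_eq_sub (L.odd_jacobi (h.extension_odd hφ hu) (h.extension_odd hφ hw) (φ v))]

/-- By the Jacobi identity, the property of `u` that `φ` intertwines `ad u` with `ad (φ u)` passes
to the brackets needed. It holds for `e`, `f` and `M`, and these generate `x`, `[e, M]` and, through
the values of `T`, all of `g^♮`. -/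
theorem extension_br (u v : V) : φ (L.br u v) = L.br (φ u) (φ v) := by
  have hadd : ∀ u w, (∀ v, φ (L.br u v) = L.br (φ u) (φ v)) →
      (∀ v, φ (L.br w v) = L.br (φ w) (φ v)) → ∀ v, φ (L.br (u + w) v) = L.br (φ (u + w)) (φ v) :=
    fun u w hu hw v => by simp [hu, hw]
  have hsmul : ∀ (c : ℂ) (u : V), (∀ v, φ (L.br u v) = L.br (φ u) (φ v)) →
      ∀ v, φ (L.br (c • u) v) = L.br (φ (c • u)) (φ v) := fun c u hu v => by simp [hu]
  have he : ∀ v, φ (L.br e v) = L.br (φ e) (φ v) := fun v => by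
    rw [hφ.map_e, h.extension_br_e hφ hc]
  have hf : ∀ v, φ (L.br f v) = L.br (φ f) (φ v) := fun v => by
    rw [hφ.map_f, h.extension_br_f hφ hc]
  have hx : ∀ v, φ (L.br x v) = L.br (φ x) (φ v) := by
    rw [← h.triple.br_e_f]
    exact h.extension_br_even hφ hc h.triple.e_even he hf
  have hm := h.extension_br_half hφ hc
  have hn : ∀ (m : L.oddHalf x) (v : V), φ (L.br (L.br e m) v) = L.br (φ (L.br e m)) (φ v) :=
    fun m => h.extension_br_even hφ hc h.triple.e_even he (hm m)
  refine h.forall_of_forall (P := fun u => ∀ v, φ (L.br u v) = L.br (φ u) (φ v)) hadd hsmul he hx hf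
    (fun a => ?_) hm hn u v
  have ha : a ∈ Submodule.span ℂ {a | ∃ m n, a = h.moment m n} := h.span_moment ▸ Submodule.mem_top
  induction ha using Submodule.span_induction with
  | mem a ha =>
    obtain ⟨m, n, rfl⟩ := ha
    rw [h.coe_moment]
    exact hadd _ _ (hsmul _ _ (h.extension_br_odd hφ hc (h.br_e_half_odd m.2) n.2.1 (hn m) (hm n)))
      (hsmul _ _ hx)
  | zero =>
    change ∀ v, φ (L.br 0 v) = L.br (φ 0) (φ v)
    simp
  | add a b _ _ h1 h2 => exact hadd _ _ h1 h2
  | smul c a _ h1 => exact hsmul c _ h1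

theorem extension_isConjInvolution : L.IsConjInvolution φ where
  involutive := h.extension_involutive hφ hc
  parity i v hv := by
    fin_cases i
    · exact h.extension_even hφ hv
    · exact h.extension_odd hφ hv
  map_br := h.extension_br hφ hc

theorem extension_isCompactOn : L.IsCompactOn φ (L.natural e x f) := by
  have := h.basic.finite
  refine ⟨fun a ha => h.extension_natural hφ ha, ?_⟩
  let ι : L.evenCentralizer e x f →ₗ[ℂ] V :=
    (L.part 0).subtype ∘ₗ (L.evenCentralizer e x f).toSubmodule.subtype
  -- Any linear retraction onto `g^♮` will do: it only serves to extend minus the real part of the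
  -- trace form of `M` to a form on `V`.
  obtain ⟨π, hπ⟩ := ι.exists_leftInverse_of_injective
    (LinearMap.ker_eq_bot.mpr fun a b hab => h.ext_evenCentralizer hab)
  have hπ' : ∀ a : L.evenCentralizer e x f, π ((a : L.Even) : V) = a := LinearMap.congr_fun hπ
  have hlift : ∀ a ∈ L.natural e x f, ∃ a' : L.evenCentralizer e x f, a = ((a' : L.Even) : V) :=
    fun a ha => ⟨⟨⟨a, h.natural_le ha⟩, (h.mem_evenCentralizer _).mpr ha⟩, rfl⟩
  let τ := traceForm ℂ (L.evenCentralizer e x f) (L.oddHalf x)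
  let β : V →ₗ[ℝ] V →ₗ[ℝ] ℝ := LinearMap.mk₂ ℝ (fun a b => -(τ (π a) (π b)).re)
    (fun a a' b => by simp; ring) (fun c a b => by simp [← Complex.coe_smul])
    (fun a b b' => by simp; ring) (fun c a b => by simp [← Complex.coe_smul])
  have hβ : ∀ a b : L.evenCentralizer e x f,
      β ((a : L.Even) : V) ((b : L.Even) : V) = -(τ a b).re := fun a b => by
    change -(τ (π _) (π _)).re = _
    rw [hπ', hπ']
  refine ⟨β, fun a ha b hb _ _ => ?_, fun a ha hfix ha0 => ?_, fun a ha b hb c hc _ _ _ => ?_⟩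
  · obtain ⟨a, rfl⟩ := hlift a ha
    obtain ⟨b, rfl⟩ := hlift b hb
    rw [hβ, hβ, traceForm_comm]
  · obtain ⟨a, rfl⟩ := hlift a ha
    rw [hβ, neg_pos]
    refine hc.neg a (h.ext_evenCentralizer ?_) fun h0 => ha0 (by rw [h0]; rfl)
    rw [← hφ.map_even, hfix]
  · obtain ⟨a, rfl⟩ := hlift a ha
    obtain ⟨b, rfl⟩ := hlift b hb
    obtain ⟨c, rfl⟩ := hlift c hc
    rw [← h.coe_lie_evenCentralizer, ← h.coe_lie_evenCentralizer, hβ, hβ, ← lie_skew, map_neg,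
      LinearMap.neg_apply, traceForm_apply_lie_apply]
    simp [τ]

theorem extension_isAlmostCompact : L.IsAlmostCompact e x f φ where
  conjInvolution := h.extension_isConjInvolution hφ hc
  map_e := hφ.map_e
  map_x := hφ.map_x
  map_f := hφ.map_f
  compact := h.extension_isCompactOn hφ hc

end Extension

end IsMinimalTriple
end LieSuperalgebra

theorem mainTheorem9 {V : Type*} [AddCommGroup V] [Module ℂ V]
    (L : LieSuperalgebra V) (B : V →ₗ[ℂ] V →ₗ[ℂ] ℂ) (hL : L.IsBasic B)
    (H : LieSubalgebra ℂ L.Even) (hH : H.IsCartanSubalgebra) (hreal : L.HasRealRootProducts B H)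
    (e x f : V) (htriple : L.IsTriple e x f)
    (hsplit : L.EvenPartSplits e x f) (hmin : L.IsMinimalGrading x f) :
    ∃ φ : V →ₛₗ[starRingEnd ℂ] V, L.IsAlmostCompact e x f φ := by
  have h : L.IsMinimalTriple B e x f := ⟨hL, htriple, hsplit, hmin⟩
  obtain ⟨n, b, ν, hb⟩ := h.exists_isCompactBasis H hreal
  obtain ⟨J, σ, hc⟩ := hb.exists_isCompactConjugation h.isMomentMap
  obtain ⟨φ, hφ⟩ := h.exists_extension J σ
  exact ⟨φ, h.extension_isAlmostCompact hφ hc⟩
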